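/- Let $i\mathsf{RCA}_0$ be the following theory in two-sorted intuitionistic predicate logic, with variables for natural numbers and for functions $\mathbb N\to\mathbb N$ and with equality between numbers: number terms are built from number variables, $0$, successor, values $f(t)$ of function variables, and primitive recursion; the non-logical axioms are the successor axioms, the defining equations of primitive recursion, induction for quantifier-free formulas, and quantifier-free choice $\forall x\,\exists y\,\varphi(x,y)\to\exists f\,\forall x\,\varphi(x,f(x))$ ($\varphi$ quantifier-free), where parameters of both sorts are allowed. Let $\mathsf{ACA}_0$ be the extension of $i\mathsf{RCA}_0$ by the scheme of arithmetical comprehension: for every formula $\varphi(x)$ without function quantifiers (number and function parameters allowed), $\exists f\,\forall x\,\bigl(f(x)\le 1\wedge(f(x)=1\leftrightarrow\varphi(x))\bigr)$. A function $e:\mathbb N\to\mathbb N$ codes a sequence $\langle G_i\rangle_{i\in\mathbb N}$ of graphs with vertex set $\mathbb N$: for $a<b$, the pair $(a,b)$ is an edge of $G_i$ if and only if $e(\langle i,p(a,b)\rangle)\neq 0$, where $\langle\cdot,\cdot\rangle$ is the Cantor pairing bijection $\mathbb N\times\mathbb N\to\mathbb N$ and $p(a,b)=\frac{b(b-1)}2+a$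 is a bijection from $\{(a,b): a<b\}$ onto $\mathbb N$. The $m$-th initial subgraph of $G_i$ is the subgraph of $G_i$ induced on the vertices $0,\dots,m$. It is $k$-colorable if there is (a code of) a finite sequence $s_0,\dots,s_m$ of numbers less than $k$ with $s_a\ne s_b$ for every edge $(a,b)$ of $G_i$ with $a<b\le m$. A $k$-coloring of $G_i$ is a function $c:\mathbb N\to\{0,\dots,k-1\}$ with $c(a)\neq c(b)$ for every edge $(a,b)$ of $G_i$. A function of two numbers $f(i,n)$ is coded as a function of $\langle i,n\rangle$. Let $\mathsf{C}(k)$ be the formula (with the number variable $k$ free) stating: for every sequence $\langle G_i\rangle_{i\in\mathbb N}$ of graphs there is a function $f:\mathbb N\times\mathbb N\to\mathbb N$ such that for each $i$, either $f(i,0)=m>0$ and the $m$-th initial subgraph of $G_i$ is not $k$-colorable, or $f(i,0)=0$ and $n\mapsto f(i,n)$ is a $k$-coloring of $G_i$. Then, over $i\mathsf{RCA}_0$, for $k\ge 2$, $\mathsf{ACA}_0$ is equivalent to $\mathsf C(k)$, where $k$ is a number variable of the theory. That is: 1. $i\mathsf{RCA}_0$ together with arithmetical comprehension proves $\forall k\,(k\ge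 2\to\mathsf C(k))$; and 2. for every arithmetical formula $\varphi$, possibly with parameters, $i\mathsf{RCA}_0$ proves $\forall k\,\bigl(k\ge 2\to(\mathsf C(k)\to\mathsf{CA}_\varphi)\bigr)$, where $\mathsf{CA}_\varphi$ is the instance of arithmetical comprehension for $\varphi$. In particular, for each fixed natural number $k\ge2$, $\mathsf{ACA}_0$ and $\mathsf C(k)$ are equivalent over $i\mathsf{RCA}_0$. -/

import Mathlib

namespace IRCA

/-- Number terms of the two-sorted language of second order arithmetic with function variables, in
de Bruijn style; number variables and function variables are indexed separately. `app f t` is the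
value of the `f`-th function variable at `t`. In `recur a b t` (primitive recursion), `b` binds two
number variables: variable `0` is the previous value, variable `1` the index of the previous step,
so that `h x = recur a b x` satisfies `h 0 = a` and `h (x + 1) = b (h x, x)`. -/
inductive Tm : Type
  | var (i : ℕ)
  | zero
  | succ (t : Tm)
  | app (f : ℕ) (t : Tm)
  | recur (a b t : Tm)

/-- Formulas: `all`, `ex` quantify over numbers, `fall`, `fex` over functions from `ℕ` to `ℕ`.
Each quantifier binds variable `0` of its sort. -/
inductive Fml : Type
  | eq (s t : Tm)
  | bot
  | and (φ ψ : Fml)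
  | or (φ ψ : Fml)
  | imp (φ ψ : Fml)
  | all (φ : Fml)
  | ex (φ : Fml)
  | fall (φ : Fml)
  | fex (φ : Fml)

/-! Renaming and substitution -/

/-- Push a renaming under a binder. -/
def upRen (r : ℕ → ℕ) : ℕ → ℕ
  | 0 => 0
  | n + 1 => r n + 1

/-- Rename number variables by `r` and function variables by `p`. -/
def Tm.ren (r p : ℕ → ℕ) : Tm → Tm
  | .var i => .var (r i)
  | .zero => .zero
  | .succ t => .succ (t.ren r p)
  | .app f t => .app (p f) (t.ren r p)
  | .recur a b t => .recur (a.ren r p) (b.ren (upRen (upRen r)) p) (t.ren r p)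

/-- Raise the number variables of a term by `n`. -/
def Tm.up (n : ℕ) (t : Tm) : Tm := t.ren (fun i => i + n) id

/-- Push a substitution under a number binder. -/
def upSub (σ : ℕ → Tm) : ℕ → Tm
  | 0 => .var 0
  | n + 1 => (σ n).up 1

/-- Simultaneously substitute `σ i` for the number variable `i` and rename function variables
by `p`. -/
def Tm.sub (σ : ℕ → Tm) (p : ℕ → ℕ) : Tm → Tm
  | .var i => σ i
  | .zero => .zero
  | .succ t => .succ (t.sub σ p)
  | .app f t => .app (p f) (t.sub σ p)
  | .recur a b t => .recur (a.sub σ p) (b.sub (upSub (upSub σ)) p) (t.sub σ p)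

/-- Capture-avoiding simultaneous substitution in formulas. -/
def Fml.sub (σ : ℕ → Tm) (p : ℕ → ℕ) : Fml → Fml
  | .eq s t => .eq (s.sub σ p) (t.sub σ p)
  | .bot => .bot
  | .and φ ψ => .and (φ.sub σ p) (ψ.sub σ p)
  | .or φ ψ => .or (φ.sub σ p) (ψ.sub σ p)
  | .imp φ ψ => .imp (φ.sub σ p) (ψ.sub σ p)
  | .all φ => .all (φ.sub (upSub σ) p)
  | .ex φ => .ex (φ.sub (upSub σ) p)
  | .fall φ => .fall (φ.sub (fun n => (σ n).ren id Nat.succ) (upRen p))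
  | .fex φ => .fex (φ.sub (fun n => (σ n).ren id Nat.succ) (upRen p))

/-- `scons a s` is the sequence `a, s 0, s 1, …`. -/
def scons {α : Type} (a : α) (s : ℕ → α) : ℕ → α
  | 0 => a
  | n + 1 => s n

/-- Replace the number variable `0` by `t` and lower the other number variables. -/
def Fml.inst (φ : Fml) (t : Tm) : Fml := φ.sub (scons t .var) id

/-- Replace the function variable `0` by the function variable `g` and lower the others. -/
def Fml.finst (φ : Fml) (g : ℕ) : Fml := φ.sub .var (scons g id)

/-- Raise all number variables by one. -/
def Fml.lift (φ : Fml) : Fml := φ.sub (fun n => .var (n + 1)) id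

/-- Raise all function variables by one. -/
def Fml.flift (φ : Fml) : Fml := φ.sub .var Nat.succ

def Fml.neg (φ : Fml) : Fml := .imp φ .bot

def Fml.iff (φ ψ : Fml) : Fml := .and (.imp φ ψ) (.imp ψ φ)

/-- Quantifier-free formulas. -/
def Fml.QF : Fml → Prop
  | .eq _ _ => True
  | .bot => True
  | .and φ ψ => φ.QF ∧ ψ.QF
  | .or φ ψ => φ.QF ∧ ψ.QF
  | .imp φ ψ => φ.QF ∧ ψ.QF
  | .all _ => False
  | .ex _ => False
  | .fall _ => False
  | .fex _ => False

/-- Arithmetical formulas: no function quantifiers; free function variables are allowed. -/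
def Fml.Arith : Fml → Prop
  | .eq _ _ => True
  | .bot => True
  | .and φ ψ => φ.Arith ∧ ψ.Arith
  | .or φ ψ => φ.Arith ∧ ψ.Arith
  | .imp φ ψ => φ.Arith ∧ ψ.Arith
  | .all φ => φ.Arith
  | .ex φ => φ.Arith
  | .fall _ => False
  | .fex _ => False

/-- `Prf T Γ φ`: natural deduction for two-sorted intuitionistic predicate logic with equality of
numbers; `φ` is derived from the hypotheses `Γ` and the non-logical schemata `T` (whose free
variables are read universally). -/
inductive Prf (T : Set Fml) : List Fml → Fml → Prop
  | ax {Γ φ} : φ ∈ T → Prf T Γ φ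
  | hyp {Γ φ} : φ ∈ Γ → Prf T Γ φ
  | botE {Γ} (φ) : Prf T Γ .bot → Prf T Γ φ
  | andI {Γ φ ψ} : Prf T Γ φ → Prf T Γ ψ → Prf T Γ (.and φ ψ)
  | andE₁ {Γ φ ψ} : Prf T Γ (.and φ ψ) → Prf T Γ φ
  | andE₂ {Γ φ ψ} : Prf T Γ (.and φ ψ) → Prf T Γ ψ
  | orI₁ {Γ φ ψ} : Prf T Γ φ → Prf T Γ (.or φ ψ)
  | orI₂ {Γ φ ψ} : Prf T Γ ψ → Prf T Γ (.or φ ψ)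
  | orE {Γ φ ψ χ} : Prf T Γ (.or φ ψ) → Prf T (φ :: Γ) χ → Prf T (ψ :: Γ) χ → Prf T Γ χ
  | impI {Γ φ ψ} : Prf T (φ :: Γ) ψ → Prf T Γ (.imp φ ψ)
  | impE {Γ φ ψ} : Prf T Γ (.imp φ ψ) → Prf T Γ φ → Prf T Γ ψ
  | allI {Γ φ} : Prf T (Γ.map Fml.lift) φ → Prf T Γ (.all φ)
  | allE {Γ φ} (t : Tm) : Prf T Γ (.all φ) → Prf T Γ (φ.inst t)
  | exI {Γ φ} (t : Tm) : Prf T Γ (φ.inst t) → Prf T Γ (.ex φ)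
  | exE {Γ φ ψ} : Prf T Γ (.ex φ) → Prf T (φ :: Γ.map Fml.lift) ψ.lift → Prf T Γ ψ
  | fallI {Γ φ} : Prf T (Γ.map Fml.flift) φ → Prf T Γ (.fall φ)
  | fallE {Γ φ} (g : ℕ) : Prf T Γ (.fall φ) → Prf T Γ (φ.finst g)
  | fexI {Γ φ} (g : ℕ) : Prf T Γ (φ.finst g) → Prf T Γ (.fex φ)
  | fexE {Γ φ ψ} : Prf T Γ (.fex φ) → Prf T (φ :: Γ.map Fml.flift) ψ.flift → Prf T Γ ψ
  | eqI {Γ} (t : Tm) : Prf T Γ (.eq t t)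
  | eqE {Γ s t} (φ : Fml) : Prf T Γ (.eq s t) → Prf T Γ (φ.inst s) → Prf T Γ (φ.inst t)

/-- `φ` is provable from `T` in intuitionistic logic. -/
def Provable (T : Set Fml) (φ : Fml) : Prop := Prf T [] φ

/-- The intuitionistic system `iRCA₀`, in its function-based form: successor, primitive recursion
(relative to function variables), quantifier-free induction, and quantifier-free choice from numbers
to numbers, all with arbitrary parameters. Explicit definition of functions is the case
`y = t(x)` of quantifier-free choice. -/
inductive IsIRCA0 : Fml → Prop
  | succ_ne_zero (t : Tm) : IsIRCA0 (Fml.neg (.eq (.succ t) .zero))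
  | succ_inj (s t : Tm) : IsIRCA0 (.imp (.eq (.succ s) (.succ t)) (.eq s t))
  | recur_zero (a b : Tm) : IsIRCA0 (.eq (.recur a b .zero) a)
  | recur_succ (a b t : Tm) :
      IsIRCA0 (.eq (.recur a b (.succ t)) (b.sub (scons (.recur a b t) (scons t .var)) id))
  /-- `φ(0) → ∀ x (φ(x) → φ(x + 1)) → ∀ x φ(x)` -/
  | ind (φ : Fml) : φ.QF →
      IsIRCA0 (.imp (φ.inst .zero)
        (.imp (.all (.imp φ (φ.sub (scons (.succ (.var 0)) fun n => .var (n + 1)) id))) (.all φ)))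
  /-- `∀ x ∃ y φ(x, y) → ∃ f ∀ x φ(x, f x)` -/
  | choice (φ : Fml) : φ.QF →
      IsIRCA0 (.imp (.all (.ex φ)) (.fex (.all (φ.sub (scons (.app 0 (.var 0)) .var) Nat.succ))))

def IRCA0 : Set Fml := {φ | IsIRCA0 φ}

/-! Primitive recursive terms -/

def Tm.one : Tm := .succ .zero

def Tm.add (s t : Tm) : Tm := .recur s (.succ (.var 0)) t

def Tm.pred (t : Tm) : Tm := .recur .zero (.var 1) t

/-- Truncated subtraction. -/
def Tm.monus (s t : Tm) : Tm := .recur s (Tm.pred (.var 0)) t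

/-- `tri n = 0 + 1 + ⋯ + (n - 1)`. -/
def Tm.tri (t : Tm) : Tm := .recur .zero (Tm.add (.var 0) (.var 1)) t

/-- The Cantor bijection `(s, t) ↦ (0 + 1 + ⋯ + (s + t)) + s` from `ℕ × ℕ` to `ℕ`. -/
def Tm.pair (s t : Tm) : Tm := Tm.add (Tm.tri (.succ (Tm.add s t))) s

/-- `diag z` is the sum of the two components of the pair coded by `z`, that is, the largest `d`
with `0 + 1 + ⋯ + d ≤ z`. -/
def Tm.diag (z : Tm) : Tm :=
  .recur .zero
    (Tm.add (.var 0)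
      (Tm.monus Tm.one (Tm.monus (Tm.tri (.succ (.succ (.var 0)))) (.succ (.var 1))))) z

/-- First component of the pair coded by `z`. -/
def Tm.fst (z : Tm) : Tm := Tm.monus z (Tm.tri (.succ (Tm.diag z)))

/-- Second component of the pair coded by `z`. -/
def Tm.snd (z : Tm) : Tm := Tm.monus (Tm.diag z) (Tm.fst z)

/-- The `a`-th entry of the finite sequence coded by `s`, where `x₀, …, xₘ` has the code
`pair x₀ (pair x₁ (… (pair xₘ 0)))`. -/
def Tm.entry (s a : Tm) : Tm := Tm.fst (.recur s (Tm.snd (.var 0)) a)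

/-- The code of the pair `(a, b)` under the bijection from `{(a, b) | a < b}` to `ℕ`. -/
def Tm.edgeCode (a b : Tm) : Tm := Tm.add (Tm.tri b) a

/-- `s ≤ t`. -/
def Fml.le (s t : Tm) : Fml := .eq (Tm.monus s t) .zero

/-- `s < t`. -/
def Fml.lt (s t : Tm) : Fml := Fml.le (.succ s) t

/-! Arithmetical comprehension -/

/-- Comprehension for `φ(x)`, where `x` is the number variable `0`: the set of all `x` with `φ(x)`
has a characteristic function, `∃ f ∀ x (f x ≤ 1 ∧ (f x = 1 ↔ φ(x)))`. -/
def Fml.comprehension (φ : Fml) : Fml :=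
  .fex (.all (.and (Fml.le (.app 0 (.var 0)) Tm.one)
    (Fml.iff (.eq (.app 0 (.var 0)) Tm.one) φ.flift)))

/-- The schema of arithmetical comprehension, with arbitrary parameters. -/
def ACA : Set Fml := {ψ | ∃ φ : Fml, φ.Arith ∧ ψ = φ.comprehension}

/-! Sequences of graphs. A function `e` codes the sequence of graphs `Gᵢ` on the vertex set `ℕ` in
which, for `a < b`, the pair `(a, b)` is an edge of `Gᵢ` if and only if
`e (pair i (edgeCode a b)) ≠ 0`. -/

/-- For `a < b`: `(a, b)` is an edge of the graph `Gᵢ` coded by the function variable `e`. -/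
def edge (e : ℕ) (i a b : Tm) : Fml :=
  Fml.neg (.eq (.app e (Tm.pair i (Tm.edgeCode a b))) .zero)

/-- The initial subgraph of `Gᵢ` with the vertices `0, …, m` has a `k`-coloring:
there is (a code of) a finite sequence `s` such that `∀ a ≤ m, s a < k`, and for all `a < b ≤ m`,
if `(a, b)` is an edge of `Gᵢ` then `s a ≠ s b`. -/
def initialColorable (e : ℕ) (k i m : Tm) : Fml :=
  .ex (.and
    -- here `s` is variable 1 and `a` is variable 0
    (.all (.imp (Fml.le (.var 0) (m.up 2)) (Fml.lt (Tm.entry (.var 1) (.var 0)) (k.up 2))))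
    -- here `s` is variable 2, `a` is variable 1 and `b` is variable 0
    (.all (.all (.imp (Fml.lt (.var 1) (.var 0)) (.imp (Fml.le (.var 0) (m.up 3))
      (.imp (edge e (i.up 3) (.var 1) (.var 0))
        (Fml.neg (.eq (Tm.entry (.var 2) (.var 1)) (Tm.entry (.var 2) (.var 0))))))))))

/-- The function `n ↦ f (pair i n)` is a `k`-coloring of `Gᵢ`. -/
def isColoring (e f : ℕ) (k i : Tm) : Fml :=
  .and
    (.all (Fml.lt (.app f (Tm.pair (i.up 1) (.var 0))) (k.up 1)))
    -- here `a` is variable 1 and `b` is variable 0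
    (.all (.all (.imp (Fml.lt (.var 1) (.var 0)) (.imp (edge e (i.up 2) (.var 1) (.var 0))
      (Fml.neg (.eq (.app f (Tm.pair (i.up 2) (.var 1))) (.app f (Tm.pair (i.up 2) (.var 0)))))))))

/-- For every sequence of graphs `Gᵢ` (coded by `e`, function variable 1) there is a function `f`
(function variable 0) such that for every `i` (number variable 0), either `f (i, 0) = m > 0` and the
`m`-th initial subgraph of `Gᵢ` has no `k`-coloring, or `f (i, 0) = 0` and `n ↦ f (i, n)` is a
`k`-coloring of `Gᵢ`. -/
def totalColoring (k : Tm) : Fml :=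
  .fall (.fex (.all (.or
    (.and (Fml.lt .zero (.app 0 (Tm.pair (.var 0) .zero)))
      (Fml.neg (initialColorable 1
        ((k.ren id (fun n => n + 2)).up 1) (.var 0) (.app 0 (Tm.pair (.var 0) .zero)))))
    (.and (.eq (.app 0 (Tm.pair (.var 0) .zero)) .zero)
      (isColoring 1 0 ((k.ren id (fun n => n + 2)).up 1) (.var 0))))))

/-- `2 ≤ k`. -/
def twoLe (k : Tm) : Fml := Fml.le (.succ (.succ .zero)) k

end IRCA

namespace IRCA

/-! Algebra of substitutions -/

/-! Intuitionistic derivations are hardly ever written out; they are replaced by a completeness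
argument. A `World` is a prime theory: consistent, deductively closed, with the disjunction property
and with witnesses for both existential quantifiers. By a Lindenbaum construction, a formula that
lies in every world containing `Γ` is derivable from `Γ` (`Prf.of_worlds`). Contexts are finite
lists, so unused variables always exist and can serve as witnesses; no new constants are needed.

Terms modulo provable equality and the function variables make each world into a classical
two-sorted structure. Membership in the world follows Tarski's clauses for `∧`, `∨`, `∃`, but in
general not for `→` and `∀`, which speak about all larger worlds. Equations, however, are decided in
every world, hence so are quantifier-free formulas (`Fml.QF.strongDec`), and the structure satisfies
quantifier-free induction (`World.induct`). Classical arguments can therefore be carried out inside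
one world. Only where an implication or a universal formula has to be put into a theory must a
derivation, or a check in all worlds, be supplied.

From coloring to comprehension: to decide `∃ n, g (x, n) ≠ 0` uniformly in `x`, let `G_x` join `a <
b` when `g (x, n) ≠ 0` for some `n ≤ a`. Without a witness the graph is edgeless and every initial
subgraph has a constant coloring, so `f (x, 0) = 0`. With a witness `n` the vertices from `n` on
form an infinite clique, and a coloring would contradict the pigeonhole principle
(`World.pigeonhole`, proved for an arbitrary, possibly nonstandard, `k`), so `f (x, 0) ≠ 0`. Thus `f
(x, 0)` decides the Σ₁ formula (`Prf.decider_of_totalColoring`). Induction on arithmetical formulas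
gives deciding functions for all of them (`Fml.Arith.decided`); `∀` is handled as `¬∃¬`, which is
sound because the matrix is already decided.

From comprehension to coloring: comprehension yields excluded middle for arithmetical formulas, so
in each world arithmetical membership is Tarskian truth (`Fml.Arith.strongDec`) and the structure
behaves as a classical model. There the usual compactness proof works: a partial coloring that
extends to colorings of all initial subgraphs can be prolonged by one more vertex with the same
property, and arithmetical choice iterates this uniformly in all graphs. A permutation of the colors
gives vertex `0` the color `0`, as the principle demands. -/

theorem upRen_succ (r : ℕ → ℕ) (n : ℕ) : upRen r (n + 1) = r n + 1 := rfl

theorem upRen_comp (r s : ℕ → ℕ) : (fun n => upRen s (upRen r n)) = upRen (fun n => s (r n)) := by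
  funext n; cases n <;> rfl

theorem Tm.ren_ren (t : Tm) : ∀ (r s p q : ℕ → ℕ),
    (t.ren r p).ren s q = t.ren (fun n => s (r n)) (fun n => q (p n)) := by
  induction t with
  | var i => intros; rfl
  | zero => intros; rfl
  | succ t ih => intros; simp [Tm.ren, ih]
  | app f t ih => intros; simp [Tm.ren, ih]
  | recur a b t iha ihb iht => intros; simp [Tm.ren, iha, ihb, iht, upRen_comp]

theorem upSub_upRen (r : ℕ → ℕ) (σ : ℕ → Tm) :
    (fun n => upSub σ (upRen r n)) = upSub (fun n => σ (r n)) := by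
  funext n; cases n <;> rfl

theorem Tm.sub_ren (t : Tm) : ∀ (r p : ℕ → ℕ) (σ : ℕ → Tm) (q : ℕ → ℕ),
    (t.ren r p).sub σ q = t.sub (fun n => σ (r n)) (fun n => q (p n)) := by
  induction t with
  | var i => intros; rfl
  | zero => intros; rfl
  | succ t ih => intros; simp [Tm.ren, Tm.sub, ih]
  | app f t ih => intros; simp [Tm.ren, Tm.sub, ih]
  | recur a b t iha ihb iht => intros; simp [Tm.ren, Tm.sub, iha, ihb, iht, upSub_upRen]

theorem upRen_upSub (r q : ℕ → ℕ) (σ : ℕ → Tm) :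
    (fun n => (upSub σ n).ren (upRen r) q) = upSub (fun n => (σ n).ren r q) := by
  funext n
  cases n with
  | zero => rfl
  | succ n => simp [upSub, Tm.up, Tm.ren_ren, upRen]

theorem Tm.ren_sub (t : Tm) : ∀ (σ : ℕ → Tm) (p r q : ℕ → ℕ),
    (t.sub σ p).ren r q = t.sub (fun n => (σ n).ren r q) (fun n => q (p n)) := by
  induction t with
  | var i => intros; rfl
  | zero => intros; rfl
  | succ t ih => intros; simp [Tm.ren, Tm.sub, ih]
  | app f t ih => intros; simp [Tm.ren, Tm.sub, ih]
  | recur a b t iha ihb iht => intros; simp [Tm.ren, Tm.sub, iha, ihb, iht, upRen_upSub]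

theorem upSub_upSub (σ τ : ℕ → Tm) (q : ℕ → ℕ) :
    (fun n => (upSub σ n).sub (upSub τ) q) = upSub (fun n => (σ n).sub τ q) := by
  funext n
  cases n with
  | zero => rfl
  | succ n => simp [upSub, Tm.up, Tm.sub_ren, Tm.ren_sub]

theorem Tm.sub_sub (t : Tm) : ∀ (σ : ℕ → Tm) (p : ℕ → ℕ) (τ : ℕ → Tm) (q : ℕ → ℕ),
    (t.sub σ p).sub τ q = t.sub (fun n => (σ n).sub τ q) (fun n => q (p n)) := by
  induction t with
  | var i => intros; rfl
  | zero => intros; rfl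
  | succ t ih => intros; simp [Tm.sub, ih]
  | app f t ih => intros; simp [Tm.sub, ih]
  | recur a b t iha ihb iht => intros; simp [Tm.sub, iha, ihb, iht, upSub_upSub]

theorem upSub_var : upSub .var = .var := by
  funext n; cases n <;> rfl

theorem upRen_id : upRen (fun n => n) = fun n => n := by
  funext n; cases n <;> rfl

theorem Tm.sub_var (t : Tm) : t.sub .var (fun n => n) = t := by
  induction t with
  | var i => rfl
  | zero => rfl
  | succ t ih => simp [Tm.sub, ih]
  | app f t ih => simp [Tm.sub, ih]
  | recur a b t iha ihb iht => simp [Tm.sub, iha, ihb, iht, upSub_var]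

theorem Tm.ren_eq_sub (t : Tm) (r p : ℕ → ℕ) : t.ren r p = t.sub (fun n => .var (r n)) p := by
  have := Tm.sub_var (t.ren r p)
  rw [Tm.sub_ren] at this
  exact this.symm

theorem Fml.sub_sub (φ : Fml) : ∀ (σ : ℕ → Tm) (p : ℕ → ℕ) (τ : ℕ → Tm) (q : ℕ → ℕ),
    (φ.sub σ p).sub τ q = φ.sub (fun n => (σ n).sub τ q) (fun n => q (p n)) := by
  induction φ with
  | eq s t => intros; simp [Fml.sub, Tm.sub_sub]
  | bot => intros; rfl
  | and φ ψ ih₁ ih₂ => intros; simp [Fml.sub, ih₁, ih₂]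
  | or φ ψ ih₁ ih₂ => intros; simp [Fml.sub, ih₁, ih₂]
  | imp φ ψ ih₁ ih₂ => intros; simp [Fml.sub, ih₁, ih₂]
  | all φ ih => intros; simp [Fml.sub, ih, upSub_upSub]
  | ex φ ih => intros; simp [Fml.sub, ih, upSub_upSub]
  | fall φ ih => intros; simp [Fml.sub, ih, Tm.sub_ren, Tm.ren_sub, upRen_comp, upRen_succ]
  | fex φ ih => intros; simp [Fml.sub, ih, Tm.sub_ren, Tm.ren_sub, upRen_comp, upRen_succ]

theorem Fml.sub_var (φ : Fml) : φ.sub .var (fun n => n) = φ := by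
  induction φ with
  | eq s t => simp [Fml.sub, Tm.sub_var]
  | bot => rfl
  | and φ ψ ih₁ ih₂ => simp [Fml.sub, ih₁, ih₂]
  | or φ ψ ih₁ ih₂ => simp [Fml.sub, ih₁, ih₂]
  | imp φ ψ ih₁ ih₂ => simp [Fml.sub, ih₁, ih₂]
  | all φ ih => simp [Fml.sub, ih, upSub_var]
  | ex φ ih => simp [Fml.sub, ih, upSub_var]
  | fall φ ih => simp [Fml.sub, ih, Tm.ren, upRen_id]
  | fex φ ih => simp [Fml.sub, ih, Tm.ren, upRen_id]

theorem Fml.sub_congr (φ : Fml) {σ τ : ℕ → Tm} {p q : ℕ → ℕ} (h : ∀ n, σ n = τ n)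
    (h' : ∀ n, p n = q n) : φ.sub σ p = φ.sub τ q := by
  rw [funext h, funext h']

theorem Tm.sub_congr (t : Tm) {σ τ : ℕ → Tm} {p q : ℕ → ℕ} (h : ∀ n, σ n = τ n)
    (h' : ∀ n, p n = q n) : t.sub σ p = t.sub τ q := by
  rw [funext h, funext h']

/-- Instances of a substituted quantified formula are brought to the form `scons t σ`, the syntactic
counterpart of the extended assignments in Tarski's clauses for quantifiers. -/
theorem Fml.inst_sub_upSub (φ : Fml) (σ : ℕ → Tm) (p : ℕ → ℕ) (t : Tm) :
    (φ.sub (upSub σ) p).inst t = φ.sub (scons t σ) p := by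
  rw [Fml.inst, Fml.sub_sub]
  refine Fml.sub_congr _ (fun n => ?_) fun n => rfl
  cases n with
  | zero => rfl
  | succ n => exact (Tm.sub_ren _ _ _ _ _).trans (Tm.sub_var _)

theorem Fml.finst_sub_upRen (φ : Fml) (σ : ℕ → Tm) (p : ℕ → ℕ) (g : ℕ) :
    (φ.sub (fun n => (σ n).ren id Nat.succ) (upRen p)).finst g = φ.sub σ (scons g p) := by
  rw [Fml.finst, Fml.sub_sub]
  refine Fml.sub_congr _ (fun n => ?_) fun n => ?_
  · exact (Tm.sub_ren _ _ _ _ _).trans (Tm.sub_var _)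
  · cases n <;> rfl

theorem Fml.sub_inst (φ : Fml) (σ : ℕ → Tm) (p : ℕ → ℕ) (t : Tm) :
    (φ.inst t).sub σ p = (φ.sub (upSub σ) p).inst (t.sub σ p) := by
  rw [Fml.inst_sub_upSub, Fml.inst, Fml.sub_sub]
  exact Fml.sub_congr _ (fun n => by cases n <;> rfl) fun n => rfl

theorem Fml.sub_finst (φ : Fml) (σ : ℕ → Tm) (p : ℕ → ℕ) (g : ℕ) :
    (φ.finst g).sub σ p =
      (φ.sub (fun n => (σ n).ren id Nat.succ) (upRen p)).finst (p g) := by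
  rw [Fml.finst_sub_upRen, Fml.finst, Fml.sub_sub]
  exact Fml.sub_congr _ (fun n => rfl) fun n => by cases n <;> rfl

theorem Fml.sub_lift (φ : Fml) (σ : ℕ → Tm) (p : ℕ → ℕ) :
    (φ.lift).sub (upSub σ) p = (φ.sub σ p).lift := by
  rw [Fml.lift, Fml.lift, Fml.sub_sub, Fml.sub_sub]
  exact Fml.sub_congr _ (fun n => Tm.ren_eq_sub _ _ _) fun n => rfl

theorem Fml.sub_flift (φ : Fml) (σ : ℕ → Tm) (p : ℕ → ℕ) :
    (φ.flift).sub (fun n => (σ n).ren id Nat.succ) (upRen p) = (φ.sub σ p).flift := by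
  rw [Fml.flift, Fml.flift, Fml.sub_sub, Fml.sub_sub]
  exact Fml.sub_congr _ (fun n => Tm.ren_eq_sub _ _ _) fun n => rfl

theorem upSub_agree {σ τ : ℕ → Tm} {N : ℕ} (h : ∀ i < N, σ i = τ i) :
    ∀ i < N, upSub σ i = upSub τ i := by
  rintro (_ | i) hi
  · rfl
  · simp [upSub, h i (by omega)]

theorem upRen_agree {p q : ℕ → ℕ} {N : ℕ} (h : ∀ i < N, p i = q i) :
    ∀ i < N, upRen p i = upRen q i := by
  rintro (_ | i) hi
  · rfl
  · simp [upRen, h i (by omega)]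

/-- Only finitely many variables occur in a term. -/
theorem Tm.exists_bound (t : Tm) : ∃ N : ℕ, ∀ (σ τ : ℕ → Tm) (p q : ℕ → ℕ),
    (∀ i < N, σ i = τ i) → (∀ i < N, p i = q i) → t.sub σ p = t.sub τ q := by
  induction t with
  | var i => exact ⟨i + 1, fun σ τ p q h _ => h i (by omega)⟩
  | zero => exact ⟨0, fun _ _ _ _ _ _ => rfl⟩
  | succ t ih =>
    obtain ⟨N, hN⟩ := ih
    exact ⟨N, fun σ τ p q h h' => by simp [Tm.sub, hN σ τ p q h h']⟩
  | app f t ih =>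
    obtain ⟨N, hN⟩ := ih
    refine ⟨N + f + 1, fun σ τ p q h h' => ?_⟩
    simp [Tm.sub, hN σ τ p q (fun i hi => h i (by omega)) (fun i hi => h' i (by omega)),
      h' f (by omega)]
  | recur a b t iha ihb iht =>
    obtain ⟨A, hA⟩ := iha
    obtain ⟨B, hB⟩ := ihb
    obtain ⟨N, hN⟩ := iht
    refine ⟨A + B + N, fun σ τ p q h h' => ?_⟩
    simp only [Tm.sub]
    rw [hA σ τ p q (fun i hi => h i (by omega)) (fun i hi => h' i (by omega)),
      hN σ τ p q (fun i hi => h i (by omega)) (fun i hi => h' i (by omega)),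
      hB _ (upSub (upSub τ)) p q
        (fun i hi => upSub_agree (upSub_agree (N := A + B + N) h) i (by omega))
        (fun i hi => h' i (by omega))]

/-- Only finitely many variables occur in a formula. -/
theorem Fml.exists_bound (φ : Fml) : ∃ N : ℕ, ∀ (σ τ : ℕ → Tm) (p q : ℕ → ℕ),
    (∀ i < N, σ i = τ i) → (∀ i < N, p i = q i) → φ.sub σ p = φ.sub τ q := by
  induction φ with
  | eq s t =>
    obtain ⟨A, hA⟩ := s.exists_bound
    obtain ⟨B, hB⟩ := t.exists_bound
    refine ⟨A + B, fun σ τ p q h h' => ?_⟩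
    simp only [Fml.sub]
    rw [hA σ τ p q (fun i hi => h i (by omega)) (fun i hi => h' i (by omega)),
      hB σ τ p q (fun i hi => h i (by omega)) (fun i hi => h' i (by omega))]
  | bot => exact ⟨0, fun _ _ _ _ _ _ => rfl⟩
  | and φ ψ ih₁ ih₂ | or φ ψ ih₁ ih₂ | imp φ ψ ih₁ ih₂ =>
    obtain ⟨A, hA⟩ := ih₁
    obtain ⟨B, hB⟩ := ih₂
    refine ⟨A + B, fun σ τ p q h h' => ?_⟩
    simp only [Fml.sub]
    rw [hA σ τ p q (fun i hi => h i (by omega)) (fun i hi => h' i (by omega)),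
      hB σ τ p q (fun i hi => h i (by omega)) (fun i hi => h' i (by omega))]
  | all φ ih | ex φ ih =>
    obtain ⟨N, hN⟩ := ih
    refine ⟨N, fun σ τ p q h h' => ?_⟩
    simp only [Fml.sub]
    rw [hN _ _ p q (upSub_agree h) h']
  | fall φ ih | fex φ ih =>
    obtain ⟨N, hN⟩ := ih
    refine ⟨N, fun σ τ p q h h' => ?_⟩
    simp only [Fml.sub]
    rw [hN _ (fun n => (τ n).ren id Nat.succ) _ _ (fun i hi => by rw [h i hi]) (upRen_agree h')]

theorem exists_bound_list (Γ : List Fml) : ∃ N : ℕ, ∀ φ ∈ Γ, ∀ (σ τ : ℕ → Tm) (p q : ℕ → ℕ),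
    (∀ i < N, σ i = τ i) → (∀ i < N, p i = q i) → φ.sub σ p = φ.sub τ q := by
  induction Γ with
  | nil => exact ⟨0, by simp⟩
  | cons φ Γ ih =>
    obtain ⟨A, hA⟩ := φ.exists_bound
    obtain ⟨B, hB⟩ := ih
    refine ⟨A + B, fun ψ hψ σ τ p q h h' => ?_⟩
    rcases List.mem_cons.1 hψ with rfl | hψ
    · exact hA σ τ p q (fun i hi => h i (by omega)) (fun i hi => h' i (by omega))
    · exact hB ψ hψ σ τ p q (fun i hi => h i (by omega)) (fun i hi => h' i (by omega))

/-! Derived rules -/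

/-- A set of schemata is closed under substitution. -/
def SubClosed (T : Set Fml) : Prop := ∀ φ ∈ T, ∀ (σ : ℕ → Tm) (p : ℕ → ℕ), φ.sub σ p ∈ T

theorem Prf.weaken {T : Set Fml} {Γ : List Fml} {φ : Fml} (h : Prf T Γ φ) :
    ∀ {Δ : List Fml}, Γ ⊆ Δ → Prf T Δ φ := by
  induction h with
  | ax h => exact fun _ => .ax h
  | hyp h => exact fun hs => .hyp (hs h)
  | botE φ _ ih => exact fun hs => .botE φ (ih hs)
  | andI _ _ ih₁ ih₂ => exact fun hs => .andI (ih₁ hs) (ih₂ hs)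
  | andE₁ _ ih => exact fun hs => .andE₁ (ih hs)
  | andE₂ _ ih => exact fun hs => .andE₂ (ih hs)
  | orI₁ _ ih => exact fun hs => .orI₁ (ih hs)
  | orI₂ _ ih => exact fun hs => .orI₂ (ih hs)
  | orE _ _ _ ih ih₁ ih₂ =>
    exact fun hs => .orE (ih hs) (ih₁ (List.cons_subset_cons _ hs)) (ih₂ (List.cons_subset_cons _ hs))
  | impI _ ih => exact fun hs => .impI (ih (List.cons_subset_cons _ hs))
  | impE _ _ ih₁ ih₂ => exact fun hs => .impE (ih₁ hs) (ih₂ hs)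
  | allI _ ih => exact fun hs => .allI (ih (List.map_subset _ hs))
  | allE t _ ih => exact fun hs => .allE t (ih hs)
  | exI t _ ih => exact fun hs => .exI t (ih hs)
  | exE _ _ ih₁ ih₂ =>
    exact fun hs => .exE (ih₁ hs) (ih₂ (List.cons_subset_cons _ (List.map_subset _ hs)))
  | fallI _ ih => exact fun hs => .fallI (ih (List.map_subset _ hs))
  | fallE t _ ih => exact fun hs => .fallE t (ih hs)
  | fexI t _ ih => exact fun hs => .fexI t (ih hs)
  | fexE _ _ ih₁ ih₂ =>
    exact fun hs => .fexE (ih₁ hs) (ih₂ (List.cons_subset_cons _ (List.map_subset _ hs)))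
  | eqI t => exact fun _ => .eqI t
  | eqE φ _ _ ih₁ ih₂ => exact fun hs => .eqE φ (ih₁ hs) (ih₂ hs)

theorem map_lift_sub (Γ : List Fml) (σ : ℕ → Tm) (p : ℕ → ℕ) :
    (Γ.map Fml.lift).map (·.sub (upSub σ) p) = (Γ.map (·.sub σ p)).map Fml.lift := by
  simp [Fml.sub_lift]

theorem map_flift_sub (Γ : List Fml) (σ : ℕ → Tm) (p : ℕ → ℕ) :
    (Γ.map Fml.flift).map (·.sub (fun n => (σ n).ren id Nat.succ) (upRen p)) =
      (Γ.map (·.sub σ p)).map Fml.flift := by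
  simp [Fml.sub_flift]

/-- Derivations are closed under substitution. -/
theorem Prf.subst {T : Set Fml} (hT : SubClosed T) {Γ : List Fml} {φ : Fml} (h : Prf T Γ φ) :
    ∀ (σ : ℕ → Tm) (p : ℕ → ℕ), Prf T (Γ.map (·.sub σ p)) (φ.sub σ p) := by
  induction h with
  | ax h => exact fun σ p => .ax (hT _ h σ p)
  | hyp h => exact fun σ p => .hyp (List.mem_map_of_mem h)
  | botE φ _ ih => exact fun σ p => .botE _ (ih σ p)
  | andI _ _ ih₁ ih₂ => exact fun σ p => .andI (ih₁ σ p) (ih₂ σ p)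
  | andE₁ _ ih => exact fun σ p => .andE₁ (ih σ p)
  | andE₂ _ ih => exact fun σ p => .andE₂ (ih σ p)
  | orI₁ _ ih => exact fun σ p => .orI₁ (ih σ p)
  | orI₂ _ ih => exact fun σ p => .orI₂ (ih σ p)
  | orE _ _ _ ih ih₁ ih₂ => exact fun σ p => .orE (ih σ p) (ih₁ σ p) (ih₂ σ p)
  | impI _ ih => exact fun σ p => .impI (ih σ p)
  | impE _ _ ih₁ ih₂ => exact fun σ p => .impE (ih₁ σ p) (ih₂ σ p)
  | allI _ ih => exact fun σ p => .allI (by rw [← map_lift_sub]; exact ih _ p)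
  | allE t _ ih => exact fun σ p => by rw [Fml.sub_inst]; exact .allE _ (ih σ p)
  | exI t _ ih => exact fun σ p => .exI (t.sub σ p) (by rw [← Fml.sub_inst]; exact ih σ p)
  | exE _ _ ih₁ ih₂ =>
    refine fun σ p => .exE (ih₁ σ p) ?_
    rw [← map_lift_sub, ← Fml.sub_lift]
    exact ih₂ _ p
  | fallI _ ih => exact fun σ p => .fallI (by rw [← map_flift_sub]; exact ih _ _)
  | fallE g _ ih => exact fun σ p => by rw [Fml.sub_finst]; exact .fallE _ (ih σ p)
  | fexI g _ ih => exact fun σ p => .fexI (p g) (by rw [← Fml.sub_finst]; exact ih σ p)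
  | fexE _ _ ih₁ ih₂ =>
    refine fun σ p => .fexE (ih₁ σ p) ?_
    rw [← map_flift_sub, ← Fml.sub_flift]
    exact ih₂ _ _
  | eqI t => exact fun σ p => .eqI _
  | eqE φ _ _ ih₁ ih₂ =>
    refine fun σ p => ?_
    rw [Fml.sub_inst]
    exact .eqE _ (ih₁ σ p) (by rw [← Fml.sub_inst]; exact ih₂ σ p)

/-- Abstraction of a fresh number variable. -/
theorem exists_fresh (Γ : List Fml) (φ : Fml) : ∃ (N : ℕ) (σ : ℕ → Tm),
    (φ.inst (.var N)).sub σ id = φ ∧ Γ.map (·.sub σ id) = Γ.map Fml.lift := by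
  obtain ⟨N, hN⟩ := exists_bound_list (φ :: Γ)
  -- The fresh variable becomes the bound variable `0`; all others move up. On formulas without `N`
  -- this is just `Fml.lift`.
  refine ⟨N, fun i => if i = N then .var 0 else .var (i + 1), ?_, ?_⟩
  · rw [Fml.inst, Fml.sub_sub]
    refine Eq.trans (hN φ (by simp) _ _ _ _ (fun i hi => ?_) fun i _ => rfl) φ.sub_var
    cases i with
    | zero => simp [scons, Tm.sub]
    | succ i => simp [scons, Tm.sub, show i ≠ N by omega]
  · refine List.map_congr_left fun ψ hψ => hN ψ (by simp [hψ]) _ _ _ _ (fun i hi => ?_) fun i _ => rfl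
    simp [show i ≠ N by omega]

/-- Abstraction of a fresh function variable. -/
theorem exists_ffresh (Γ : List Fml) (φ : Fml) : ∃ (N : ℕ) (p : ℕ → ℕ),
    (φ.finst N).sub .var p = φ ∧ Γ.map (·.sub .var p) = Γ.map Fml.flift := by
  obtain ⟨N, hN⟩ := exists_bound_list (φ :: Γ)
  refine ⟨N, fun i => if i = N then 0 else i + 1, ?_, ?_⟩
  · rw [Fml.finst, Fml.sub_sub]
    refine Eq.trans (hN φ (by simp) _ _ _ _ (fun i _ => rfl) fun i hi => ?_) φ.sub_var
    cases i with
    | zero => simp [scons]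
    | succ i => simp [scons, show i ≠ N by omega]
  · refine List.map_congr_left fun ψ hψ => hN ψ (by simp [hψ]) _ _ _ _ (fun i _ => rfl) fun i hi => ?_
    simp [show i ≠ N by omega]

/-- The premise is used only for one variable fresh for `Γ` and `φ`. Quantifying over all terms in
the metalanguage removes the eigenvariable bookkeeping from later arguments. -/
theorem Prf.allI_of_forall {T : Set Fml} (hT : SubClosed T) {Γ : List Fml} {φ : Fml}
    (h : ∀ t, Prf T Γ (φ.inst t)) : Prf T Γ (.all φ) := by
  obtain ⟨N, σ, h₁, h₂⟩ := exists_fresh Γ φ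
  have := (h (.var N)).subst hT σ id
  rw [h₁, h₂] at this
  exact .allI this

theorem Prf.fallI_of_forall {T : Set Fml} (hT : SubClosed T) {Γ : List Fml} {φ : Fml}
    (h : ∀ g, Prf T Γ (φ.finst g)) : Prf T Γ (.fall φ) := by
  obtain ⟨N, p, h₁, h₂⟩ := exists_ffresh Γ φ
  have := (h N).subst hT .var p
  rw [h₁, h₂] at this
  exact .fallI this

theorem Prf.exE_of_forall {T : Set Fml} (hT : SubClosed T) {Γ : List Fml} {φ χ : Fml}
    (h₀ : Prf T Γ (.ex φ)) (h : ∀ t, Prf T (φ.inst t :: Γ) χ) :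
    Prf T Γ χ := by
  -- Existential elimination is reduced to universal introduction for `φ → χ`, instantiated
  -- afterwards at the eigenvariable of `exE`.
  have key : Prf T Γ (.all (.imp φ χ.lift)) := by
    refine Prf.allI_of_forall hT fun t => .impI ?_
    have e : χ.lift.sub (scons t .var) id = χ := by
      rw [Fml.lift, Fml.sub_sub]; exact χ.sub_var
    rw [e]
    exact h t
  refine .exE h₀ (.impE (φ := φ) ?_ (.hyp (by simp)))
  have h' := (key.subst hT (fun n => .var (n + 1)) id).allE (.var 0)
  rw [Fml.inst_sub_upSub] at h'
  have e : (φ.imp χ.lift).sub (scons (.var 0) fun n => .var (n + 1)) id = φ.imp χ.lift :=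
    (Fml.sub_congr _ (fun n => by cases n <;> rfl) fun n => rfl).trans (Fml.sub_var _)
  rw [e] at h'
  exact h'.weaken (List.subset_cons_self _ _)

theorem Prf.fexE_of_forall {T : Set Fml} (hT : SubClosed T) {Γ : List Fml} {φ χ : Fml}
    (h₀ : Prf T Γ (.fex φ)) (h : ∀ g, Prf T (φ.finst g :: Γ) χ) :
    Prf T Γ χ := by
  have key : Prf T Γ (.fall (.imp φ χ.flift)) := by
    refine Prf.fallI_of_forall hT fun t => .impI ?_
    have e : χ.flift.sub .var (scons t id) = χ := by
      rw [Fml.flift, Fml.sub_sub]; exact χ.sub_var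
    rw [e]
    exact h t
  refine .fexE h₀ (.impE (φ := φ) ?_ (.hyp (by simp)))
  have h' := (key.subst hT .var Nat.succ).fallE 0
  rw [Fml.finst_sub_upRen] at h'
  have e : (φ.imp χ.flift).sub .var (scons 0 Nat.succ) = φ.imp χ.flift :=
    (Fml.sub_congr _ (fun n => rfl) fun n => by cases n <;> rfl).trans (Fml.sub_var _)
  rw [e] at h'
  exact h'.weaken (List.subset_cons_self _ _)


/-! Countability of the language -/

/-- A code of a term. -/
def Tm.code : Tm → ℕ
  | .var i => Nat.pair 0 i
  | .zero => Nat.pair 1 0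
  | .succ t => Nat.pair 2 t.code
  | .app f t => Nat.pair 3 (Nat.pair f t.code)
  | .recur a b t => Nat.pair 4 (Nat.pair a.code (Nat.pair b.code t.code))

theorem Tm.code_injective : Function.Injective Tm.code := by
  intro s
  induction s with
  | var i => intro t; cases t <;> simp [Tm.code]
  | zero => intro t; cases t <;> simp [Tm.code]
  | succ s ih =>
    intro t
    cases t <;> simp [Tm.code]
    exact fun h => ih h
  | app f s ih =>
    intro t
    cases t <;> simp [Tm.code]
    exact fun h h' => ⟨h, ih h'⟩
  | recur a b s iha ihb ih =>
    intro t
    cases t <;> simp [Tm.code]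
    exact fun h h' h'' => ⟨iha h, ihb h', ih h''⟩

/-- A code of a formula. -/
def Fml.code : Fml → ℕ
  | .eq s t => Nat.pair 0 (Nat.pair s.code t.code)
  | .bot => Nat.pair 1 0
  | .and φ ψ => Nat.pair 2 (Nat.pair φ.code ψ.code)
  | .or φ ψ => Nat.pair 3 (Nat.pair φ.code ψ.code)
  | .imp φ ψ => Nat.pair 4 (Nat.pair φ.code ψ.code)
  | .all φ => Nat.pair 5 φ.code
  | .ex φ => Nat.pair 6 φ.code
  | .fall φ => Nat.pair 7 φ.code
  | .fex φ => Nat.pair 8 φ.code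

theorem Fml.code_injective : Function.Injective Fml.code := by
  intro φ
  induction φ with
  | eq s t =>
    intro χ
    cases χ <;> simp [Fml.code]
    exact fun h h' => ⟨Tm.code_injective h, Tm.code_injective h'⟩
  | bot => intro χ; cases χ <;> simp [Fml.code]
  | and φ ψ ih₁ ih₂ | or φ ψ ih₁ ih₂ | imp φ ψ ih₁ ih₂ =>
    intro χ
    cases χ <;> simp [Fml.code]
    exact fun h h' => ⟨ih₁ h, ih₂ h'⟩
  | all φ ih | ex φ ih | fall φ ih | fex φ ih =>
    intro χ
    cases χ <;> simp [Fml.code]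
    exact fun h => ih h

instance : Countable Fml := Fml.code_injective.countable

instance : Nonempty Fml := ⟨.bot⟩

/-! Saturated theories -/

/-- A theory over `iRCA₀` given by schemata. -/
class IsBase (T : Set Fml) : Prop where
  subClosed : SubClosed T
  irca : IRCA0 ⊆ T

/-- A consistent deductively closed set of formulas with the disjunction property and with
witnesses for existential formulas; free variables play the role of constants. -/
structure World (T : Set Fml) where
  carrier : Set Fml
  closed : ∀ (Γ : List Fml) (φ : Fml), (∀ ψ ∈ Γ, ψ ∈ carrier) → Prf T Γ φ → φ ∈ carrier
  bot_notMem : .bot ∉ carrier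
  or_mem : ∀ φ ψ : Fml, .or φ ψ ∈ carrier → φ ∈ carrier ∨ ψ ∈ carrier
  ex_mem : ∀ φ : Fml, .ex φ ∈ carrier → ∃ t, φ.inst t ∈ carrier
  fex_mem : ∀ φ : Fml, .fex φ ∈ carrier → ∃ g, φ.finst g ∈ carrier

/-- If every disjunct, or every candidate witness, allowed a derivation of `χ` when added, then the
elimination rule for `θ` would derive `χ` from `Γ` itself. So some choice keeps `χ` underivable. -/
theorem exists_saturation_step {T : Set Fml} (hT : SubClosed T) {Γ : List Fml} {χ : Fml}
    (h : ¬ Prf T Γ χ) (θ : Fml) : ∃ Γ' : List Fml, Γ ⊆ Γ' ∧ ¬ Prf T Γ' χ ∧ (Prf T Γ θ →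
      (∀ φ ψ, θ = .or φ ψ → φ ∈ Γ' ∨ ψ ∈ Γ') ∧ (∀ φ, θ = .ex φ → ∃ t, φ.inst t ∈ Γ') ∧
      (∀ φ, θ = .fex φ → ∃ g, φ.finst g ∈ Γ')) := by
  by_cases hθ : Prf T Γ θ
  swap
  · exact ⟨Γ, List.Subset.refl _, h, fun h' => absurd h' hθ⟩
  cases θ with
  | or φ ψ =>
    by_cases h₁ : Prf T (φ :: Γ) χ
    · exact ⟨ψ :: Γ, List.subset_cons_self _ _, fun h₂ => h (hθ.orE h₁ h₂), fun _ => by simp⟩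
    · exact ⟨φ :: Γ, List.subset_cons_self _ _, h₁, fun _ => by simp⟩
  | ex φ =>
    obtain ⟨t, ht⟩ : ∃ t, ¬ Prf T (φ.inst t :: Γ) χ := by
      by_contra! hc
      exact h (hθ.exE_of_forall hT hc)
    exact ⟨_, List.subset_cons_self _ _, ht, fun _ => by simpa using ⟨t, .inl rfl⟩⟩
  | fex φ =>
    obtain ⟨t, ht⟩ : ∃ t, ¬ Prf T (φ.finst t :: Γ) χ := by
      by_contra! hc
      exact h (hθ.fexE_of_forall hT hc)
    exact ⟨_, List.subset_cons_self _ _, ht, fun _ => by simpa using ⟨t, .inl rfl⟩⟩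
  | _ => exact ⟨Γ, List.Subset.refl _, h, fun _ => by simp⟩

/-- An unprovable formula is omitted by some saturated theory. -/
theorem World.exists_notMem {T : Set Fml} [hT : IsBase T] {Γ : List Fml} {χ : Fml}
    (h : ¬ Prf T Γ χ) : ∃ W : World T, (∀ φ ∈ Γ, φ ∈ W.carrier) ∧ χ ∉ W.carrier := by
  obtain ⟨e, he⟩ := exists_surjective_nat Fml
  choose F hF₁ hF₂ hF₃ using
    fun (A : {Γ : List Fml // ¬ Prf T Γ χ}) => exists_saturation_step hT.subClosed A.2
  -- Indexing by `n.unpair.1` treats each formula at infinitely many stages, in particular at some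
  -- stage after it has become derivable.
  let S : ℕ → {Γ : List Fml // ¬ Prf T Γ χ} := fun n =>
    Nat.rec ⟨Γ, h⟩ (fun n A => ⟨F A (e n.unpair.1), hF₂ A _⟩) n
  have hS : ∀ n, (S (n + 1)).1 = F (S n) (e n.unpair.1) := fun n => rfl
  have mono : ∀ m n, m ≤ n → (S m).1 ⊆ (S n).1 := by
    intro m n hmn
    induction n, hmn using Nat.le_induction with
    | base => exact List.Subset.refl _
    | succ n _ ih => exact List.Subset.trans ih (hF₁ (S n) _)
  have stage : ∀ θ n, Prf T (S n).1 θ → ∃ m, Prf T (S m).1 θ ∧ (S (m + 1)).1 = F (S m) θ := by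
    intro θ n hn
    obtain ⟨i, rfl⟩ := he θ
    refine ⟨Nat.pair i n, hn.weaken (mono _ _ (Nat.right_le_pair i n)), ?_⟩
    rw [hS, Nat.unpair_pair]
  refine ⟨⟨{φ | ∃ n, Prf T (S n).1 φ}, ?_, ?_, ?_, ?_, ?_⟩, ?_, ?_⟩
  · intro Δ φ hΔ hφ
    have key : ∃ n, ∀ ψ ∈ Δ, Prf T (S n).1 ψ := by
      clear hφ
      induction Δ with
      | nil => exact ⟨0, by simp⟩
      | cons ψ Δ ih =>
        obtain ⟨n, hn⟩ := ih fun θ hθ => hΔ θ (by simp [hθ])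
        obtain ⟨m, hm⟩ := hΔ ψ (by simp)
        refine ⟨max m n, fun θ hθ => ?_⟩
        rcases List.mem_cons.1 hθ with rfl | hθ
        · exact hm.weaken (mono _ _ (le_max_left _ _))
        · exact (hn θ hθ).weaken (mono _ _ (le_max_right _ _))
    obtain ⟨n, hn⟩ := key
    refine ⟨n, ?_⟩
    clear hΔ
    generalize (S n).1 = Θ at hn
    induction Δ generalizing φ with
    | nil => exact hφ.weaken (by simp)
    | cons ψ Δ ih => exact .impE (ih _ hφ.impI fun θ hθ => hn θ (by simp [hθ])) (hn ψ (by simp))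
  · rintro ⟨n, hn⟩
    exact (S n).2 (.botE _ hn)
  · rintro φ ψ ⟨n, hn⟩
    obtain ⟨m, hm, e⟩ := stage _ n hn
    rcases (hF₃ (S m) _ hm).1 φ ψ rfl with h' | h' <;> rw [← e] at h'
    · exact .inl ⟨m + 1, .hyp h'⟩
    · exact .inr ⟨m + 1, .hyp h'⟩
  · rintro φ ⟨n, hn⟩
    obtain ⟨m, hm, e⟩ := stage _ n hn
    obtain ⟨t, ht⟩ := (hF₃ (S m) _ hm).2.1 φ rfl
    rw [← e] at ht
    exact ⟨t, m + 1, .hyp ht⟩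
  · rintro φ ⟨n, hn⟩
    obtain ⟨m, hm, e⟩ := stage _ n hn
    obtain ⟨t, ht⟩ := (hF₃ (S m) _ hm).2.2 φ rfl
    rw [← e] at ht
    exact ⟨t, m + 1, .hyp ht⟩
  · exact fun φ hφ => ⟨0, .hyp hφ⟩
  · rintro ⟨n, hn⟩
    exact (S n).2 hn

instance {T : Set Fml} : Membership Fml (World T) := ⟨fun W φ => φ ∈ W.carrier⟩

/-- Completeness for saturated theories. -/
theorem Prf.of_worlds {T : Set Fml} [IsBase T] {Γ : List Fml} {χ : Fml}
    (h : ∀ W : World T, (∀ φ ∈ Γ, φ ∈ W) → χ ∈ W) : Prf T Γ χ := by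
  by_contra hc
  obtain ⟨W, h₁, h₂⟩ := World.exists_notMem hc
  exact h₂ (h W h₁)

namespace World

variable {T : Set Fml} (W : World T)

theorem mem_of_prf {Γ : List Fml} {φ : Fml} (h : Prf T Γ φ) (hΓ : ∀ ψ ∈ Γ, ψ ∈ W) : φ ∈ W :=
  W.closed Γ φ hΓ h

theorem mem_and {φ ψ : Fml} : .and φ ψ ∈ W ↔ φ ∈ W ∧ ψ ∈ W :=
  ⟨fun h => ⟨W.mem_of_prf (Γ := [.and φ ψ]) (.andE₁ (ψ := ψ) (.hyp (by simp))) (by simpa using h),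
    W.mem_of_prf (Γ := [.and φ ψ]) (.andE₂ (φ := φ) (.hyp (by simp))) (by simpa using h)⟩,
  fun h => W.mem_of_prf (Γ := [φ, ψ]) (.andI (.hyp (by simp)) (.hyp (by simp))) (by simpa using h)⟩

theorem mem_or {φ ψ : Fml} : .or φ ψ ∈ W ↔ φ ∈ W ∨ ψ ∈ W := by
  refine ⟨W.or_mem φ ψ, ?_⟩
  rintro (h | h)
  · exact W.mem_of_prf (Γ := [φ]) (.orI₁ (.hyp (by simp))) (by simpa using h)
  · exact W.mem_of_prf (Γ := [ψ]) (.orI₂ (.hyp (by simp))) (by simpa using h)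

theorem mem_ex {φ : Fml} : .ex φ ∈ W ↔ ∃ t, φ.inst t ∈ W :=
  ⟨W.ex_mem φ, fun ⟨t, h⟩ => W.mem_of_prf (Γ := [φ.inst t]) (.exI t (.hyp (by simp))) (by simpa using h)⟩

theorem mem_fex {φ : Fml} : .fex φ ∈ W ↔ ∃ g, φ.finst g ∈ W :=
  ⟨W.fex_mem φ,
    fun ⟨g, h⟩ => W.mem_of_prf (Γ := [φ.finst g]) (.fexI g (.hyp (by simp))) (by simpa using h)⟩

theorem mem_mp {φ ψ : Fml} (h : .imp φ ψ ∈ W) (h' : φ ∈ W) : ψ ∈ W :=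
  W.mem_of_prf (Γ := [.imp φ ψ, φ]) (.impE (φ := φ) (.hyp (by simp)) (.hyp (by simp)))
    (by simp [h, h'])

theorem mem_imp_of_mem {φ ψ : Fml} (h : ψ ∈ W) : .imp φ ψ ∈ W :=
  W.mem_of_prf (Γ := [ψ]) (.impI (.hyp (by simp))) (by simpa using h)

theorem mem_imp_of_neg_mem {φ ψ : Fml} (h : φ.neg ∈ W) : .imp φ ψ ∈ W :=
  W.mem_of_prf (Γ := [φ.neg]) (.impI (.botE _ (.impE (φ := φ) (.hyp (by simp [Fml.neg]))
    (.hyp (by simp))))) (by simpa using h)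

theorem notMem_of_neg_mem {φ : Fml} (h : φ.neg ∈ W) : φ ∉ W := fun h' =>
  W.bot_notMem (W.mem_mp h h')

theorem mem_inst_of_all {φ : Fml} (h : .all φ ∈ W) (t : Tm) : φ.inst t ∈ W :=
  W.mem_of_prf (Γ := [.all φ]) (.allE t (.hyp (by simp))) (by simpa using h)

theorem mem_eqE {s t : Tm} (φ : Fml) (h : .eq s t ∈ W) (h' : φ.inst s ∈ W) : φ.inst t ∈ W :=
  W.mem_of_prf (Γ := [.eq s t, φ.inst s]) (.eqE φ (s := s) (.hyp (by simp)) (.hyp (by simp)))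
    (by simp [h, h'])

theorem eq_mem_refl (t : Tm) : .eq t t ∈ W := W.mem_of_prf (Γ := []) (.eqI t) (by simp)

/-- The rule `eqE` replaces a single term in a formula; this isolates the variable `i` as the place
of replacement. -/
theorem sub_update_eq_inst (φ : Fml) (σ : ℕ → Tm) (p : ℕ → ℕ) (i : ℕ) (s : Tm) :
    φ.sub (Function.update σ i s) p =
      (φ.sub (Function.update (fun n => (σ n).up 1) i (.var 0)) p).inst s := by
  rw [Fml.inst, Fml.sub_sub]
  refine Fml.sub_congr _ (fun n => ?_) fun n => rfl
  by_cases h : n = i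
  · subst h; simp [Tm.sub, scons]
  · simp only [Function.update_of_ne h]
    exact ((Tm.sub_ren _ _ _ _ _).trans (Tm.sub_var _)).symm

/-- The terms are exchanged one variable at a time, and finitely many exchanges suffice because only
finitely many variables occur in `φ`. -/
theorem mem_sub_congr (φ : Fml) {σ τ : ℕ → Tm} (p : ℕ → ℕ) (h : ∀ n, .eq (σ n) (τ n) ∈ W)
    (hφ : φ.sub σ p ∈ W) : φ.sub τ p ∈ W := by
  have key : ∀ n, φ.sub (fun i => if i < n then τ i else σ i) p ∈ W := by
    intro n
    induction n with
    | zero => simpa using hφ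
    | succ n ih =>
      have e₁ : (fun i => if i < n then τ i else σ i) =
          Function.update (fun i => if i < n then τ i else σ i) n (σ n) := by
        funext i; by_cases hi : i = n <;> simp [hi]
      have e₂ : (fun i => if i < n + 1 then τ i else σ i) =
          Function.update (fun i => if i < n then τ i else σ i) n (τ n) := by
        funext i
        by_cases hi : i = n
        · simp [hi]
        · simp [hi, show i < n + 1 ↔ i < n by omega]
      rw [e₁, sub_update_eq_inst] at ih
      rw [e₂, sub_update_eq_inst]
      exact W.mem_eqE _ (h n) ih
  obtain ⟨N, hN⟩ := φ.exists_bound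
  rw [← hN (fun i => if i < N then τ i else σ i) τ p p (fun i hi => by simp [hi]) fun _ _ => rfl]
  exact key N

theorem eq_mem_sub_congr (t : Tm) {σ τ : ℕ → Tm} (p : ℕ → ℕ) (h : ∀ n, .eq (σ n) (τ n) ∈ W) :
    .eq (t.sub σ p) (t.sub τ p) ∈ W := by
  -- The two sides get disjoint variables, even and odd. Starting from the reflexive equation, only
  -- the terms at odd variables are replaced.
  have := W.mem_sub_congr (.eq (t.ren (fun n => 2 * n) id) (t.ren (fun n => 2 * n + 1) id))
    (σ := fun n => σ (n / 2)) (τ := fun n => if n % 2 = 0 then σ (n / 2) else τ (n / 2)) p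
    (fun n => by
      split_ifs
      · exact W.eq_mem_refl _
      · exact h _)
    (by
      simp only [Fml.sub, Tm.sub_ren]
      convert W.eq_mem_refl _ using 3
      funext n; congr 1; omega)
  simp only [Fml.sub, Tm.sub_ren] at this
  have e₁ := Tm.sub_congr t (σ := fun n => if 2 * n % 2 = 0 then σ (2 * n / 2) else τ (2 * n / 2))
    (τ := σ) (p := fun n => p (id n)) (q := p) (fun n => by simp) fun n => rfl
  have e₂ := Tm.sub_congr t (σ := fun n => if (2 * n + 1) % 2 = 0 then σ ((2 * n + 1) / 2)
    else τ ((2 * n + 1) / 2)) (τ := τ) (p := fun n => p (id n)) (q := p)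
    (fun n => by rw [if_neg (by omega), show (2 * n + 1) / 2 = n by omega]) fun n => rfl
  rwa [e₁, e₂] at this

end World

/-! Closure of the axiom systems under substitution -/

theorem Fml.QF.sub {φ : Fml} (h : φ.QF) : ∀ (σ : ℕ → Tm) (p : ℕ → ℕ), (φ.sub σ p).QF := by
  induction φ with
  | eq s t => exact fun _ _ => trivial
  | bot => exact fun _ _ => trivial
  | and φ ψ ih₁ ih₂ | or φ ψ ih₁ ih₂ | imp φ ψ ih₁ ih₂ =>
    exact fun σ p => ⟨ih₁ h.1 σ p, ih₂ h.2 σ p⟩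
  | _ => exact h.elim

theorem Fml.Arith.sub {φ : Fml} (h : φ.Arith) : ∀ (σ : ℕ → Tm) (p : ℕ → ℕ), (φ.sub σ p).Arith := by
  induction φ with
  | eq s t => exact fun _ _ => trivial
  | bot => exact fun _ _ => trivial
  | and φ ψ ih₁ ih₂ | or φ ψ ih₁ ih₂ | imp φ ψ ih₁ ih₂ =>
    exact fun σ p => ⟨ih₁ h.1 σ p, ih₂ h.2 σ p⟩
  | all φ ih | ex φ ih => exact fun σ p => ih h _ p
  | _ => exact h.elim

theorem subClosed_IRCA0 : SubClosed IRCA0 := by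
  rintro _ (⟨t⟩ | ⟨s, t⟩ | ⟨a, b⟩ | ⟨a, b, t⟩ | ⟨φ, h⟩ | ⟨φ, h⟩) σ p
  · exact .succ_ne_zero _
  · exact .succ_inj _ _
  · exact .recur_zero _ _
  · have e : (b.sub (scons (.recur a b t) (scons t .var)) id).sub σ p =
        (b.sub (upSub (upSub σ)) p).sub (scons ((Tm.recur a b t).sub σ p) (scons (t.sub σ p) .var))
          id := by
      rw [Tm.sub_sub, Tm.sub_sub]
      refine Tm.sub_congr _ (fun n => ?_) fun n => rfl
      rcases n with _ | _ | n
      · rfl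
      · rfl
      · simp only [upSub, Tm.up, Tm.sub_ren]
        exact (Tm.sub_var _).symm
    change IsIRCA0 (.eq _ ((b.sub (scons (.recur a b t) (scons t .var)) id).sub σ p))
    rw [e]
    exact .recur_succ _ _ _
  · have e : (φ.sub (scons (.succ (.var 0)) fun n => .var (n + 1)) id).sub (upSub σ) p =
        (φ.sub (upSub σ) p).sub (scons (.succ (.var 0)) fun n => .var (n + 1)) id := by
      rw [Fml.sub_sub, Fml.sub_sub]
      refine Fml.sub_congr _ (fun n => ?_) fun n => rfl
      rcases n with _ | n
      · rfl
      · simp only [upSub, Tm.up, Tm.sub_ren]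
        exact Tm.ren_eq_sub _ _ _
    change IsIRCA0 (.imp ((φ.inst .zero).sub σ p) (.imp (.all (.imp _
      ((φ.sub (scons (.succ (.var 0)) fun n => .var (n + 1)) id).sub (upSub σ) p))) (.all _)))
    rw [e, Fml.sub_inst]
    exact .ind _ (h.sub _ _)
  · have e : (φ.sub (scons (.app 0 (.var 0)) .var) Nat.succ).sub
          (upSub fun n => (σ n).ren id Nat.succ) (upRen p) =
        (φ.sub (upSub (upSub σ)) p).sub (scons (.app 0 (.var 0)) .var) Nat.succ := by
      rw [Fml.sub_sub, Fml.sub_sub]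
      refine Fml.sub_congr _ (fun n => ?_) fun n => rfl
      rcases n with _ | _ | n
      · rfl
      · rfl
      · simp only [upSub, Tm.up, Tm.sub_ren, scons, Tm.sub, Tm.ren_ren]
        exact Tm.ren_eq_sub _ _ _
    change IsIRCA0 (.imp _ (.fex (.all ((φ.sub (scons (.app 0 (.var 0)) .var) Nat.succ).sub
      (upSub fun n => (σ n).ren id Nat.succ) (upRen p)))))
    rw [e]
    exact .choice _ (h.sub _ _)

theorem Fml.flift_sub_upSub (φ : Fml) (σ : ℕ → Tm) (p : ℕ → ℕ) :
    φ.flift.sub (upSub fun n => (σ n).ren id Nat.succ) (upRen p) = (φ.sub (upSub σ) p).flift := by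
  rw [← Fml.sub_flift]
  refine Fml.sub_congr _ (fun n => ?_) fun n => rfl
  rcases n with _ | n
  · rfl
  · simp [upSub, Tm.up, Tm.ren_ren]

theorem subClosed_ACA : SubClosed ACA := by
  rintro _ ⟨φ, h, rfl⟩ σ p
  refine ⟨φ.sub (upSub σ) p, h.sub _ _, ?_⟩
  rw [Fml.comprehension, Fml.comprehension, ← Fml.flift_sub_upSub]
  rfl

instance : IsBase IRCA0 := ⟨subClosed_IRCA0, Set.Subset.refl _⟩

instance : IsBase (IRCA0 ∪ ACA) where
  subClosed := fun φ h σ p =>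
    h.elim (fun h => .inl (subClosed_IRCA0 φ h σ p)) fun h => .inr (subClosed_ACA φ h σ p)
  irca := Set.subset_union_left

@[simp] theorem scons_zero {α : Type} (a : α) (s : ℕ → α) : scons a s 0 = a := rfl
@[simp] theorem scons_succ {α : Type} (a : α) (s : ℕ → α) (n : ℕ) : scons a s (n + 1) = s n := rfl
@[simp] theorem scons_one {α : Type} (a : α) (s : ℕ → α) : scons a s 1 = s 0 := rfl
@[simp] theorem scons_two {α : Type} (a : α) (s : ℕ → α) : scons a s 2 = s 1 := rfl
@[simp] theorem scons_three {α : Type} (a : α) (s : ℕ → α) : scons a s 3 = s 2 := rfl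

theorem comp_scons {α β : Type} (f : α → β) (a : α) (s : ℕ → α) :
    (fun n => f (scons a s n)) = scons (f a) fun n => f (s n) := by
  funext n; cases n <;> rfl

/-! The number sort of a saturated theory: terms modulo provable equality -/

namespace World

variable {T : Set Fml}

/-- Provable equality of terms. -/
def setoid (W : World T) : Setoid Tm where
  r s t := .eq s t ∈ W
  iseqv := by
    refine ⟨W.eq_mem_refl, fun {s t} h => ?_, fun {s t u} h h' => ?_⟩
    · have := W.mem_eqE (.eq (.var 0) (s.up 1)) h
      simp only [Fml.inst, Fml.sub, Tm.up, Tm.sub_ren] at this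
      have e : s.sub (fun n => scons t Tm.var (n + 1)) (fun n => id (id n)) = s := Tm.sub_var s
      have e' : s.sub (fun n => scons s Tm.var (n + 1)) (fun n => id (id n)) = s := Tm.sub_var s
      rw [e, e'] at this
      exact this (W.eq_mem_refl s)
    · have := W.mem_eqE (.eq (s.up 1) (.var 0)) h'
      simp only [Fml.inst, Fml.sub, Tm.up, Tm.sub_ren] at this
      have e : ∀ t, s.sub (fun n => scons t Tm.var (n + 1)) (fun n => id (id n)) = s :=
        fun _ => Tm.sub_var s
      rw [e, e] at this
      exact this h

/-- The numbers of a saturated theory. -/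
def Num (W : World T) : Type := Quotient W.setoid

/-- The number denoted by a term. -/
def val (W : World T) (t : Tm) : W.Num := Quotient.mk W.setoid t

/-- A term denoting a given number. -/
noncomputable def rep {W : World T} (x : W.Num) : Tm := Quotient.out x

variable {W : World T}

@[simp] theorem val_rep (x : W.Num) : W.val (rep x) = x := Quotient.out_eq x

theorem val_eq_val {s t : Tm} : W.val s = W.val t ↔ .eq s t ∈ W := Quotient.eq (r := W.setoid)

theorem val_sub_congr (t : Tm) {σ τ : ℕ → Tm} (p : ℕ → ℕ) (h : ∀ n, W.val (σ n) = W.val (τ n)) :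
    W.val (t.sub σ p) = W.val (t.sub τ p) :=
  val_eq_val.2 (W.eq_mem_sub_congr t p fun n => val_eq_val.1 (h n))

/-- Value of a term. -/
noncomputable def ev (W : World T) (t : Tm) (v : ℕ → W.Num) (p : ℕ → ℕ) : W.Num :=
  W.val (t.sub (fun n => rep (v n)) p)

theorem val_sub (t : Tm) (σ : ℕ → Tm) (p : ℕ → ℕ) :
    W.val (t.sub σ p) = W.ev t (fun n => W.val (σ n)) p :=
  val_sub_congr t p fun n => by simp

theorem ev_sub (t : Tm) (σ : ℕ → Tm) (q : ℕ → ℕ) (v : ℕ → W.Num) (p : ℕ → ℕ) :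
    W.ev (t.sub σ q) v p = W.ev t (fun n => W.ev (σ n) v p) fun n => p (q n) := by
  rw [ev, Tm.sub_sub, val_sub]
  rfl

theorem ev_ren (t : Tm) (r q : ℕ → ℕ) (v : ℕ → W.Num) (p : ℕ → ℕ) :
    W.ev (t.ren r q) v p = W.ev t (fun n => v (r n)) fun n => p (q n) := by
  rw [ev, Tm.sub_ren]
  rfl

@[simp] theorem ev_up (t : Tm) (m : ℕ) (v : ℕ → W.Num) (p : ℕ → ℕ) :
    W.ev (t.up m) v p = W.ev t (fun n => v (n + m)) p := ev_ren _ _ _ _ _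

theorem val_unary (t s : Tm) :
    W.val (t.sub (scons s .var) id) = W.val (t.sub (scons (rep (W.val s)) .var) id) :=
  val_sub_congr t id fun n => by cases n <;> simp

theorem val_binary (t s u : Tm) :
    W.val (t.sub (scons s (scons u .var)) id) =
      W.val (t.sub (scons (rep (W.val s)) (scons (rep (W.val u)) .var)) id) :=
  val_sub_congr t id fun n => by rcases n with _ | _ | n <;> simp

instance : Zero W.Num := ⟨W.val .zero⟩
instance : One W.Num := ⟨W.val (.succ .zero)⟩
noncomputable instance : Add W.Num := ⟨fun x y => W.val (.add (rep x) (rep y))⟩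
noncomputable instance : Sub W.Num := ⟨fun x y => W.val (.monus (rep x) (rep y))⟩

/-- The value of the function variable `g` at `x`. -/
noncomputable def app (g : ℕ) (x : W.Num) : W.Num := W.val (.app g (rep x))
noncomputable def pred (x : W.Num) : W.Num := W.val (.pred (rep x))
noncomputable def tri (x : W.Num) : W.Num := W.val (.tri (rep x))
noncomputable def pair (x y : W.Num) : W.Num := W.val (.pair (rep x) (rep y))
noncomputable def diag (x : W.Num) : W.Num := W.val (.diag (rep x))
noncomputable def fst (x : W.Num) : W.Num := W.val (.fst (rep x))
noncomputable def snd (x : W.Num) : W.Num := W.val (.snd (rep x))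
noncomputable def entry (x y : W.Num) : W.Num := W.val (.entry (rep x) (rep y))

/-- Primitive recursion. -/
noncomputable def recur (a b : Tm) (v : ℕ → W.Num) (p : ℕ → ℕ) (x : W.Num) : W.Num :=
  W.val (.recur (a.sub (fun n => rep (v n)) p) (b.sub (upSub (upSub fun n => rep (v n))) p) (rep x))

theorem val_zero : W.val .zero = 0 := rfl
theorem val_one : W.val (.succ .zero) = 1 := rfl
theorem val_add (s t : Tm) : W.val (.add s t) = W.val s + W.val t :=
  val_binary (.add (.var 0) (.var 1)) s t
theorem val_monus (s t : Tm) : W.val (.monus s t) = W.val s - W.val t :=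
  val_binary (.monus (.var 0) (.var 1)) s t
theorem val_pair (s t : Tm) : W.val (.pair s t) = pair (W.val s) (W.val t) :=
  val_binary (.pair (.var 0) (.var 1)) s t
theorem val_entry (s t : Tm) : W.val (.entry s t) = entry (W.val s) (W.val t) :=
  val_binary (.entry (.var 0) (.var 1)) s t
theorem val_app (g : ℕ) (s : Tm) : W.val (.app g s) = app g (W.val s) := val_unary (.app g (.var 0)) s
theorem val_pred (s : Tm) : W.val (.pred s) = pred (W.val s) := val_unary (.pred (.var 0)) s
theorem val_tri (s : Tm) : W.val (.tri s) = tri (W.val s) := val_unary (.tri (.var 0)) s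
theorem val_diag (s : Tm) : W.val (.diag s) = diag (W.val s) := val_unary (.diag (.var 0)) s
theorem val_fst (s : Tm) : W.val (.fst s) = fst (W.val s) := val_unary (.fst (.var 0)) s
theorem val_snd (s : Tm) : W.val (.snd s) = snd (W.val s) := val_unary (.snd (.var 0)) s

theorem val_recur_congr {s t : Tm} (a b : Tm) (h : W.val s = W.val t) :
    W.val (.recur a b s) = W.val (.recur a b t) := by
  have key : ∀ u, (Tm.recur (a.up 1) (b.sub (upSub (upSub fun n => .var (n + 1))) id) (.var 0)).sub
      (scons u .var) id = .recur a b u := by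
    intro u
    simp only [Tm.sub, Tm.up, Tm.sub_ren, Tm.sub_sub, scons_zero, Tm.recur.injEq, and_true]
    refine ⟨a.sub_var, Eq.trans (Tm.sub_congr _ (fun n => ?_) fun n => rfl) b.sub_var⟩
    rcases n with _ | _ | n <;> rfl
  rw [← key s, ← key t]
  exact val_sub_congr _ _ fun n => by cases n <;> simp [h]

section
variable (v : ℕ → W.Num) (p : ℕ → ℕ) (s t : Tm)

@[simp] theorem ev_var (i : ℕ) : W.ev (.var i) v p = v i := val_rep _
@[simp] theorem ev_zero : W.ev .zero v p = 0 := rfl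
@[simp] theorem ev_one : W.ev Tm.one v p = 1 := rfl
@[simp] theorem ev_add : W.ev (.add s t) v p = W.ev s v p + W.ev t v p := val_add _ _
@[simp] theorem ev_monus : W.ev (.monus s t) v p = W.ev s v p - W.ev t v p := val_monus _ _
@[simp] theorem ev_pair : W.ev (.pair s t) v p = pair (W.ev s v p) (W.ev t v p) := val_pair _ _
@[simp] theorem ev_entry : W.ev (.entry s t) v p = entry (W.ev s v p) (W.ev t v p) := val_entry _ _
@[simp] theorem ev_app (g : ℕ) : W.ev (.app g s) v p = app (p g) (W.ev s v p) := val_app _ _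
@[simp] theorem ev_pred : W.ev (.pred s) v p = pred (W.ev s v p) := val_pred _
@[simp] theorem ev_tri : W.ev (.tri s) v p = tri (W.ev s v p) := val_tri _
@[simp] theorem ev_diag : W.ev (.diag s) v p = diag (W.ev s v p) := val_diag _
@[simp] theorem ev_fst : W.ev (.fst s) v p = fst (W.ev s v p) := val_fst _
@[simp] theorem ev_snd : W.ev (.snd s) v p = snd (W.ev s v p) := val_snd _
@[simp] theorem ev_recur (a b : Tm) :
    W.ev (.recur a b t) v p = recur a b v p (W.ev t v p) := val_recur_congr _ _ (val_rep _).symm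

end

/-! Satisfaction -/

/-- Tarskian satisfaction in the structure of all numbers and all function variables. -/
def Sat (W : World T) : Fml → (ℕ → W.Num) → (ℕ → ℕ) → Prop
  | .eq s t, v, p => W.ev s v p = W.ev t v p
  | .bot, _, _ => False
  | .and φ ψ, v, p => W.Sat φ v p ∧ W.Sat ψ v p
  | .or φ ψ, v, p => W.Sat φ v p ∨ W.Sat ψ v p
  | .imp φ ψ, v, p => W.Sat φ v p → W.Sat ψ v p
  | .all φ, v, p => ∀ x, W.Sat φ (scons x v) p
  | .ex φ, v, p => ∃ x, W.Sat φ (scons x v) p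
  | .fall φ, v, p => ∀ g, W.Sat φ v (scons g p)
  | .fex φ, v, p => ∃ g, W.Sat φ v (scons g p)

section
variable (v : ℕ → W.Num) (p : ℕ → ℕ) (φ ψ : Fml)

@[simp] theorem sat_eq (s t : Tm) : W.Sat (.eq s t) v p ↔ W.ev s v p = W.ev t v p := Iff.rfl
@[simp] theorem sat_and : W.Sat (.and φ ψ) v p ↔ W.Sat φ v p ∧ W.Sat ψ v p := Iff.rfl
@[simp] theorem sat_or : W.Sat (.or φ ψ) v p ↔ W.Sat φ v p ∨ W.Sat ψ v p := Iff.rfl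
@[simp] theorem sat_imp : W.Sat (.imp φ ψ) v p ↔ (W.Sat φ v p → W.Sat ψ v p) := Iff.rfl
@[simp] theorem sat_neg : W.Sat (.neg φ) v p ↔ ¬ W.Sat φ v p := Iff.rfl
@[simp] theorem sat_all : W.Sat (.all φ) v p ↔ ∀ x, W.Sat φ (scons x v) p := Iff.rfl
@[simp] theorem sat_ex : W.Sat (.ex φ) v p ↔ ∃ x, W.Sat φ (scons x v) p := Iff.rfl

end

theorem sat_congr (φ : Fml) {v w : ℕ → W.Num} {p q : ℕ → ℕ} (h : ∀ n, v n = w n)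
    (h' : ∀ n, p n = q n) : W.Sat φ v p ↔ W.Sat φ w q := by
  rw [funext h, funext h']

theorem sat_sub (φ : Fml) : ∀ (σ : ℕ → Tm) (q : ℕ → ℕ) (v : ℕ → W.Num) (p : ℕ → ℕ),
    W.Sat (φ.sub σ q) v p ↔ W.Sat φ (fun n => W.ev (σ n) v p) fun n => p (q n) := by
  have up : ∀ (σ : ℕ → Tm) (v : ℕ → W.Num) (p : ℕ → ℕ) x n,
      W.ev (upSub σ n) (scons x v) p = scons x (fun n => W.ev (σ n) v p) n := by
    intro σ v p x n; cases n <;> simp [upSub]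
  have fup : ∀ (q p : ℕ → ℕ) g n, scons g p (upRen q n) = scons g (fun n => p (q n)) n := by
    intro q p g n; cases n <;> rfl
  induction φ with
  | eq s t => intros; simp [Fml.sub, ev_sub]
  | bot => intros; rfl
  | and φ ψ ih₁ ih₂ | or φ ψ ih₁ ih₂ | imp φ ψ ih₁ ih₂ => intros; simp [Fml.sub, ih₁, ih₂]
  | all φ ih =>
    intro σ q v p
    exact forall_congr' fun x => (ih _ _ _ _).trans (sat_congr φ (up σ v p x) fun n => rfl)
  | ex φ ih =>
    intro σ q v p
    exact exists_congr fun x => (ih _ _ _ _).trans (sat_congr φ (up σ v p x) fun n => rfl)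
  | fall φ ih =>
    intro σ q v p
    exact forall_congr' fun x => (ih _ _ _ _).trans
      (sat_congr φ (fun n => ev_ren _ _ _ _ _) (fup q p x))
  | fex φ ih =>
    intro σ q v p
    exact exists_congr fun x => (ih _ _ _ _).trans
      (sat_congr φ (fun n => ev_ren _ _ _ _ _) (fup q p x))

end World
-- Defining equations of the arithmetical operations on numbers
namespace World

variable {T : Set Fml} {W : World T}

theorem snd_eq (x : W.Num) : snd x = diag x - fst x := by
  simpa [Tm.snd] using (ev_snd (W := W) (fun _ => x) id (.var 0)).symm

theorem entry_eq (x y : W.Num) :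
    entry x y = fst (recur (.var 0) (.snd (.var 0)) (fun _ => x) id y) := by
  have h := ev_entry (W := W) (scons x (scons y fun _ => 0)) id (.var 0) (.var 1)
  simp only [Tm.entry, ev_fst, ev_recur, ev_var, scons_zero, scons_one] at h
  rw [← h]
  rfl

section
variable [hT : IsBase T]

theorem val_eq_of_ax {s t : Tm} (h : IsIRCA0 (.eq s t)) : W.val s = W.val t :=
  val_eq_val.2 (W.mem_of_prf (Γ := []) (.ax (hT.irca h)) (by simp))

theorem val_succ (s : Tm) : W.val (.succ s) = W.val s + 1 := by
  rw [← val_one, ← val_add]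
  have h := val_eq_of_ax (W := W) (.recur_succ s (.succ (.var 0)) .zero)
  refine Eq.trans ?_ h.symm
  have h' := val_eq_of_ax (W := W) (.recur_zero s (.succ (.var 0)))
  exact (val_unary (.succ (.var 0)) s).trans (h' ▸ (val_unary (.succ (.var 0)) _).symm)

@[simp] theorem ev_succ (v : ℕ → W.Num) (p : ℕ → ℕ) (s : Tm) :
    W.ev (.succ s) v p = W.ev s v p + 1 := val_succ _

@[simp] theorem recur_zero (a b : Tm) (v : ℕ → W.Num) (p : ℕ → ℕ) :
    recur a b v p 0 = W.ev a v p :=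
  (val_recur_congr _ _ (val_rep _)).trans (val_eq_of_ax (.recur_zero _ _))

@[simp] theorem recur_succ (a b : Tm) (v : ℕ → W.Num) (p : ℕ → ℕ) (x : W.Num) :
    recur a b v p (x + 1) = W.ev b (scons (recur a b v p x) (scons x v)) p := by
  have h : W.val (rep (x + 1)) = W.val (.succ (rep x)) := by rw [val_succ]; simp
  refine (val_recur_congr _ _ h).trans ((val_eq_of_ax (.recur_succ _ _ _)).trans ?_)
  rw [Tm.sub_sub, val_sub]
  congr 1
  funext n
  rcases n with _ | _ | n
  · rfl
  · exact val_rep x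
  · simp only [upSub, Tm.up, Tm.sub_ren]
    exact (congrArg W.val (Tm.sub_var _)).trans (val_rep _)

theorem add_zero' (x : W.Num) : x + 0 = x := by
  simpa [Tm.add] using (ev_add (W := W) (scons x fun _ => 0) id (.var 0) .zero).symm

theorem add_succ' (x y : W.Num) : x + (y + 1) = (x + y) + 1 := by
  have h := ev_add (W := W) (scons x (scons y fun _ => 0)) id (.var 0) (.succ (.var 1))
  have h' := ev_add (W := W) (scons x (scons y fun _ => 0)) id (.var 0) (.var 1)
  simp only [Tm.add, ev_recur, ev_succ, recur_succ, ev_var, scons_zero, scons_one] at h h'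
  rw [← h, h']

@[simp] theorem pred_zero : pred (0 : W.Num) = 0 := by
  have h := ev_pred (W := W) (fun _ => 0) id .zero
  simp only [Tm.pred, ev_recur, recur_zero, ev_zero] at h
  exact h.symm

@[simp] theorem pred_succ (x : W.Num) : pred (x + 1) = x := by
  have h := ev_pred (W := W) (fun _ => x) id (.succ (.var 0))
  simp only [Tm.pred, ev_recur, ev_succ, recur_succ, ev_var, scons_one, scons_zero] at h
  exact h.symm

theorem sub_zero' (x : W.Num) : x - 0 = x := by
  simpa [Tm.monus] using (ev_monus (W := W) (scons x fun _ => 0) id (.var 0) .zero).symm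

theorem sub_succ' (x y : W.Num) : x - (y + 1) = pred (x - y) := by
  have h := ev_monus (W := W) (scons x (scons y fun _ => 0)) id (.var 0) (.succ (.var 1))
  have h' := ev_monus (W := W) (scons x (scons y fun _ => 0)) id (.var 0) (.var 1)
  simp only [Tm.monus, ev_recur, ev_succ, recur_succ, ev_var, scons_zero, scons_one, ev_pred]
    at h h'
  rw [← h, h']

@[simp] theorem tri_zero : tri (0 : W.Num) = 0 := by
  simpa [Tm.tri] using (ev_tri (W := W) (fun _ => 0) id .zero).symm

@[simp] theorem tri_succ (x : W.Num) : tri (x + 1) = tri x + x := by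
  have h := ev_tri (W := W) (fun _ => x) id (.succ (.var 0))
  have h' := ev_tri (W := W) (fun _ => x) id (.var 0)
  simp only [Tm.tri, ev_recur, ev_succ, recur_succ, ev_var, scons_zero, scons_one, ev_add] at h h'
  rw [← h, h']

theorem diag_zero : diag (0 : W.Num) = 0 := by
  simpa [Tm.diag] using (ev_diag (W := W) (fun _ => 0) id .zero).symm

theorem diag_succ (x : W.Num) :
    diag (x + 1) = diag x + (1 - (tri (diag x + 1 + 1) - (x + 1))) := by
  have h := ev_diag (W := W) (fun _ => x) id (.succ (.var 0))
  have h' := ev_diag (W := W) (fun _ => x) id (.var 0)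
  simp only [Tm.diag, ev_recur, ev_succ, recur_succ, ev_var, scons_zero, scons_one, ev_add,
    ev_monus, ev_tri, ev_one] at h h'
  rw [← h, h']

theorem fst_eq (x : W.Num) : fst x = x - tri (diag x + 1) := by
  simpa [Tm.fst] using (ev_fst (W := W) (fun _ => x) id (.var 0)).symm

theorem pair_eq (x y : W.Num) : pair x y = tri (x + y + 1) + x := by
  simpa [Tm.pair] using
    (ev_pair (W := W) (scons x (scons y fun _ => 0)) id (.var 0) (.var 1)).symm

end

end World

/-! ### Formulas for which membership is Tarskian truth -/

/-- In every saturated theory, `φ` holds if and only if it is satisfied. -/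
def Dec (T : Set Fml) (φ : Fml) : Prop :=
  ∀ (W : World T) (σ : ℕ → Tm) (p : ℕ → ℕ), φ.sub σ p ∈ W ↔ W.Sat φ (fun n => W.val (σ n)) p

variable {T : Set Fml}

theorem dec_eq (s t : Tm) : Dec T (.eq s t) := fun W σ p => by
  rw [World.sat_eq, ← World.val_sub, ← World.val_sub, World.val_eq_val]
  rfl

theorem Dec.or {φ ψ : Fml} (h : Dec T φ) (h' : Dec T ψ) : Dec T (.or φ ψ) := fun W σ p => by
  rw [World.sat_or, ← h W, ← h' W]
  exact W.mem_or

theorem Dec.and {φ ψ : Fml} (h : Dec T φ) (h' : Dec T ψ) : Dec T (.and φ ψ) := fun W σ p => by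
  rw [World.sat_and, ← h W, ← h' W]
  exact W.mem_and

theorem Dec.ex {φ : Fml} (h : Dec T φ) : Dec T (.ex φ) := fun W σ p => by
  refine W.mem_ex.trans ⟨fun ⟨t, ht⟩ => ⟨W.val t, ?_⟩, fun ⟨x, hx⟩ => ⟨World.rep x, ?_⟩⟩
  · rwa [Fml.inst_sub_upSub, h W, comp_scons] at ht
  · rwa [Fml.inst_sub_upSub, h W, comp_scons, World.val_rep]

theorem Dec.fex {φ : Fml} (h : Dec T φ) : Dec T (.fex φ) := fun W σ p => by
  refine W.mem_fex.trans (exists_congr fun g => ?_)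
  rw [Fml.finst_sub_upRen, h W]

/-- In every saturated theory, one of `φ` and `¬φ` holds, in accordance with satisfaction. -/
def StrongDec (T : Set Fml) (φ : Fml) : Prop :=
  ∀ (W : World T) (σ : ℕ → Tm) (p : ℕ → ℕ),
    (W.Sat φ (fun n => W.val (σ n)) p → φ.sub σ p ∈ W) ∧
    (¬ W.Sat φ (fun n => W.val (σ n)) p → (φ.sub σ p).neg ∈ W)

theorem StrongDec.dec {φ : Fml} (h : StrongDec T φ) : Dec T φ := fun W σ p =>
  ⟨fun h' => by_contra fun hc => W.notMem_of_neg_mem ((h W σ p).2 hc) h', (h W σ p).1⟩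

theorem strongDec_bot : StrongDec T .bot := fun W _ _ =>
  ⟨False.elim, fun _ => W.mem_of_prf (Γ := []) (.impI (.hyp (by simp [Fml.sub]))) (by simp)⟩

theorem StrongDec.and {φ ψ : Fml} (h : StrongDec T φ) (h' : StrongDec T ψ) :
    StrongDec T (.and φ ψ) := fun W σ p => by
  refine ⟨(Dec.and h.dec h'.dec W σ p).2, fun hn => ?_⟩
  by_cases h₁ : W.Sat φ (fun n => W.val (σ n)) p
  · refine W.mem_of_prf (Γ := [(ψ.sub σ p).neg]) (.impI (.impE (φ := ψ.sub σ p) (.hyp ?_)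
      (.andE₂ (φ := φ.sub σ p) (.hyp ?_)))) ?_
    · simp [Fml.neg]
    · simp [Fml.sub]
    · simpa using (h' W σ p).2 fun h₂ => hn ⟨h₁, h₂⟩
  · refine W.mem_of_prf (Γ := [(φ.sub σ p).neg]) (.impI (.impE (φ := φ.sub σ p) (.hyp ?_)
      (.andE₁ (ψ := ψ.sub σ p) (.hyp ?_)))) ?_
    · simp [Fml.neg]
    · simp [Fml.sub]
    · simpa using (h W σ p).2 h₁

theorem StrongDec.or {φ ψ : Fml} (h : StrongDec T φ) (h' : StrongDec T ψ) :
    StrongDec T (.or φ ψ) := fun W σ p => by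
  refine ⟨(Dec.or h.dec h'.dec W σ p).2, fun hn => ?_⟩
  rw [World.sat_or, not_or] at hn
  refine W.mem_of_prf (Γ := [(φ.sub σ p).neg, (ψ.sub σ p).neg]) (.impI (.orE (φ := φ.sub σ p)
    (ψ := ψ.sub σ p) (.hyp ?_) (.impE (φ := φ.sub σ p) (.hyp ?_) (.hyp ?_))
      (.impE (φ := ψ.sub σ p) (.hyp ?_) (.hyp ?_)))) ?_
  · simp [Fml.sub]
  · simp [Fml.neg]
  · simp
  · simp [Fml.neg]
  · simp
  · simpa using ⟨(h W σ p).2 hn.1, (h' W σ p).2 hn.2⟩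

theorem StrongDec.imp {φ ψ : Fml} (h : StrongDec T φ) (h' : StrongDec T ψ) :
    StrongDec T (.imp φ ψ) := fun W σ p => by
  refine ⟨fun hs => ?_, fun hn => ?_⟩
  · by_cases h₁ : W.Sat φ (fun n => W.val (σ n)) p
    · exact W.mem_imp_of_mem ((h' W σ p).1 (hs h₁))
    · exact W.mem_imp_of_neg_mem ((h W σ p).2 h₁)
  · rw [World.sat_imp, Classical.not_imp] at hn
    refine W.mem_of_prf (Γ := [φ.sub σ p, (ψ.sub σ p).neg]) (.impI (.impE (φ := ψ.sub σ p) (.hyp ?_)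
      (.impE (φ := φ.sub σ p) (.hyp ?_) (.hyp ?_)))) ?_
    · simp [Fml.neg]
    · simp [Fml.sub]
    · simp
    · simpa using ⟨(h W σ p).1 hn.1, (h' W σ p).2 hn.2⟩

/-! ### Quantifier-free induction as a rule, and basic arithmetic -/

variable [hT : IsBase T]

/-- The rule of quantifier-free induction. -/
theorem World.sat_of_ind {φ : Fml} (hq : φ.QF) (hd : Dec T φ)
    (h₀ : ∀ (W : World T) v p, W.Sat φ (scons 0 v) p)
    (h₁ : ∀ (W : World T) v p x, W.Sat φ (scons x v) p → W.Sat φ (scons (x + 1) v) p)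
    (W : World T) (v : ℕ → W.Num) (p : ℕ → ℕ) (x : W.Num) : W.Sat φ (scons x v) p := by
  let ψ := φ.sub (upSub fun n => rep (v n)) p
  have hψ : ∀ t, ψ.inst t = φ.sub (scons t fun n => rep (v n)) p := Fml.inst_sub_upSub _ _ _
  have hstep : Prf T [] (.all (.imp ψ
      (ψ.sub (scons (.succ (.var 0)) fun n => .var (n + 1)) id))) := by
    -- The induction step is an implication under `∀`, so it has to be derivable, hence checked in
    -- every world that contains its premise. This is why `h₀` and `h₁` range over all worlds.
    refine Prf.allI_of_forall hT.subClosed fun t => .impI (Prf.of_worlds fun W' hW => ?_)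
    have h : ψ.inst t ∈ W' := hW _ (by simp [Fml.inst])
    rw [hψ, hd W', comp_scons] at h
    have h' := h₁ W' _ _ _ h
    have e : (ψ.sub (scons (.succ (.var 0)) fun n => .var (n + 1)) id).sub (scons t .var) id =
        ψ.inst (.succ t) := by
      rw [Fml.sub_sub, Fml.inst]
      exact Fml.sub_congr _ (fun n => by cases n <;> rfl) fun n => rfl
    rw [e, hψ, hd W', comp_scons, val_succ]
    exact h'
  have hbase : Prf T [] (ψ.inst .zero) := Prf.of_worlds fun W' _ => by
    rw [hψ, hd W', comp_scons]
    exact h₀ W' _ _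
  have := (((Prf.ax (hT.irca (.ind ψ (hq.sub _ _)))).impE hbase).impE hstep).allE (rep x)
  rw [hψ] at this
  have := (hd W _ _).1 (W.mem_of_prf this (by simp))
  rw [comp_scons] at this
  simpa using this

theorem World.ev_eq_of_ind (s t : Tm)
    (h₀ : ∀ (W : World T) v p, W.ev s (scons 0 v) p = W.ev t (scons 0 v) p)
    (h₁ : ∀ (W : World T) v p x, W.ev s (scons x v) p = W.ev t (scons x v) p →
      W.ev s (scons (x + 1) v) p = W.ev t (scons (x + 1) v) p)
    (W : World T) (v : ℕ → W.Num) (p : ℕ → ℕ) (x : W.Num) :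
    W.ev s (scons x v) p = W.ev t (scons x v) p :=
  sat_of_ind (φ := .eq s t) trivial (dec_eq s t) h₀ h₁ W v p x

namespace World

variable {W : World T}

theorem zero_add' (x : W.Num) : 0 + x = x := by
  simpa using ev_eq_of_ind (.add .zero (.var 0)) (.var 0) (fun W v p => by simp [add_zero'])
    (fun W v p x h => by
      simp only [ev_add, ev_var, ev_zero, scons_zero] at h ⊢
      simp only [add_succ', h]) W (fun _ => 0) id x

theorem succ_add' (x y : W.Num) : (x + 1) + y = (x + y) + 1 := by
  simpa using ev_eq_of_ind (.add (.succ (.var 1)) (.var 0)) (.succ (.add (.var 1) (.var 0)))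
    (fun W v p => by simp [add_zero'])
    (fun W v p x h => by
      simp only [ev_add, ev_succ, ev_var, scons_zero, scons_one] at h ⊢
      simp only [add_succ', h]) W (fun _ => x) id y

theorem add_comm' (x y : W.Num) : x + y = y + x := by
  simpa using ev_eq_of_ind (.add (.var 1) (.var 0)) (.add (.var 0) (.var 1))
    (fun W v p => by simp [add_zero', zero_add'])
    (fun W v p x h => by
      simp only [ev_add, ev_var, scons_zero, scons_one] at h ⊢
      simp only [add_succ', succ_add', h]) W (fun _ => x) id y

theorem add_assoc' (x y z : W.Num) : (x + y) + z = x + (y + z) := by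
  simpa using ev_eq_of_ind (.add (.add (.var 1) (.var 2)) (.var 0))
    (.add (.var 1) (.add (.var 2) (.var 0)))
    (fun W v p => by simp [add_zero'])
    (fun W v p x h => by
      simp only [ev_add, ev_var, scons_zero, scons_one, scons_two] at h ⊢
      simp only [add_succ', h]) W (scons x (scons y fun _ => 0)) id z

theorem eq_zero_or_eq_succ (x : W.Num) : x = 0 ∨ ∃ y, x = y + 1 := by
  have := sat_of_ind (φ := .or (.eq (.var 0) .zero) (.eq (.var 0) (.succ (.pred (.var 0)))))
    ⟨trivial, trivial⟩ (.or (dec_eq _ _) (dec_eq _ _)) (fun W v p => by simp)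
    (fun W v p x h => by simp) W (fun _ => 0) id x
  simp only [sat_or, sat_eq, ev_var, scons_zero, ev_zero, ev_succ, ev_pred] at this
  exact this.imp id fun h => ⟨_, h⟩

theorem succ_sub_succ' (x y : W.Num) : (x + 1) - (y + 1) = x - y := by
  simpa using ev_eq_of_ind (.monus (.succ (.var 1)) (.succ (.var 0))) (.monus (.var 1) (.var 0))
    (fun W v p => by simp [sub_zero', sub_succ'])
    (fun W v p x h => by
      simp only [ev_monus, ev_succ, ev_var, scons_zero, scons_one] at h ⊢
      rw [sub_succ', h, sub_succ']) W (fun _ => x) id y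

theorem zero_sub' (x : W.Num) : 0 - x = 0 := by
  simpa using ev_eq_of_ind (.monus .zero (.var 0)) .zero (fun W v p => by simp [sub_zero'])
    (fun W v p x h => by
      simp only [ev_monus, ev_zero, ev_var, scons_zero] at h ⊢
      rw [sub_succ', h, pred_zero]) W (fun _ => 0) id x

theorem add_sub_cancel_left' (x y : W.Num) : (x + y) - x = y := by
  simpa using ev_eq_of_ind (.monus (.add (.var 0) (.var 1)) (.var 0)) (.var 1)
    (fun W v p => by simp [zero_add', sub_zero'])
    (fun W v p x h => by simpa [succ_add', succ_sub_succ'] using h) W (fun _ => y) id x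

theorem sub_add_self' (x y : W.Num) : x - (x + y) = 0 := by
  simpa using ev_eq_of_ind (.monus (.var 0) (.add (.var 0) (.var 1))) .zero
    (fun W v p => by simp [zero_sub'])
    (fun W v p x h => by simpa [succ_add', succ_sub_succ'] using h) W (fun _ => y) id x

theorem eq_add_sub_or (x y : W.Num) : x = y + (x - y) ∨ y = x + (y - x) := by
  have := sat_of_ind (φ := .or (.eq (.var 0) (.add (.var 1) (.monus (.var 0) (.var 1))))
    (.eq (.var 1) (.add (.var 0) (.monus (.var 1) (.var 0)))))
    ⟨trivial, trivial⟩ (.or (dec_eq _ _) (dec_eq _ _))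
    (fun W v p => by simp [zero_add', sub_zero'])
    (fun W v p x h => by
      simp only [sat_or, sat_eq, ev_var, scons_zero, scons_one, ev_add, ev_monus] at h ⊢
      generalize v 0 = y at h ⊢
      rcases h with h | h
      · generalize x - y = d at h
        subst h
        rw [← add_succ', add_sub_cancel_left']
        exact .inl rfl
      · generalize y - x = d at h
        subst h
        rcases eq_zero_or_eq_succ d with rfl | ⟨d, rfl⟩
        · rw [add_zero', add_sub_cancel_left']
          exact .inl rfl
        · rw [add_succ', ← succ_add', add_sub_cancel_left']
          exact .inr rfl) W (fun _ => y) id x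
  simpa using this

theorem succ_ne_zero' (x : W.Num) : x + 1 ≠ 0 := by
  intro h
  have h' := W.mem_of_prf (Γ := []) (.ax (hT.irca (.succ_ne_zero (rep x)))) (by simp)
  refine W.notMem_of_neg_mem h' (val_eq_val.1 ?_)
  rw [val_succ, val_rep]
  exact h

/-- Mere absence of `s = t` from a theory does not refute it. But distinct numbers differ by some `d
+ 1`, and the equation expressing this lies in `W` and contradicts `s = t` in every world. -/
theorem neg_eq_mem {s t : Tm} (h : W.val s ≠ W.val t) : (Fml.eq s t).neg ∈ W := by
  have key : ∀ x y : W.Num, x ≠ y → ∃ d, x = y + (d + 1) ∨ y = x + (d + 1) := by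
    intro x y h
    rcases eq_add_sub_or x y with h' | h'
    · generalize x - y = d at h'
      rcases eq_zero_or_eq_succ d with rfl | ⟨d, rfl⟩
      · exact absurd (h'.trans (add_zero' y)) h
      · exact ⟨d, .inl h'⟩
    · generalize y - x = d at h'
      rcases eq_zero_or_eq_succ d with rfl | ⟨d, rfl⟩
      · exact absurd (h'.trans (add_zero' x)).symm h
      · exact ⟨d, .inr h'⟩
  have ne : ∀ (W : World T) (x d : W.Num), x ≠ x + (d + 1) := fun W x d h => by
    have := add_sub_cancel_left' x (d + 1)
    rw [← h] at this
    have h0 := add_sub_cancel_left' x 0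
    rw [add_zero'] at h0
    exact succ_ne_zero' d (this.symm.trans h0)
  obtain ⟨d, hd | hd⟩ := key _ _ h
  · refine W.mem_of_prf (Γ := [.eq s (.add t (.succ (rep d)))])
      (.impI (Prf.of_worlds fun W' hW => ?_)) ?_
    · have h₁ := val_eq_val.2 (hW (.eq s t) (by simp))
      have h₂ := val_eq_val.2 (hW (.eq s (.add t (.succ (rep d)))) (by simp))
      rw [val_add, val_succ, h₁] at h₂
      exact absurd h₂ (ne W' _ _)
    · simp only [List.mem_singleton, forall_eq, ← val_eq_val, val_add, val_succ, val_rep]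
      exact hd
  · refine W.mem_of_prf (Γ := [.eq t (.add s (.succ (rep d)))])
      (.impI (Prf.of_worlds fun W' hW => ?_)) ?_
    · have h₁ := val_eq_val.2 (hW (.eq s t) (by simp))
      have h₂ := val_eq_val.2 (hW (.eq t (.add s (.succ (rep d)))) (by simp))
      rw [val_add, val_succ, ← h₁] at h₂
      exact absurd h₂ (ne W' _ _)
    · simp only [List.mem_singleton, forall_eq, ← val_eq_val, val_add, val_succ, val_rep]
      exact hd

end World

theorem strongDec_eq (s t : Tm) : StrongDec T (.eq s t) := fun W σ p =>
  ⟨(dec_eq s t W σ p).2, fun h => World.neg_eq_mem fun h' => h (by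
    rw [World.val_sub, World.val_sub] at h'; exact h')⟩

/-- Decidability of equations propagates through the connectives; it makes classical reasoning about
quantifier-free formulas legitimate. -/
theorem Fml.QF.strongDec {φ : Fml} (h : φ.QF) : StrongDec T φ := by
  induction φ with
  | eq s t => exact strongDec_eq s t
  | bot => exact strongDec_bot
  | and φ ψ ih₁ ih₂ => exact (ih₁ h.1).and (ih₂ h.2)
  | or φ ψ ih₁ ih₂ => exact (ih₁ h.1).or (ih₂ h.2)
  | imp φ ψ ih₁ ih₂ => exact (ih₁ h.1).imp (ih₂ h.2)
  | _ => exact h.elim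

theorem Fml.QF.dec {φ : Fml} (h : φ.QF) : Dec T φ := h.strongDec.dec


/-! ### Deciding functions, explicit definitions and internal induction -/

/-- Membership of a universally quantified decided formula yields satisfaction. -/
theorem Dec.sat_all {T : Set Fml} {φ : Fml} (h : Dec T φ) {W : World T} {σ : ℕ → Tm} {p : ℕ → ℕ}
    (h' : (Fml.all φ).sub σ p ∈ W) (x : W.Num) :
    W.Sat φ (scons x fun n => W.val (σ n)) p := by
  have := W.mem_inst_of_all h' (World.rep x)
  rw [Fml.inst_sub_upSub, h W, comp_scons] at this
  simpa using this

/-- There is a function deciding `φ(x)`, where `x` is the number variable `0`. -/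
def Fml.decider (φ : Fml) : Fml :=
  .fex (.all (.or (.and φ.flift (.eq (.app 0 (.var 0)) Tm.one))
    (.and φ.flift.neg (.eq (.app 0 (.var 0)) .zero))))

theorem World.ev_val_var {T : Set Fml} {W : World T} (t : Tm) :
    W.ev t (fun n => W.val (.var n)) (fun n => n) = W.val t := by
  rw [← World.val_sub, Tm.sub_var]

@[simp] theorem World.ev_edgeCode {T : Set Fml} {W : World T} (s t : Tm) (v : ℕ → W.Num) (p : ℕ → ℕ) :
    W.ev (.edgeCode s t) v p = tri (W.ev t v p) + W.ev s v p := by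
  simp [Tm.edgeCode]

variable {T : Set Fml} [hT : IsBase T]

/-- Quantifier-free choice is applied to the relation `(φ(x) ∧ y = 1) ∨ (¬φ(x) ∧ y = 0)`, which is
total because `φ` is decided. -/
theorem Fml.QF.decider {φ : Fml} (h : φ.QF) (Γ : List Fml) : Prf T Γ φ.decider := by
  let θ : Fml := .or (.and φ.lift (.eq (.var 0) Tm.one)) (.and φ.lift.neg (.eq (.var 0) .zero))
  have hθ : θ.QF := ⟨⟨h.sub _ _, trivial⟩, ⟨h.sub _ _, trivial⟩, trivial⟩
  have e : φ.lift.sub (scons (.app 0 (.var 0)) .var) Nat.succ = φ.flift := by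
    rw [Fml.lift, Fml.sub_sub]
    rfl
  have e' : θ.sub (scons (.app 0 (.var 0)) .var) Nat.succ =
      .or (.and φ.flift (.eq (.app 0 (.var 0)) Tm.one))
        (.and φ.flift.neg (.eq (.app 0 (.var 0)) .zero)) := by
    rw [← e]
    rfl
  rw [Fml.decider, ← e']
  refine .impE (.ax (hT.irca (.choice θ hθ))) (Prf.allI_of_forall hT.subClosed fun t =>
    Prf.of_worlds fun W _ => ?_)
  refine ((hθ.dec.ex) W _ _).2 ?_
  by_cases hs : W.Sat φ (fun n => W.val (scons t .var n)) id
  · exact ⟨1, .inl ⟨(World.sat_sub _ _ _ _ _).2 ((World.sat_congr φ (by simp) fun n => rfl).1 hs), by simp⟩⟩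
  · exact ⟨0, .inr ⟨fun hc => hs ((World.sat_congr φ (by simp) fun n => rfl).1
      ((World.sat_sub _ _ _ _ _).1 hc)), by simp⟩⟩

/-- Explicit definition of functions. -/
theorem Prf.explicit (t : Tm) (Γ : List Fml) :
    Prf T Γ (.fex (.all (.eq (.app 0 (.var 0)) (t.ren id Nat.succ)))) := by
  have e : (Fml.eq (.var 0) (t.up 1)).sub (scons (.app 0 (.var 0)) .var) Nat.succ =
      .eq (.app 0 (.var 0)) (t.ren id Nat.succ) := by
    simp only [Fml.sub, Tm.up, Tm.sub_ren, Tm.ren_eq_sub t id]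
    rfl
  rw [← e]
  refine .impE (.ax (hT.irca (.choice (.eq (.var 0) (t.up 1)) trivial)))
    (Prf.allI_of_forall hT.subClosed fun t => Prf.of_worlds fun W _ => ?_)
  exact ((dec_eq _ _).ex W _ _).2 ⟨_, by simp; rfl⟩

namespace World

variable {W : World T}

theorem exists_app_eq (t : Tm) (v : ℕ → W.Num) (p : ℕ → ℕ) :
    ∃ g, ∀ x, app g x = W.ev t (scons x v) p := by
  have h := W.mem_of_prf (Prf.explicit (t.sub (upSub fun n => rep (v n)) p) []) (by simp)
  obtain ⟨g, hg⟩ := W.fex_mem _ h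
  refine ⟨g, fun x => ?_⟩
  have := (dec_eq _ _).sat_all hg x
  simp only [sat_eq, ev_app, ev_var, scons_zero, ev_ren, ev_sub] at this
  rw [this]
  congr 1
  funext n
  cases n <;> simp [upSub, ev_val_var]

theorem exists_decider {φ : Fml} (hq : φ.QF) (v : ℕ → W.Num) (p : ℕ → ℕ) :
    ∃ g, ∀ x, (W.Sat φ (scons x v) p ∧ app g x = 1) ∨ (¬ W.Sat φ (scons x v) p ∧ app g x = 0) := by
  have hq' := hq.sub (upSub fun n => rep (v n)) p
  have h := W.mem_of_prf (hq'.decider []) (by simp)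
  obtain ⟨g, hg⟩ := W.fex_mem _ h
  refine ⟨g, fun x => ?_⟩
  have hd : Fml.QF (.or (.and (φ.sub (upSub fun n => rep (v n)) p).flift
      (.eq (.app 0 (.var 0)) Tm.one)) (.and (φ.sub (upSub fun n => rep (v n)) p).flift.neg
        (.eq (.app 0 (.var 0)) .zero))) :=
    ⟨⟨hq'.sub _ _, trivial⟩, ⟨hq'.sub _ _, trivial⟩, trivial⟩
  have := hd.dec.sat_all hg x
  have e : W.Sat (φ.sub (upSub fun n => rep (v n)) p).flift
      (scons x fun n => W.val (.var n)) (scons g id) ↔ W.Sat φ (scons x v) p := by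
    rw [Fml.flift, sat_sub, sat_sub]
    refine sat_congr _ (fun n => ?_) fun n => rfl
    cases n <;> simp [upSub, ev_val_var]
  simp only [sat_or, sat_and, sat_neg] at this
  rw [e] at this
  simpa using this

/-- Induction for nonvanishing of a function. -/
theorem app_ne_zero_of_ind (g : ℕ) (h₀ : app g (0 : W.Num) ≠ 0)
    (h₁ : ∀ x : W.Num, app g x ≠ 0 → app g (x + 1) ≠ 0) (x : W.Num) : app g x ≠ 0 := by
  -- `last x` is the largest `y < x` with `g y ≠ 0`
  let b : Tm := .recur (.var 0) (.var 3) (.app 0 (.var 1))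
  let last : Tm := .recur .zero b (.var 0)
  -- A failure of induction for `g` comes with an explicit place where it fails, namely `last`. So
  -- formulated, the statement assumes nothing about `g`, and the induction rule, which needs its
  -- premises in all worlds, applies. The recursion in `b` is a definition by cases on whether `g`
  -- vanishes.
  let φ : Fml := .or (.eq (.app 0 .zero) .zero) (.or (.neg (.eq (.app 0 (.var 0)) .zero))
    (.and (.neg (.eq (.app 0 last) .zero)) (.eq (.app 0 (.succ last)) .zero)))
  have hq : φ.QF := ⟨trivial, ⟨trivial, trivial⟩, ⟨trivial, trivial⟩, trivial⟩
  have key := sat_of_ind (T := T) hq hq.dec (fun W v p => by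
    by_cases h : app (p 0) (0 : W.Num) = 0 <;> simp [φ, h]) (fun W v p x h => by
    have env : recur .zero b (scons (x + 1) v) p = recur (W := W) .zero b (scons x v) p := rfl
    simp only [φ, last, sat_or, sat_and, sat_neg, sat_eq, ev_app, ev_zero, ev_recur, ev_var,
      ev_succ, env, recur_succ, scons_zero, scons_one, b] at h ⊢
    refine h.imp id fun h => ?_
    generalize recur .zero (.recur (.var 0) (.var 3) (.app 0 (.var 1))) (scons x v) p x = y at h ⊢
    by_cases hx : app (p 0) (x + 1) = 0
    swap
    · exact .inl hx
    right
    rcases eq_zero_or_eq_succ (app (p 0) x) with h0 | ⟨z, hz⟩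
    · rw [h0, recur_zero, ev_var, scons_zero]
      exact h.resolve_left fun h => h h0
    · rw [hz, recur_succ, ev_var, scons_three, scons_two, scons_one, scons_zero]
      exact ⟨fun h => succ_ne_zero' z (hz.symm.trans h), hx⟩) W (fun _ => 0) (fun _ => g) x
  simp only [φ, last, sat_or, sat_and, sat_neg, sat_eq, ev_app, ev_zero, ev_recur, ev_var,
    ev_succ, scons_zero] at key
  rcases key with h | h | ⟨h, h'⟩
  · exact absurd h h₀
  · exact h
  · exact absurd h' (h₁ _ h)

/-- Induction for quantifier-free formulas, inside a saturated theory. -/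
theorem induct {φ : Fml} (hq : φ.QF) (v : ℕ → W.Num) (p : ℕ → ℕ) (h₀ : W.Sat φ (scons 0 v) p)
    (h₁ : ∀ x, W.Sat φ (scons x v) p → W.Sat φ (scons (x + 1) v) p) (x : W.Num) :
    W.Sat φ (scons x v) p := by
  obtain ⟨g, hg⟩ := exists_decider hq v p
  have one : (1 : W.Num) ≠ 0 := by
    have := succ_ne_zero' (0 : W.Num)
    rwa [zero_add'] at this
  have e : ∀ x, app g x ≠ 0 ↔ W.Sat φ (scons x v) p := fun x => by
    rcases hg x with h | h
    · simp [h, one]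
    · simp [h]
  simp only [← e] at h₀ h₁ ⊢
  exact app_ne_zero_of_ind g h₀ h₁ x

/-! Addition and order -/

noncomputable instance : AddCommMonoid W.Num where
  add_assoc := add_assoc'
  zero_add := zero_add'
  add_zero := add_zero'
  add_comm := add_comm'
  nsmul := nsmulRec

instance : IsLeftCancelAdd W.Num where
  add_left_cancel x y z h := by
    have h' : (x + y) - x = (x + z) - x := congrArg (· - x) h
    rwa [add_sub_cancel_left', add_sub_cancel_left'] at h'

instance : IsCancelAdd W.Num where
  add_right_cancel x y z h := by
    have h : y + x = z + x := h
    rw [add_comm y, add_comm z] at h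
    exact add_left_cancel h

theorem sub_eq_zero_iff_exists {x y : W.Num} : x - y = 0 ↔ ∃ d, y = x + d := by
  constructor
  · intro h
    rcases eq_add_sub_or x y with h' | h'
    · exact ⟨0, by rw [h, add_zero] at h'; rw [h', add_zero]⟩
    · exact ⟨_, h'⟩
  · rintro ⟨d, rfl⟩
    exact sub_add_self' x d

theorem eq_zero_of_add_eq_zero {x y : W.Num} (h : x + y = 0) : y = 0 := by
  rcases eq_zero_or_eq_succ y with rfl | ⟨y, rfl⟩
  · rfl
  · exact absurd ((add_assoc x y 1).trans h) (succ_ne_zero' _)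

/-- Taking `x - y = 0` as the order makes it agree definitionally with the meaning of `Fml.le`. -/
noncomputable instance : LinearOrder W.Num where
  le x y := x - y = 0
  le_refl x := sub_eq_zero_iff_exists.2 ⟨0, (add_zero x).symm⟩
  le_trans x y z h h' := by
    obtain ⟨d, rfl⟩ := sub_eq_zero_iff_exists.1 h
    obtain ⟨e, rfl⟩ := sub_eq_zero_iff_exists.1 h'
    exact sub_eq_zero_iff_exists.2 ⟨d + e, add_assoc _ _ _⟩
  le_antisymm x y h h' := by
    obtain ⟨d, rfl⟩ := sub_eq_zero_iff_exists.1 h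
    obtain ⟨e, he⟩ := sub_eq_zero_iff_exists.1 h'
    rw [add_assoc, left_eq_add, add_comm] at he
    rw [eq_zero_of_add_eq_zero he, add_zero]
  le_total x y := by
    simp only [sub_eq_zero_iff_exists]
    exact (eq_add_sub_or x y).symm.imp (fun h => ⟨_, h⟩) fun h => ⟨_, h⟩
  toDecidableLE := Classical.decRel _

theorem le_iff_exists {x y : W.Num} : x ≤ y ↔ ∃ d, y = x + d := sub_eq_zero_iff_exists

instance : IsOrderedCancelAddMonoid W.Num where
  add_le_add_left x y h z := by
    obtain ⟨d, rfl⟩ := le_iff_exists.1 h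
    exact le_iff_exists.2 ⟨d, add_right_comm _ _ _⟩
  le_of_add_le_add_left x y z h := by
    obtain ⟨d, hd⟩ := le_iff_exists.1 h
    rw [add_assoc] at hd
    exact le_iff_exists.2 ⟨d, add_left_cancel hd⟩

instance : CanonicallyOrderedAdd W.Num where
  exists_add_of_le h := le_iff_exists.1 h
  le_self_add _ y := le_iff_exists.2 ⟨y, rfl⟩
  le_add_self _ y := le_iff_exists.2 ⟨y, add_comm _ _⟩

instance : ZeroLEOneClass W.Num := ⟨zero_le⟩

instance : NeZero (1 : W.Num) := ⟨by
  have := succ_ne_zero' (0 : W.Num)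
  rwa [zero_add] at this⟩

theorem lt_iff_add_one_le {x y : W.Num} : x < y ↔ x + 1 ≤ y := by
  constructor
  · intro h
    obtain ⟨d, rfl⟩ := le_iff_exists.1 h.le
    rcases eq_zero_or_eq_succ d with rfl | ⟨d, rfl⟩
    · simp at h
    · exact le_iff_exists.2 ⟨d, by rw [add_comm d, add_assoc]⟩
  · intro h
    exact (lt_add_of_pos_right x one_pos).trans_le h

@[simp] theorem sat_le (s t : Tm) (v : ℕ → W.Num) (p : ℕ → ℕ) :
    W.Sat (Fml.le s t) v p ↔ W.ev s v p ≤ W.ev t v p := by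
  simp only [Fml.le, sat_eq, ev_monus]
  rfl

@[simp] theorem sat_lt (s t : Tm) (v : ℕ → W.Num) (p : ℕ → ℕ) :
    W.Sat (Fml.lt s t) v p ↔ W.ev s v p < W.ev t v p := by
  rw [Fml.lt, sat_le, ev_succ, lt_iff_add_one_le]

instance : OrderedSub W.Num where
  tsub_le_iff_right x y z := by
    rcases le_total x y with h | h
    · have e : x - y = 0 := h
      rw [e]
      exact iff_of_true zero_le (h.trans le_add_self)
    · obtain ⟨d, rfl⟩ := le_iff_exists.1 h
      rw [add_sub_cancel_left', add_comm z, add_le_add_iff_left]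

theorem lt_add_one_iff' {x y : W.Num} : x < y + 1 ↔ x ≤ y := by
  rw [lt_iff_add_one_le, add_le_add_iff_right]

/-! Pairing -/

theorem tri_one : tri (1 : W.Num) = 0 := by
  have := tri_succ (0 : W.Num)
  rwa [zero_add, tri_zero, add_zero] at this

theorem tri_mono {x y : W.Num} (h : x ≤ y) : tri x ≤ tri y := by
  obtain ⟨d, rfl⟩ := le_iff_exists.1 h
  have := induct (φ := .le (.tri (.var 1)) (.tri (.add (.var 1) (.var 0)))) trivial (fun _ => x) id
    (by simp) (fun d hd => by
      simp only [sat_le, ev_tri, ev_add, ev_var, scons_zero, scons_one] at hd ⊢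
      rw [← add_assoc, tri_succ]
      exact hd.trans le_self_add) d
  simpa using this

theorem tri_diag (x : W.Num) : tri (diag x + 1) ≤ x ∧ x < tri (diag x + 1 + 1) := by
  have := induct (φ := .and (.le (.tri (.succ (.diag (.var 0)))) (.var 0))
    (.lt (.var 0) (.tri (.succ (.succ (.diag (.var 0))))))) ⟨trivial, trivial⟩ (fun _ => 0) id
    (by simp [diag_zero, tri_one]) (fun x h => by
      simp only [sat_and, sat_le, sat_lt, ev_tri, ev_succ, ev_diag, ev_var, scons_zero] at h ⊢
      rw [diag_succ]
      -- The increment in `diag_succ` is `1` exactly when `x + 1` reaches the next triangular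
      -- number, and `0` otherwise.
      rcases (lt_iff_add_one_le.1 h.2).eq_or_lt with e | e
      · rw [← e, tsub_self, tsub_zero, ← e]
        refine ⟨le_rfl, ?_⟩
        rw [tri_succ (diag x + 1 + 1), ← e]
        exact lt_add_of_pos_right _ (one_pos.trans_le le_add_self)
      · have : 1 ≤ tri (diag x + 1 + 1) - (x + 1) := by
          rw [le_tsub_iff_left e.le]
          exact lt_iff_add_one_le.1 e
        rw [tsub_eq_zero_of_le this, add_zero]
        exact ⟨h.1.trans le_self_add, e⟩) x
  simpa using this

theorem diag_eq {x d : W.Num} (h : tri (d + 1) ≤ x) (h' : x < tri (d + 1 + 1)) : diag x = d := by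
  obtain ⟨h₁, h₂⟩ := tri_diag x
  rcases lt_trichotomy (diag x) d with hd | hd | hd
  · exact absurd (h₂.trans_le ((tri_mono (by
      rw [add_le_add_iff_right]; exact lt_iff_add_one_le.1 hd)).trans h)) (lt_irrefl _)
  · exact hd
  · exact absurd (h'.trans_le ((tri_mono (by
      rw [add_le_add_iff_right]; exact lt_iff_add_one_le.1 hd)).trans h₁)) (lt_irrefl _)

theorem diag_pair (x y : W.Num) : diag (pair x y) = x + y := by
  rw [pair_eq]
  refine diag_eq le_self_add ?_
  rw [tri_succ (x + y + 1), add_lt_add_iff_left, lt_add_one_iff']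
  exact le_self_add

@[simp] theorem fst_pair (x y : W.Num) : fst (pair x y) = x := by
  rw [fst_eq, diag_pair, pair_eq, add_tsub_cancel_left]

@[simp] theorem snd_pair (x y : W.Num) : snd (pair x y) = y := by
  rw [snd_eq, diag_pair, fst_pair, add_tsub_cancel_left]

/-- Writing `b = a + 1 + d` turns the edge code into the Cantor code of `a` and `d`. Hence `fst`
recovers the smaller vertex of an edge. -/
theorem edgeCode_eq_pair {a b : W.Num} (h : a < b) : ∃ d, tri b + a = pair a d := by
  obtain ⟨d, rfl⟩ := le_iff_exists.1 (lt_iff_add_one_le.1 h)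
  exact ⟨d, by rw [pair_eq, add_right_comm]⟩

theorem fst_edgeCode {a b : W.Num} (h : a < b) : fst (tri b + a) = a := by
  obtain ⟨d, hd⟩ := edgeCode_eq_pair h
  rw [hd, fst_pair]

end World
-- Primitive recursion, the pigeonhole principle and partial sums
namespace World

theorem recur_up {T : Set Fml} {W : World T} (a b : Tm) (v : ℕ → W.Num) (p : ℕ → ℕ) (y : W.Num) :
    recur (a.up 1) (b.ren (upRen (upRen Nat.succ)) id) (scons y v) p = recur a b v p := by
  funext x
  simp only [recur, Tm.up, Tm.sub_ren, upSub_upRen]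
  rfl

variable {T : Set Fml} [hT : IsBase T] {W : World T}

/-- Primitive recursion defines a function. -/
theorem exists_app_eq_recur (a b : Tm) (v : ℕ → W.Num) (p : ℕ → ℕ) :
    ∃ g, ∀ y, app g y = recur a b v p y := by
  obtain ⟨g, hg⟩ := exists_app_eq
    (.recur (a.up 1) (b.ren (upRen (upRen Nat.succ)) id) (.var 0)) v p
  exact ⟨g, fun y => by rw [hg, ev_recur, recur_up, ev_var, scons_zero]⟩

/-- Primitive recursion with a parameter. -/
theorem exists_recur (a b : Tm) (v : ℕ → W.Num) (p : ℕ → ℕ) :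
    ∃ g, ∀ x, app g (pair x 0) = W.ev a (scons x v) p ∧
      ∀ y, app g (pair x (y + 1)) = W.ev b (scons (app g (pair x y)) (scons y (scons x v))) p := by
  obtain ⟨g, hg⟩ := exists_app_eq
    ((Tm.recur (a.up 1) (b.ren (upRen (upRen Nat.succ)) id) (.var 0)).sub
      (scons (.snd (.var 0)) (scons (.fst (.var 0)) fun n => .var (n + 1))) id) v p
  have key : ∀ x y, app g (pair x y) = recur a b (scons x v) p y := by
    intro x y
    have env : (fun n => W.ev (scons (.snd (.var 0)) (scons (.fst (.var 0)) fun n => .var (n + 1)) n)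
        (scons (pair x y) v) p) = scons y (scons x v) := by
      funext n
      rcases n with _ | _ | n <;> simp
    rw [hg, ev_sub, env, ev_recur, recur_up]
    simp
  exact ⟨g, fun x => ⟨by rw [key, recur_zero], fun y => by rw [key, key, recur_succ]⟩⟩

/-- There is no injection of all numbers into the numbers below `k`. -/
theorem pigeonhole (c : ℕ) (k : W.Num) (hinj : ∀ i j : W.Num, i < j → app c i ≠ app c j)
    (hk : ∀ i, app c i < k) : False := by
  -- The Kronecker delta by truncated subtraction. The proof is a double count in which all counts
  -- are primitive recursive, so that quantifier-free induction suffices.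
  let δ : W.Num → W.Num → W.Num := fun x y => 1 - ((x - y) + (y - x))
  have δ_self : ∀ x, δ x x = 1 := fun x => by simp [δ]
  have δ_ne : ∀ x y, x ≠ y → δ x y = 0 := fun x y h => by
    refine tsub_eq_zero_of_le ?_
    rcases lt_or_gt_of_ne h with h | h
    · have : 1 ≤ y - x := by
        rw [le_tsub_iff_left h.le]
        exact lt_iff_add_one_le.1 h
      exact this.trans le_add_self
    · have : 1 ≤ x - y := by
        rw [le_tsub_iff_left h.le]
        exact lt_iff_add_one_le.1 h
      exact this.trans le_self_add
  have δ_le : ∀ x y, δ x y ≤ 1 := fun x y => tsub_le_self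
  -- `u (v, j)` is the number of `i < j` with `c i = v`
  obtain ⟨u, hu⟩ := exists_recur .zero (.add (.var 0) (.monus .one (.add
    (.monus (.app 0 (.var 1)) (.var 2)) (.monus (.var 2) (.app 0 (.var 1))))))
    (fun _ => (0 : W.Num)) (fun _ => c)
  have hu₀ : ∀ v : W.Num, app u (pair v 0) = 0 := fun v => (hu v).1
  have hu₁ : ∀ v j : W.Num, app u (pair v (j + 1)) = app u (pair v j) + δ (app c j) v :=
    fun v j => by simpa [δ] using (hu v).2 j
  -- `s (j, w)` is the sum of `u (v, j)` over `v < w`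
  obtain ⟨s, hs⟩ := exists_recur .zero (.add (.var 0) (.app 0 (.pair (.var 1) (.var 2))))
    (fun _ => (0 : W.Num)) (fun _ => u)
  have hs₀ : ∀ j : W.Num, app s (pair j 0) = 0 := fun j => (hs j).1
  have hs₁ : ∀ j w : W.Num, app s (pair j (w + 1)) = app s (pair j w) + app u (pair w j) :=
    fun j w => by simpa using (hs j).2 w
  -- `d (j, w)` is `1` if `c j < w` and `0` otherwise
  obtain ⟨d, hd⟩ := exists_recur .zero (.add (.var 0) (.monus .one (.add
    (.monus (.app 0 (.var 2)) (.var 1)) (.monus (.var 1) (.app 0 (.var 2))))))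
    (fun _ => (0 : W.Num)) (fun _ => c)
  have hd₀ : ∀ v : W.Num, app d (pair v 0) = 0 := fun v => (hd v).1
  have hd₁ : ∀ j w : W.Num, app d (pair j (w + 1)) = app d (pair j w) + δ (app c j) w :=
    fun v j => by simpa [δ] using (hd v).2 j
  clear hu hs hd
  clear_value δ
  have hd₂ : ∀ j w : W.Num, (w ≤ app c j → app d (pair j w) = 0) ∧
      (app c j < w → app d (pair j w) = 1) := by
    intro j w
    have := induct (W := W) (φ := .and (.imp (.le (.var 0) (.app 0 (.var 1)))
      (.eq (.app 1 (.pair (.var 1) (.var 0))) .zero)) (.imp (.lt (.app 0 (.var 1)) (.var 0))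
      (.eq (.app 1 (.pair (.var 1) (.var 0))) .one))) ⟨⟨trivial, trivial⟩, trivial, trivial⟩
      (fun _ => j) (scons c fun _ => d) (by simp [hd₀]) (fun w h => by
        simp only [sat_and, sat_imp, sat_le, sat_lt, sat_eq, ev_app, ev_pair, ev_var, scons_zero,
          scons_one, ev_zero, ev_one, hd₁, lt_add_one_iff', ← lt_iff_add_one_le] at h ⊢
        refine ⟨fun hw => ?_, fun hw => ?_⟩
        · rw [h.1 hw.le, δ_ne _ _ hw.ne', add_zero]
        · rcases hw.eq_or_lt with hw | hw
          · rw [h.1 hw.ge, hw, δ_self, zero_add]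
          · rw [h.2 hw, δ_ne _ _ hw.ne, add_zero]) w
    simpa using this
  have hs₂ : ∀ j w : W.Num, app s (pair (j + 1) w) = app s (pair j w) + app d (pair j w) := by
    intro j w
    have := induct (W := W) (φ := .eq (.app 0 (.pair (.succ (.var 1)) (.var 0)))
      (.add (.app 0 (.pair (.var 1) (.var 0))) (.app 1 (.pair (.var 1) (.var 0))))) trivial
      (fun _ => j) (scons s fun _ => d) (by simp [hd₀, hs₀]) (fun w h => by
        simp only [sat_eq, ev_app, ev_pair, ev_var, scons_zero, scons_one, ev_succ, ev_add, hs₁,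
          hd₁, hu₁] at h ⊢
        rw [h, add_add_add_comm]) w
    simpa using this
  have hs₃ : ∀ w : W.Num, app s (pair 0 w) = 0 := by
    intro w
    have := induct (W := W) (φ := .eq (.app 0 (.pair .zero (.var 0))) .zero) trivial
      (fun _ => 0) (fun _ => s) (by simp [hs₀]) (fun w h => by
        simp only [sat_eq, ev_app, ev_pair, ev_var, scons_zero, ev_zero, hs₁, hu₀] at h ⊢
        rw [h, add_zero]) w
    simpa using this
  -- Each of the first `j` indices has its value below `k`, so it is counted exactly once.
  have hs₄ : ∀ j : W.Num, app s (pair j k) = j := by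
    intro j
    have := induct (W := W) (φ := .eq (.app 0 (.pair (.var 0) (.var 1))) (.var 0)) trivial
      (fun _ => k) (fun _ => s) (by simp [hs₃]) (fun j h => by
        simp only [sat_eq, ev_app, ev_pair, ev_var, scons_zero, scons_one, hs₂] at h ⊢
        rw [h, (hd₂ j k).2 (hk j)]) j
    simpa using this
  have hu₂ : ∀ i j : W.Num, j ≤ i → app u (pair (app c i) j) = 0 := by
    intro i j
    have := induct (W := W) (φ := .imp (.le (.var 0) (.var 1))
      (.eq (.app 0 (.pair (.app 1 (.var 1)) (.var 0))) .zero)) ⟨trivial, trivial⟩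
      (fun _ => i) (scons u fun _ => c) (by simp [hu₀]) (fun j h => by
        simp only [sat_imp, sat_le, sat_eq, ev_app, ev_pair, ev_var, scons_zero, scons_one,
          ev_zero, hu₁, ← lt_iff_add_one_le] at h ⊢
        intro hj
        rw [h hj.le, δ_ne _ _ (hinj _ _ hj), add_zero]) j
    simpa using this
  have hu₃ : ∀ v j : W.Num, app u (pair v j) ≤ 1 := by
    intro v j
    have := induct (W := W) (φ := .le (.app 0 (.pair (.var 1) (.var 0))) .one) trivial
      (fun _ => v) (fun _ => u) (by simp [hu₀]) (fun j h => by
        simp only [sat_le, ev_app, ev_pair, ev_var, scons_zero, scons_one, ev_one, hu₁] at h ⊢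
        by_cases hv : app c j = v
        · subst hv
          rw [hu₂ j j le_rfl, zero_add]
          exact δ_le _ _
        · rwa [δ_ne _ _ hv, add_zero]) j
    simpa using this
  -- By injectivity each value below `w` is counted at most once. For `w = k` this contradicts the
  -- total `k + 1`.
  have hs₅ : ∀ w : W.Num, app s (pair (k + 1) w) ≤ w := by
    intro w
    have := induct (W := W) (φ := .le (.app 0 (.pair (.succ (.var 1)) (.var 0))) (.var 0)) trivial
      (fun _ => k) (fun _ => s) (by simp [hs₀]) (fun w h => by
        simp only [sat_le, ev_app, ev_pair, ev_var, ev_succ, scons_zero, scons_one, hs₁] at h ⊢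
        exact add_le_add h (hu₃ _ _)) w
    simpa using this
  have := hs₅ k
  rw [hs₄] at this
  exact absurd this (not_le.2 (lt_add_one_iff'.2 le_rfl))

/-- Partial sums of `g` vanish exactly as long as `g` does. -/
theorem partialSum_ne_zero_iff (h g : ℕ) (i : W.Num) (h₀ : app h 0 = app g (pair i 0))
    (h₁ : ∀ y, app h (y + 1) = app h y + app g (pair i (y + 1))) (a : W.Num) :
    app h a ≠ 0 ↔ ∃ n ≤ a, app g (pair i n) ≠ 0 := by
  constructor
  · intro ha
    by_contra! hc
    have := induct (W := W) (φ := .imp (.le (.var 0) (.var 1)) (.eq (.app 0 (.var 0)) .zero))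
      ⟨trivial, trivial⟩ (fun _ => a) (fun _ => h) (by simp [h₀, hc 0 zero_le]) (fun y hy => by
        simp only [sat_imp, sat_le, sat_eq, ev_app, ev_var, scons_zero, scons_one, ev_zero,
          h₁] at hy ⊢
        intro hle
        rw [hy (le_self_add.trans hle), hc _ hle, add_zero]) a
    simp at this
    exact ha this
  · rintro ⟨n, hn, hg⟩
    have hne : app g (pair i n) ≤ app h n := by
      rcases eq_zero_or_eq_succ n with rfl | ⟨n, rfl⟩
      · exact h₀.ge
      · rw [h₁]
        exact le_add_self
    obtain ⟨d, rfl⟩ := le_iff_exists.1 hn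
    have := induct (W := W) (φ := .le (.app 0 (.var 1)) (.app 0 (.add (.var 1) (.var 0))))
      trivial (fun _ => n) (fun _ => h) (by simp) (fun y hy => by
        simp only [sat_le, ev_app, ev_var, scons_zero, scons_one, ev_add] at hy ⊢
        rw [← add_assoc, h₁]
        exact hy.trans le_self_add) d
    simp only [sat_le, ev_app, ev_var, scons_zero, scons_one, ev_add] at this
    exact ((pos_iff_ne_zero.2 hg).trans_le (hne.trans this)).ne'

end World

/-! ### Rules for deciding functions -/

variable {T : Set Fml}

theorem World.mem_sub_iff {W : World T} (φ : Fml) {σ τ : ℕ → Tm} (p : ℕ → ℕ)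
    (h : ∀ n, W.val (σ n) = W.val (τ n)) : φ.sub σ p ∈ W ↔ φ.sub τ p ∈ W :=
  ⟨W.mem_sub_congr φ p fun n => World.val_eq_val.1 (h n),
    W.mem_sub_congr φ p fun n => World.val_eq_val.1 (h n).symm⟩

/-- The function `g` decides `φ(x)`, where `x` is the number variable `0`. -/
def Fml.decides (φ : Fml) (g : ℕ) : Fml :=
  .all (.or (.and φ (.eq (.app g (.var 0)) Tm.one)) (.and φ.neg (.eq (.app g (.var 0)) .zero)))

theorem Fml.finst_decider (φ : Fml) (g : ℕ) :
    (Fml.all (.or (.and φ.flift (.eq (.app 0 (.var 0)) Tm.one))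
      (.and φ.flift.neg (.eq (.app 0 (.var 0)) .zero)))).finst g = φ.decides g := by
  have e : φ.flift.sub (upSub .var) (scons g id) = φ := by
    rw [upSub_var, Fml.flift, Fml.sub_sub]
    exact φ.sub_var
  change Fml.all (.or (.and (φ.flift.sub (upSub .var) (scons g id)) _)
    (.and (.neg (φ.flift.sub (upSub .var) (scons g id))) _)) = _
  rw [e]
  rfl

theorem World.mem_decides {W : World T} {φ : Fml} {g : ℕ} (h : φ.decides g ∈ W) (t : Tm) :
    (φ.inst t ∈ W ∧ app g (W.val t) = 1) ∨ ((φ.inst t).neg ∈ W ∧ app g (W.val t) = 0) := by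
  have h' := W.mem_inst_of_all h t
  have h'' := (W.mem_or (φ := .and (φ.inst t) (.eq (.app g t) Tm.one))
    (ψ := .and (φ.inst t).neg (.eq (.app g t) .zero))).1 h'
  rw [W.mem_and, W.mem_and, ← val_eq_val, ← val_eq_val, val_app] at h''
  exact h''

theorem World.mem_explicit {W : World T} {t : Tm} {g : ℕ}
    (h : .all (.eq (.app g (.var 0)) t) ∈ W) (x : W.Num) :
    app g x = W.ev t (scons x fun n => W.val (.var n)) id := by
  have h' : (Fml.all (.eq (.app g (.var 0)) t)).sub .var id ∈ W := by
    convert h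
    exact Fml.sub_var _
  simpa using (dec_eq _ _).sat_all h' x

variable [hT : IsBase T]

theorem Prf.decider_elim {Γ : List Fml} {φ χ : Fml} (h : Prf T Γ φ.decider)
    (h' : ∀ g, Prf T (φ.decides g :: Γ) χ) : Prf T Γ χ :=
  .fexE_of_forall hT.subClosed h fun g => by
    rw [Fml.finst_decider]
    exact h' g

theorem Prf.decider_intro {Γ : List Fml} {φ : Fml} (g : ℕ)
    (h : ∀ (t : Tm) (W : World T), (∀ ψ ∈ Γ, ψ ∈ W) →
      (φ.inst t ∈ W ∧ World.app g (W.val t) = 1) ∨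
        ((φ.inst t).neg ∈ W ∧ World.app g (W.val t) = 0)) : Prf T Γ φ.decider := by
  refine .fexI g ?_
  rw [Fml.finst_decider]
  refine .allI_of_forall hT.subClosed fun t => .of_worlds fun W hW => ?_
  refine (W.mem_or (φ := .and (φ.inst t) (.eq (.app g t) Tm.one))
    (ψ := .and (φ.inst t).neg (.eq (.app g t) .zero))).2 ?_
  rw [W.mem_and, W.mem_and, ← World.val_eq_val, ← World.val_eq_val, World.val_app]
  exact h t W hW

/-- A formula equivalent to a quantifier-free formula has a deciding function. -/
theorem Prf.decider_of_equiv {Γ : List Fml} {θ φ : Fml} (hθ : θ.QF)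
    (h₁ : ∀ t, Prf T (θ.inst t :: Γ) (φ.inst t)) (h₂ : ∀ t, Prf T (φ.inst t :: Γ) (θ.inst t)) :
    Prf T Γ φ.decider := by
  refine (hθ.decider Γ).decider_elim fun g => .decider_intro g fun t W hW => ?_
  refine (World.mem_decides (hW _ (List.mem_cons_self)) t).imp (And.imp_left fun h => ?_)
    (And.imp_left fun h => ?_)
  · exact W.mem_of_prf (h₁ t) fun ψ hψ => by
      rcases List.mem_cons.1 hψ with rfl | hψ
      · exact h
      · exact hW _ (List.mem_cons_of_mem _ hψ)
  · refine W.mem_of_prf (Γ := (θ.inst t).neg :: Γ) (.impI (.impE (φ := θ.inst t)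
      (.hyp (by simp [Fml.neg])) ((h₂ t).weaken ?_))) fun ψ hψ => ?_
    · exact List.cons_subset_cons _ (List.subset_cons_self _ _)
    · rcases List.mem_cons.1 hψ with rfl | hψ
      · exact h
      · exact hW _ (List.mem_cons_of_mem _ hψ)

theorem Prf.explicit_elim {Γ : List Fml} {χ : Fml} (t : Tm)
    (h : ∀ g, Prf T (.all (.eq (.app g (.var 0)) t) :: Γ) χ) : Prf T Γ χ := by
  refine .fexE_of_forall hT.subClosed (.explicit t Γ) fun g => ?_
  have e : (t.ren id Nat.succ).sub (upSub .var) (scons g id) = t := by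
    rw [upSub_var, Tm.sub_ren]
    exact t.sub_var
  change Prf T (.all (.eq _ ((t.ren id Nat.succ).sub (upSub .var) (scons g id))) :: Γ) χ
  rw [e]
  exact h g

theorem Prf.of_sat {Γ : List Fml} {φ : Fml} {σ : ℕ → Tm} {p : ℕ → ℕ} (hφ : φ.QF)
    (h : ∀ W : World T, (∀ ψ ∈ Γ, ψ ∈ W) → W.Sat φ (fun n => W.val (σ n)) p) :
    Prf T Γ (φ.sub σ p) :=
  .of_worlds fun W hW => (hφ.dec W σ p).2 (h W hW)

theorem Prf.all_sub {Γ : List Fml} {φ : Fml} {σ : ℕ → Tm} {p : ℕ → ℕ}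
    (h : ∀ t, Prf T Γ (φ.sub (scons t σ) p)) : Prf T Γ ((Fml.all φ).sub σ p) :=
  .allI_of_forall hT.subClosed fun t => by
    rw [Fml.inst_sub_upSub]
    exact h t

/-! ### The coloring principle decides Σ₁ formulas -/

/-- The matrix of `totalColoring k`. -/
def totalColoringBody (k : Tm) : Fml :=
  .or
    (.and (Fml.lt .zero (.app 0 (Tm.pair (.var 0) .zero)))
      (Fml.neg (initialColorable 1
        ((k.ren id (fun n => n + 2)).up 1) (.var 0) (.app 0 (Tm.pair (.var 0) .zero)))))
    (.and (.eq (.app 0 (Tm.pair (.var 0) .zero)) .zero)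
      (isColoring 1 0 ((k.ren id (fun n => n + 2)).up 1) (.var 0)))

theorem Prf.totalColoring_elim {Γ : List Fml} {k : Tm} {χ : Fml} (e : ℕ)
    (h : Prf T Γ (totalColoring k))
    (h' : ∀ f, Prf T ((Fml.all (totalColoringBody k)).sub .var (scons f (scons e id)) :: Γ) χ) :
    Prf T Γ χ := by
  have h₁ := h.fallE e
  refine .fexE_of_forall hT.subClosed h₁ fun f => ?_
  have := h' f
  rw [← Fml.finst_sub_upRen] at this
  exact this

/-- In the second alternative the universal formulas have quantifier-free matrices and can be read
off as truths about numbers. In the first, colorability is not known to be decided, so its negation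
stays a membership. -/
theorem World.mem_totalColoringBody {W : World T} {k : Tm} {e f : ℕ}
    (h : (Fml.all (totalColoringBody k)).sub .var (scons f (scons e id)) ∈ W) (t : Tm) :
    (0 < app f (pair (W.val t) 0) ∧ ((initialColorable 1 ((k.ren id (fun n => n + 2)).up 1) (.var 0)
        (.app 0 (Tm.pair (.var 0) .zero))).sub (scons t .var) (scons f (scons e id))).neg ∈ W) ∨
      (app f (pair (W.val t) 0) = 0 ∧ (∀ n, app f (pair (W.val t) n) < W.val k) ∧
        ∀ a b, a < b → app e (pair (W.val t) (tri b + a)) ≠ 0 →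
          app f (pair (W.val t) a) ≠ app f (pair (W.val t) b)) := by
  have h₀ := W.mem_inst_of_all h t
  rw [Fml.inst_sub_upSub] at h₀
  refine (W.mem_or.1 h₀).imp (fun h => ?_) fun h => ?_
  · have h := W.mem_and.1 h
    refine ⟨?_, h.2⟩
    have := (Fml.QF.dec (φ := .lt .zero (.app 0 (Tm.pair (.var 0) .zero))) trivial) W
      (scons t .var) (scons f (scons e id)) |>.1 h.1
    simpa using this
  · have h := W.mem_and.1 h
    have h' := W.mem_and.1 h.2
    refine ⟨?_, fun n => ?_, fun a b hab he => ?_⟩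
    · simpa using (dec_eq _ _ W _ _).1 h.1
    · have := (Fml.QF.dec (φ := .lt (.app 0 (Tm.pair ((Tm.var 0).up 1) (.var 0)))
        (((k.ren id (fun n => n + 2)).up 1).up 1)) trivial).sat_all h'.1 n
      simp only [sat_lt, ev_app, ev_pair, ev_up, ev_var, scons_zero, ev_ren] at this
      have hk : W.ev k (fun i => scons n (fun n => W.val (scons t .var n)) (id i + 1 + 1))
          (fun n => scons f (scons e id) (n + 2)) = W.val k := ev_val_var k
      rw [hk] at this
      exact this
    · have h₁ := W.mem_inst_of_all h'.2 (rep a)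
      rw [Fml.inst_sub_upSub] at h₁
      have := (Fml.QF.dec (φ := .imp (Fml.lt (.var 1) (.var 0))
        (.imp (edge 1 ((Tm.var 0).up 2) (.var 1) (.var 0))
        (Fml.neg (.eq (.app 0 (Tm.pair ((Tm.var 0).up 2) (.var 1)))
          (.app 0 (Tm.pair ((Tm.var 0).up 2) (.var 0)))))))
        ⟨trivial, ⟨trivial, trivial⟩, trivial, trivial⟩).sat_all h₁ b
      simp only [sat_imp, sat_lt, edge, sat_neg, sat_eq, ev_app, ev_pair, ev_edgeCode, ev_up,
        ev_var, comp_scons W.val, val_rep] at this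
      exact this hab he

/-- Both projections of `0` are `0`, so the number `0` codes constant zero sequences of every
length, that is, the constant coloring. -/
theorem World.entry_zero {W : World T} (y : W.Num) : entry 0 y = 0 := by
  have h0 : fst (0 : W.Num) = 0 := by rw [fst_eq, zero_tsub]
  have h0' : snd (0 : W.Num) = 0 := by rw [snd_eq, h0, diag_zero, zero_tsub]
  obtain ⟨r, hr⟩ := exists_app_eq_recur (.var 0) (.snd (.var 0)) (fun _ => (0 : W.Num)) id
  have := induct (W := W) (φ := .eq (.app 0 (.var 0)) .zero) trivial (fun _ => 0) (fun _ => r)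
    (by simp [hr]) (fun y h => by
      simp only [sat_eq, ev_app, ev_var, ev_zero, scons_zero, hr, recur_succ, ev_snd] at h ⊢
      rw [h, h0']) y
  simp only [sat_eq, ev_app, ev_var, ev_zero, scons_zero, hr] at this
  rw [entry_eq, this, h0]

/-- If the edges up to `m` are absent, the constant coloring works. -/
theorem initialColorable_intro {Γ : List Fml} {e : ℕ} {k i m : Tm} {σ : ℕ → Tm} {p : ℕ → ℕ}
    (h : ∀ W : World T, (∀ ψ ∈ Γ, ψ ∈ W) → 0 < W.ev k (fun n => W.val (σ n)) p ∧
      ∀ a b, a < b → b ≤ W.ev m (fun n => W.val (σ n)) p →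
        World.app (p e) (World.pair (W.ev i (fun n => W.val (σ n)) p) (World.tri b + a)) = 0) :
    Prf T Γ ((initialColorable e k i m).sub σ p) := by
  refine .exI .zero ?_
  rw [Fml.inst_sub_upSub]
  refine .andI (.all_sub fun a => .of_sat ⟨trivial, trivial⟩ fun W hW => ?_)
    (.all_sub fun a => .all_sub fun b => .of_sat
      ⟨trivial, trivial, ⟨trivial, trivial⟩, trivial, trivial⟩ fun W hW => ?_)
  · have env : (fun n => W.val (scons a (scons .zero σ) (n + 2))) = fun n => W.val (σ n) := rfl
    simp only [World.sat_imp, World.sat_le, World.sat_lt, World.ev_entry, World.ev_up,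
      World.ev_var, scons_one, scons_zero, World.val_zero, World.entry_zero, env]
    exact fun _ => (h W hW).1
  · have env : (fun n => W.val (scons b (scons a (scons .zero σ)) (n + 3))) =
        fun n => W.val (σ n) := rfl
    simp only [World.sat_imp, World.sat_le, World.sat_lt, edge, World.sat_neg, World.sat_eq,
      World.ev_app, World.ev_pair, World.ev_edgeCode, World.ev_up, World.ev_var, scons_one,
      scons_zero, env]
    exact fun hab hb hne => absurd ((h W hW).2 _ _ hab hb) hne

/-- The partial sums of the functions `n ↦ g (i, n)`; the pair coded by `z` consists of `i` and a
pair whose first component is the number of the last summand. -/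
def sumTerm (g : ℕ) : Tm :=
  .recur (.app g (.pair (.fst (.var 0)) .zero))
    (.add (.var 0) (.app g (.pair (.fst (.var 2)) (.succ (.var 1))))) (.fst (.snd (.var 0)))

/-- For the code `c` of an edge `a < b` one has `fst c = a`, so the pair is joined in `G_x`
precisely when a witness `n ≤ a` exists. The only assumption is the definition of `e`, so the
equivalence is available in any world containing it. -/
theorem World.app_sum_ne_zero_iff {W : World T} {e g : ℕ}
    (he : .all (.eq (.app e (.var 0)) (sumTerm g)) ∈ W) (x c : W.Num) :
    app e (pair x c) ≠ 0 ↔ ∃ n ≤ fst c, app g (pair x n) ≠ 0 := by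
  rw [mem_explicit he, sumTerm, ev_recur]
  obtain ⟨h, hh⟩ := exists_app_eq_recur (.app g (.pair (.fst (.var 0)) .zero))
    (.add (.var 0) (.app g (.pair (.fst (.var 2)) (.succ (.var 1)))))
    (scons (pair x c) fun n => W.val (.var n)) id
  rw [← hh]
  simp only [ev_fst, ev_snd, ev_var, scons_zero, snd_pair]
  exact partialSum_ne_zero_iff h g x (by simp [hh]) (fun y => by simp [hh]) _

/-- The coloring principle yields deciding functions for `Σ₁` formulas. -/
theorem Prf.decider_of_totalColoring {Γ : List Fml} {k : Tm} (hC : Prf T Γ (totalColoring k))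
    (h2 : twoLe k ∈ Γ) (g : ℕ) :
    Prf T Γ (Fml.ex (.neg (.eq (.app g (.pair (.var 1) (.var 0))) .zero))).decider := by
  have hq : (Fml.neg (.eq (.app g (.pair (.var 1) (.var 0))) .zero)).QF := ⟨trivial, trivial⟩
  have sat : ∀ (W : World T) t, (Fml.ex (.neg (.eq (.app g (.pair (.var 1) (.var 0))) .zero))).inst t ∈ W ↔
      ∃ y, World.app g (World.pair (W.val t) y) ≠ 0 := by
    intro W t
    rw [Fml.inst, hq.dec.ex W]
    simp
  refine .explicit_elim (sumTerm g) fun e => .totalColoring_elim e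
    (hC.weaken (List.subset_cons_self _ _)) fun f => ?_
  -- Which alternative of the principle occurs is the quantifier-free condition `f (x, 0) ≠ 0`; it
  -- turns out to be equivalent to the existence of a witness.
  refine .decider_of_equiv (θ := .neg (.eq (.app f (.pair (.var 0) .zero)) .zero))
    ⟨trivial, trivial⟩ (fun t => .of_worlds fun W hW => ?_) fun t => .of_worlds fun W hW => ?_
  all_goals
    have hE := hW _ (List.mem_cons_of_mem _ (List.mem_cons_of_mem _ List.mem_cons_self))
    have hB := World.mem_totalColoringBody (hW _ (List.mem_cons_of_mem _ List.mem_cons_self)) t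
    have hθ := (Fml.QF.dec (T := T) (φ := .neg (.eq (.app f (.pair (.var 0) .zero)) .zero))
      ⟨trivial, trivial⟩) W (scons t .var) id
    simp only [World.sat_neg, World.sat_eq, World.ev_app, World.ev_pair, World.ev_var,
      World.ev_zero, scons_zero, id] at hθ
  · rw [sat]
    by_contra! hc
    rcases hB with ⟨_, hB⟩ | ⟨hB, _⟩
    -- Colorability contains `∀` and `→`, so it has to be derived rather than checked in `W` alone.
    -- With `m = f (t, 0)`, the absence of witnesses up to `m` is handed to the other worlds as one
    -- equation, the vanishing of the partial sum up to `m`, coded by the first component of `pair m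
    -- 0`.
    · refine W.notMem_of_neg_mem hB (W.mem_of_prf (Γ := [.eq (.app e (.pair t
        (.pair (.app f (.pair t .zero)) .zero))) .zero, .all (.eq (.app e (.var 0)) (sumTerm g)),
        twoLe k]) (initialColorable_intro fun W' hW' => ?_) ?_)
      · have h₁ := World.val_eq_val.2 (hW' _ List.mem_cons_self)
        have h₂ := hW' _ (List.mem_cons_of_mem _ List.mem_cons_self)
        have h₃ := hW' _ (List.mem_cons_of_mem _ (List.mem_cons_of_mem _ List.mem_cons_self))
        have hK : W'.ev ((k.ren id (fun n => n + 2)).up 1) (fun n => W'.val (scons t .var n))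
            (scons f (scons e id)) = W'.val k := by
          rw [World.ev_up, World.ev_ren]
          exact World.ev_val_var k
        rw [hK]
        simp only [World.val_app, World.val_pair, World.val_zero, World.ev_app, World.ev_pair,
          World.ev_var, World.ev_zero, scons_zero, scons_one] at h₁ ⊢
        refine ⟨?_, fun a b hab hb => ?_⟩
        · have : W'.val (.succ (.succ .zero)) ≤ W'.val k := by
            have := World.val_eq_val.2 h₃
            rwa [World.val_monus] at this
          rw [World.val_succ] at this
          exact (one_pos.trans_le le_add_self).trans_le this
        · by_contra hne
          obtain ⟨n, hn, hg⟩ := (World.app_sum_ne_zero_iff h₂ _ _).1 hne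
          rw [World.fst_edgeCode hab] at hn
          refine (World.app_sum_ne_zero_iff h₂ _ _).2 ⟨n, ?_, hg⟩ h₁
          rw [World.fst_pair]
          exact (hn.trans hab.le).trans hb
      · intro ψ hψ
        rw [List.mem_cons, List.mem_cons, List.mem_singleton] at hψ
        rcases hψ with rfl | rfl | rfl
        · rw [← World.val_eq_val]
          simp only [World.val_app, World.val_pair, World.val_zero]
          by_contra hne
          obtain ⟨n, _, hg⟩ := (World.app_sum_ne_zero_iff hE _ _).1 hne
          exact hg (hc n)
        · exact hE
        · exact hW _ (List.mem_cons_of_mem _ (List.mem_cons_of_mem _ (List.mem_cons_of_mem _ h2)))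
    · exact (hθ.1 (hW _ List.mem_cons_self)) hB
  · refine hθ.2 fun h0 => ?_
    obtain ⟨n, hn⟩ := (sat W t).1 (hW _ List.mem_cons_self)
    rcases hB with ⟨hB, _⟩ | ⟨_, hB, hB'⟩
    · exact hB.ne' h0
    -- The shifted coloring `i ↦ f (t, n + i)` lives on the vertices from the witness `n` on. These
    -- form a clique, so it would be injective.
    obtain ⟨c, hc⟩ := World.exists_app_eq (.app 0 (.pair (.var 1) (.add (.var 2) (.var 0))))
      (scons (W.val t) fun _ => n) fun _ => f
    simp only [World.ev_app, World.ev_pair, World.ev_add, World.ev_var, scons_zero, scons_one,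
      scons_two] at hc
    refine World.pigeonhole c (W.val k) (fun i j hij => ?_) fun i => by rw [hc]; exact hB _
    rw [hc, hc]
    have hlt : n + i < n + j := by simpa using hij
    refine hB' _ _ hlt ((World.app_sum_ne_zero_iff hE _ _).2 ⟨n, ?_, hn⟩)
    rw [World.fst_edgeCode hlt]
    exact le_self_add


/-! ### From Σ₁ formulas to all arithmetical formulas -/

theorem World.mem_neg_of_prf {T : Set Fml} {W : World T} {φ ψ : Fml} (h : Prf T [φ] ψ)
    (hψ : ψ.neg ∈ W) : φ.neg ∈ W :=
  W.mem_of_prf (Γ := [ψ.neg]) (.impI (.impE (φ := ψ) (.hyp (by simp [Fml.neg]))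
    (h.weaken (by simp)))) (by simpa using hψ)

theorem Fml.inst_sub (φ : Fml) (σ : ℕ → Tm) (p : ℕ → ℕ) (t : Tm) :
    (φ.sub σ p).inst t = φ.sub (fun n => (σ n).sub (scons t .var) id) p :=
  Fml.sub_sub _ _ _ _ _

/-- All substitution instances of `φ` have deciding functions under the hypotheses `Γ`. -/
def Decided (T : Set Fml) (Γ : List Fml) (φ : Fml) : Prop :=
  ∀ (σ : ℕ → Tm) (p : ℕ → ℕ), Prf T Γ (φ.sub σ p).decider

variable {T : Set Fml} {Γ : List Fml} {φ ψ : Fml}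

/-- A deciding function for `φ` with a dummy variable is evaluated at `0`. -/
theorem Decided.mem_or_neg_mem (h : Decided T Γ φ) {W : World T} (hW : ∀ ψ ∈ Γ, ψ ∈ W)
    (σ : ℕ → Tm) (p : ℕ → ℕ) : φ.sub σ p ∈ W ∨ (φ.sub σ p).neg ∈ W := by
  obtain ⟨g, hg⟩ := W.fex_mem _ (W.mem_of_prf (h (fun n => (σ n).up 1) p) hW)
  rw [Fml.finst_decider] at hg
  have e : (φ.sub (fun n => (σ n).up 1) p).inst .zero = φ.sub σ p := by
    rw [Fml.inst_sub]
    exact Fml.sub_congr _ (fun n => (Tm.sub_ren _ _ _ _ _).trans (Tm.sub_var _)) fun n => rfl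
  rw [← e]
  exact (World.mem_decides hg .zero).imp And.left And.left

/-- The equation `g x = 1`. -/
def eqOne (g : ℕ) : Fml := .eq (.app g (.var 0)) .one

theorem World.eqOne_inst_mem {W : World T} (g : ℕ) (t : Tm) :
    (eqOne g).inst t ∈ W ↔ app g (W.val t) = 1 := by
  rw [Fml.inst, eqOne, dec_eq _ _ W]
  simp

theorem World.mem_or_neg_mem_of_decides {W : World T} {φ : Fml} {g : ℕ} (h : φ.decides g ∈ W)
    (t : Tm) : φ.inst t ∈ W ∨ (φ.inst t).neg ∈ W :=
  (mem_decides h t).imp And.left And.left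

theorem World.mem_ex_sub {W : World T} (σ : ℕ → Tm) (p : ℕ → ℕ) :
    (Fml.ex φ).sub σ p ∈ W ↔ ∃ u, φ.sub (scons u σ) p ∈ W := by
  refine W.mem_ex.trans (exists_congr fun u => ?_)
  rw [Fml.inst_sub_upSub]

variable [hT : IsBase T]

theorem Fml.QF.decided (h : φ.QF) : Decided T Γ φ := fun _ _ => (h.sub _ _).decider _

theorem World.eqOne_inst_mem_iff {W : World T} {φ : Fml} {g : ℕ} (h : φ.decides g ∈ W) (t : Tm) :
    (eqOne g).inst t ∈ W ↔ φ.inst t ∈ W := by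
  rw [eqOne_inst_mem]
  rcases mem_decides h t with ⟨h₁, h₂⟩ | ⟨h₁, h₂⟩
  · exact iff_of_true h₂ h₁
  · exact iff_of_false (fun h' => zero_ne_one (h₂.symm.trans h')) (W.notMem_of_neg_mem h₁)

theorem Decided.and (h : Decided T Γ φ) (h' : Decided T Γ ψ) : Decided T Γ (.and φ ψ) :=
  fun σ p => (h σ p).decider_elim fun g => ((h' σ p).weaken (List.subset_cons_self _ _)).decider_elim
    fun g' => .decider_of_equiv (θ := .and (eqOne g) (eqOne g')) ⟨trivial, trivial⟩
      (fun t => .of_worlds fun W hW => by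
        have h₁ := World.eqOne_inst_mem_iff (hW ((φ.sub σ p).decides g) (by simp)) t
        have h₂ := World.eqOne_inst_mem_iff (hW ((ψ.sub σ p).decides g') (by simp)) t
        have h₀ := W.mem_and.1 (hW _ List.mem_cons_self)
        exact W.mem_and.2 ⟨h₁.1 h₀.1, h₂.1 h₀.2⟩)
      fun t => .of_worlds fun W hW => by
        have h₁ := World.eqOne_inst_mem_iff (hW ((φ.sub σ p).decides g) (by simp)) t
        have h₂ := World.eqOne_inst_mem_iff (hW ((ψ.sub σ p).decides g') (by simp)) t
        have h₀ := W.mem_and.1 (hW _ List.mem_cons_self)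
        exact W.mem_and.2 ⟨h₁.2 h₀.1, h₂.2 h₀.2⟩

theorem Decided.or (h : Decided T Γ φ) (h' : Decided T Γ ψ) : Decided T Γ (.or φ ψ) :=
  fun σ p => (h σ p).decider_elim fun g => ((h' σ p).weaken (List.subset_cons_self _ _)).decider_elim
    fun g' => .decider_of_equiv (θ := .or (eqOne g) (eqOne g')) ⟨trivial, trivial⟩
      (fun t => .of_worlds fun W hW => by
        have h₁ := World.eqOne_inst_mem_iff (hW ((φ.sub σ p).decides g) (by simp)) t
        have h₂ := World.eqOne_inst_mem_iff (hW ((ψ.sub σ p).decides g') (by simp)) t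
        have h₀ := W.mem_or.1 (hW _ List.mem_cons_self)
        exact W.mem_or.2 (h₀.imp h₁.1 h₂.1))
      fun t => .of_worlds fun W hW => by
        have h₁ := World.eqOne_inst_mem_iff (hW ((φ.sub σ p).decides g) (by simp)) t
        have h₂ := World.eqOne_inst_mem_iff (hW ((ψ.sub σ p).decides g') (by simp)) t
        have h₀ := W.mem_or.1 (hW _ List.mem_cons_self)
        exact W.mem_or.2 (h₀.imp h₁.2 h₂.2)

theorem Decided.imp (h : Decided T Γ φ) (h' : Decided T Γ ψ) : Decided T Γ (.imp φ ψ) :=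
  fun σ p => (h σ p).decider_elim fun g => ((h' σ p).weaken (List.subset_cons_self _ _)).decider_elim
    fun g' => .decider_of_equiv (θ := .imp (eqOne g) (eqOne g')) ⟨trivial, trivial⟩
      (fun t => .of_worlds fun W hW => by
        have h₁ := hW ((φ.sub σ p).decides g) (by simp)
        have h₂ := World.eqOne_inst_mem_iff (hW ((ψ.sub σ p).decides g') (by simp)) t
        -- Intuitionistically, the implication follows from the truth values only because the
        -- antecedent is decided.
        rcases World.mem_or_neg_mem_of_decides h₁ t with h₃ | h₃
        · exact W.mem_imp_of_mem (h₂.1 (W.mem_mp (hW _ List.mem_cons_self)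
            ((World.eqOne_inst_mem_iff h₁ t).2 h₃)))
        · exact W.mem_imp_of_neg_mem h₃)
      fun t => .impI (.of_worlds fun W hW => by
        have h₁ := World.eqOne_inst_mem_iff (hW ((φ.sub σ p).decides g) (by simp)) t
        have h₂ := World.eqOne_inst_mem_iff (hW ((ψ.sub σ p).decides g') (by simp)) t
        exact h₂.2 (W.mem_mp (hW _ (List.mem_cons_of_mem _ List.mem_cons_self))
          (h₁.1 (hW _ List.mem_cons_self))))

theorem Decided.ex {k : Tm} (hC : Prf T Γ (totalColoring k)) (h2 : twoLe k ∈ Γ)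
    (h : Decided T Γ φ) : Decided T Γ (.ex φ) := fun σ p => by
  -- instance of `φ` with the two components of the variable `0` for its first two variables
  let σ' : ℕ → Tm := scons (.snd (.var 0))
    fun n => (σ n).sub (scons (.fst (.var 0)) fun n => .var (n + 1)) id
  refine (h σ' p).decider_elim fun g => ?_
  have link : ∀ (W : World T), (φ.sub σ' p).decides g ∈ W → ∀ t u,
      (World.app g (World.pair (W.val t) (W.val u)) ≠ 0 ↔
        φ.sub (scons u fun n => (σ n).sub (scons t .var) id) p ∈ W) := by
    intro W hg t u
    have e : (φ.sub σ' p).inst (.pair t u) ∈ W ↔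
        φ.sub (scons u fun n => (σ n).sub (scons t .var) id) p ∈ W := by
      rw [Fml.inst_sub]
      refine World.mem_sub_iff φ p fun n => ?_
      rcases n with _ | n
      · change W.val (.snd (.pair t u)) = W.val u
        rw [World.val_snd, World.val_pair, World.snd_pair]
      · change W.val (((σ n).sub _ id).sub _ id) = W.val ((σ n).sub _ id)
        rw [Tm.sub_sub]
        refine World.val_sub_congr _ _ fun m => ?_
        rcases m with _ | m
        · change W.val (.fst (.pair t u)) = W.val t
          rw [World.val_fst, World.val_pair, World.fst_pair]
        · rfl
    rw [← e, ← World.val_pair]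
    rcases World.mem_decides hg (.pair t u) with ⟨h₁, h₂⟩ | ⟨h₁, h₂⟩
    · exact iff_of_true (by rw [h₂]; exact one_ne_zero) h₁
    · exact iff_of_false (fun h' => h' h₂) (W.notMem_of_neg_mem h₁)
  -- With the matrix replaced by its deciding function `g` on pairs, the existential formula becomes
  -- Σ₁ in the parameter `g`.
  refine (Prf.decider_of_totalColoring (k := k) (hC.weaken (List.subset_cons_self _ _))
    (List.mem_cons_of_mem _ h2) g).decider_elim fun f => ?_
  have hq : (Fml.neg (.eq (.app g (.pair (.var 1) (.var 0))) .zero)).QF := ⟨trivial, trivial⟩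
  have key : ∀ W : World T, (φ.sub σ' p).decides g ∈ W →
      (Fml.ex (.neg (.eq (.app g (.pair (.var 1) (.var 0))) .zero))).decides f ∈ W → ∀ t,
        ((eqOne f).inst t ∈ W ↔ ((Fml.ex φ).sub σ p).inst t ∈ W) := by
    intro W hg hf t
    rw [World.eqOne_inst_mem_iff hf, Fml.inst_sub, World.mem_ex_sub, Fml.inst, hq.dec.ex W]
    simp only [World.sat_ex, World.sat_neg, World.sat_eq, World.ev_app, World.ev_pair,
      World.ev_var, World.ev_zero, scons_zero, scons_one, id]
    constructor
    · rintro ⟨y, hy⟩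
      exact ⟨World.rep y, (link W hg t _).1 (by rw [World.val_rep]; exact hy)⟩
    · rintro ⟨u, hu⟩
      exact ⟨W.val u, (link W hg t u).2 hu⟩
  exact .decider_of_equiv (θ := eqOne f) trivial
    (fun t => .of_worlds fun W hW =>
      (key W (hW _ (by simp)) (hW _ (by simp)) t).1 (hW _ List.mem_cons_self))
    fun t => .of_worlds fun W hW =>
      (key W (hW _ (by simp)) (hW _ (by simp)) t).2 (hW _ List.mem_cons_self)

/-- The deciding function is that of `∃ ¬φ` with its values read negatively: `¬∃¬φ` gives `∀ φ`
because every instance of `φ` is decided. -/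
theorem Decided.all {k : Tm} (hC : Prf T Γ (totalColoring k)) (h2 : twoLe k ∈ Γ)
    (h : Decided T Γ φ) : Decided T Γ (.all φ) := fun σ p => by
  have hn : Decided T Γ (.ex φ.neg) := (h.imp (Fml.QF.decided (φ := .bot) trivial)).ex hC h2
  refine (hn σ p).decider_elim fun f => .decider_of_equiv (θ := (eqOne f).neg) ⟨trivial, trivial⟩
    (fun t => ?_) fun t => .impI (.of_worlds fun W hW => ?_)
  · rw [Fml.inst_sub]
    refine .all_sub fun u => .of_worlds fun W hW => ?_
    refine (h.mem_or_neg_mem (fun ψ hψ => hW ψ (by simp [hψ])) _ p).resolve_right fun hc => ?_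
    refine W.notMem_of_neg_mem (φ := (eqOne f).inst t) (hW _ List.mem_cons_self) ?_
    rw [World.eqOne_inst_mem_iff (hW (((Fml.ex φ.neg).sub σ p).decides f) (by simp)),
      Fml.inst_sub, World.mem_ex_sub]
    exact ⟨u, hc⟩
  · have h₁ := hW ((eqOne f).inst t) List.mem_cons_self
    rw [World.eqOne_inst_mem_iff (hW (((Fml.ex φ.neg).sub σ p).decides f) (by simp)),
      Fml.inst_sub, World.mem_ex_sub] at h₁
    obtain ⟨u, hu⟩ := h₁
    have h₂ := hW (((Fml.all φ).sub σ p).inst t) (by simp)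
    rw [Fml.inst_sub] at h₂
    have h₃ := W.mem_inst_of_all h₂ u
    rw [Fml.inst_sub_upSub] at h₃
    exact absurd h₃ (W.notMem_of_neg_mem hu)

/-- The coloring principle yields deciding functions for all arithmetical formulas. -/
theorem Fml.Arith.decided {k : Tm} (hC : Prf T Γ (totalColoring k)) (h2 : twoLe k ∈ Γ)
    (h : φ.Arith) : Decided T Γ φ := by
  induction φ with
  | eq s t => exact Fml.QF.decided trivial
  | bot => exact Fml.QF.decided trivial
  | and φ ψ ih₁ ih₂ => exact (ih₁ h.1).and (ih₂ h.2)
  | or φ ψ ih₁ ih₂ => exact (ih₁ h.1).or (ih₂ h.2)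
  | imp φ ψ ih₁ ih₂ => exact (ih₁ h.1).imp (ih₂ h.2)
  | all φ ih => exact (ih h).all hC h2
  | ex φ ih => exact (ih h).ex hC h2
  | _ => exact h.elim

theorem Fml.finst_comprehension (φ : Fml) (g : ℕ) :
    (Fml.all (.and (Fml.le (.app 0 (.var 0)) Tm.one)
      (Fml.iff (.eq (.app 0 (.var 0)) Tm.one) φ.flift))).finst g =
    .all (.and (Fml.le (.app g (.var 0)) Tm.one) (Fml.iff (eqOne g) φ)) := by
  have e : φ.flift.sub (upSub .var) (scons g id) = φ := by
    rw [upSub_var, Fml.flift, Fml.sub_sub]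
    exact φ.sub_var
  change Fml.all (.and _ (Fml.iff _ (φ.flift.sub (upSub .var) (scons g id)))) = _
  rw [e]
  rfl

theorem Prf.comprehension_of_decider (h : Prf T Γ φ.decider) : Prf T Γ φ.comprehension := by
  refine h.decider_elim fun g => .fexI g ?_
  rw [Fml.finst_comprehension]
  refine .allI_of_forall hT.subClosed fun t => ?_
  have mem : φ.decides g ∈ φ.decides g :: Γ := List.mem_cons_self
  refine .andI (.of_sat (φ := .le (.app g (.var 0)) Tm.one) trivial fun W hW => ?_)
    (.andI (.impI (.of_worlds fun W hW => ?_)) (.impI (.of_worlds fun W hW => ?_)))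
  · rcases World.mem_decides (hW _ mem) t with ⟨_, h⟩ | ⟨_, h⟩ <;> simp [h]
  · exact (World.eqOne_inst_mem_iff (hW _ (List.mem_cons_of_mem _ mem)) t).1
      (hW _ List.mem_cons_self)
  · exact (World.eqOne_inst_mem_iff (hW _ (List.mem_cons_of_mem _ mem)) t).2
      (hW _ List.mem_cons_self)

/-- The coloring principle implies arithmetical comprehension. -/
theorem provable_comprehension_of_totalColoring (h : φ.Arith) :
    Provable T (.all (.imp (twoLe (.var 0)) (.imp (totalColoring (.var 0)) φ.comprehension))) := by
  refine .allI (.impI (.impI (.comprehension_of_decider ?_)))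
  have := h.decided (T := T) (Γ := [totalColoring (.var 0), twoLe (.var 0)]) (k := .var 0)
    (.hyp (by simp)) (by simp) .var id
  rw [show φ.sub .var id = φ from φ.sub_var] at this
  exact this


/-! Arithmetical comprehension inside a saturated theory -/

/-- Comprehension with a dummy variable makes `φ` equivalent to an equation `g 0 = 1`, and equations
are decided. So arithmetical comprehension brings excluded middle for arithmetical formulas. -/
theorem World.mem_or_neg_mem_of_arith {T : Set Fml} [hT : IsBase T] (hA : ACA ⊆ T) (W : World T)
    {φ : Fml} (h : φ.Arith) (σ : ℕ → Tm) (p : ℕ → ℕ) :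
    φ.sub σ p ∈ W ∨ (φ.sub σ p).neg ∈ W := by
  let ψ := φ.sub (fun n => (σ n).up 1) p
  have e : ψ.inst .zero = φ.sub σ p := by
    rw [Fml.inst_sub]
    exact Fml.sub_congr _ (fun n => (Tm.sub_ren _ _ _ _ _).trans (Tm.sub_var _)) fun n => rfl
  have hψ : ψ.comprehension ∈ W :=
    W.mem_of_prf (Γ := []) (.ax (hA ⟨ψ, h.sub _ _, rfl⟩)) (by simp)
  obtain ⟨g, hg⟩ := W.fex_mem _ hψ
  rw [Fml.finst_comprehension] at hg
  have h₁ := W.mem_inst_of_all hg .zero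
  have h₂ := W.mem_and.1 (W.mem_and.1 h₁).2
  have h₃ := Fml.QF.strongDec (T := T) (φ := eqOne g) trivial W (scons .zero .var) id
  rw [← e]
  by_cases hs : W.Sat (eqOne g) (fun n => W.val (scons .zero Tm.var n)) id
  · exact .inl (W.mem_mp h₂.1 (h₃.1 hs))
  · refine .inr (W.mem_of_prf (Γ := [.imp (ψ.inst .zero) ((eqOne g).inst .zero),
      ((eqOne g).inst .zero).neg]) (.impI (.impE (φ := (eqOne g).inst .zero) (.hyp ?_)
        (.impE (φ := ψ.inst .zero) (.hyp ?_) (.hyp ?_)))) ?_)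
    · simp [Fml.neg]
    · simp
    · simp
    · intro θ hθ
      rw [List.mem_cons, List.mem_singleton] at hθ
      rcases hθ with rfl | rfl
      · exact h₂.2
      · exact h₃.2 hs

theorem Fml.Arith.strongDec {T : Set Fml} [hT : IsBase T] (hA : ACA ⊆ T) {φ : Fml}
    (h : φ.Arith) : StrongDec T φ := by
  induction φ with
  | eq s t => exact strongDec_eq s t
  | bot => exact strongDec_bot
  | and φ ψ ih₁ ih₂ => exact (ih₁ h.1).and (ih₂ h.2)
  | or φ ψ ih₁ ih₂ => exact (ih₁ h.1).or (ih₂ h.2)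
  | imp φ ψ ih₁ ih₂ => exact (ih₁ h.1).imp (ih₂ h.2)
  | ex φ ih =>
    intro W σ p
    have hd := (ih h).dec.ex W σ p
    exact ⟨hd.2, fun hs => (W.mem_or_neg_mem_of_arith hA (φ := .ex φ) h σ p).resolve_left
      fun hc => hs (hd.1 hc)⟩
  | all φ ih =>
    intro W σ p
    constructor
    · intro hs
      have hn : (Fml.ex φ.neg).Arith := ⟨h, trivial⟩
      rcases W.mem_or_neg_mem_of_arith hA hn σ p with h' | h'
      · obtain ⟨u, hu⟩ := World.mem_ex_sub σ p |>.1 h'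
        refine absurd ((ih h W (scons u σ) p).1 ?_) (W.notMem_of_neg_mem hu)
        rw [comp_scons W.val]
        exact hs _
      -- Here `∀ φ` is derived from `¬∃¬φ`: in every world with this hypothesis each instance of `φ`
      -- is decided and cannot be refuted.
      · refine W.mem_of_prf (Γ := [((Fml.ex φ.neg).sub σ p).neg]) (.all_sub fun u =>
          .of_worlds fun W' hW' => ?_) (by simpa using h')
        refine (W'.mem_or_neg_mem_of_arith hA (φ := φ) h (scons u σ) p).resolve_right fun hc => ?_
        exact W'.notMem_of_neg_mem (hW' _ List.mem_cons_self)
          ((World.mem_ex_sub σ p).2 ⟨u, hc⟩)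
    · intro hs
      obtain ⟨x, hx⟩ := not_forall.1 hs
      have h' := (ih h W (scons (World.rep x) σ) p).2 (by
        rw [comp_scons W.val, World.val_rep]
        exact hx)
      refine World.mem_neg_of_prf ?_ h'
      rw [← Fml.inst_sub_upSub]
      exact .allE _ (.hyp (by simp [Fml.sub]))
  | _ => exact h.elim

namespace World

variable {T : Set Fml} [hT : IsBase T] {W : World T}

theorem exists_decider_of_arith (hA : ACA ⊆ T) {φ : Fml} (h : φ.Arith) (v : ℕ → W.Num)
    (p : ℕ → ℕ) : ∃ g, ∀ x, app g x ≠ 0 ↔ W.Sat φ (scons x v) p := by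
  let ψ := φ.sub (upSub fun n => rep (v n)) p
  have hψ : ψ.comprehension ∈ W :=
    W.mem_of_prf (Γ := []) (.ax (hA ⟨ψ, h.sub _ _, rfl⟩)) (by simp)
  obtain ⟨g, hg⟩ := W.fex_mem _ hψ
  rw [Fml.finst_comprehension] at hg
  refine ⟨g, fun x => ?_⟩
  have hd : Dec T (.and (Fml.le (.app g (.var 0)) Tm.one) (Fml.iff (eqOne g) ψ)) :=
    (Fml.Arith.strongDec (T := T) hA (φ := .and (Fml.le (.app g (.var 0)) Tm.one)
      (Fml.iff (eqOne g) ψ)) ⟨trivial, ⟨trivial, h.sub _ _⟩, h.sub _ _, trivial⟩).dec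
  have h' : (Fml.all (.and (Fml.le (.app g (.var 0)) Tm.one) (Fml.iff (eqOne g) ψ))).sub .var id ∈
      W := by
    rw [show (Fml.all (.and (Fml.le (.app g (.var 0)) Tm.one) (Fml.iff (eqOne g) ψ))).sub .var id =
      _ from Fml.sub_var _]
    exact hg
  have key := hd.sat_all h' x
  have e : W.Sat ψ (scons x fun n => W.val (.var n)) id ↔ W.Sat φ (scons x v) p := by
    rw [sat_sub]
    refine sat_congr _ (fun n => ?_) fun n => rfl
    cases n with
    | zero => simp [upSub]
    | succ n => exact (congrArg (fun t => W.ev t _ id) rfl).trans ((ev_up _ _ _ _).trans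
      ((ev_val_var (rep (v n))).trans (val_rep _)))
  simp only [sat_and, sat_le, Fml.iff, sat_imp, e, eqOne, sat_eq, ev_app, ev_var, scons_zero,
    ev_one, id] at key
  refine ⟨fun h0 => key.2.1 (le_antisymm key.1 ?_), fun hs => by rw [key.2.2 hs]; exact one_ne_zero⟩
  have := lt_iff_add_one_le.1 (pos_iff_ne_zero.2 h0)
  rwa [zero_add] at this

/-- Choice for arithmetical formulas. -/
theorem exists_choice_of_arith (hA : ACA ⊆ T) {φ : Fml} (h : φ.Arith) (v : ℕ → W.Num) (p : ℕ → ℕ)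
    (hex : ∀ x, ∃ y, W.Sat φ (scons y (scons x v)) p) :
    ∃ f, ∀ x, W.Sat φ (scons (app f x) (scons x v)) p := by
  obtain ⟨g, hg⟩ := exists_decider_of_arith hA
    (h.sub (scons (.snd (.var 0)) (scons (.fst (.var 0)) fun n => .var (n + 1))) id) v p
  have hg' : ∀ x y, app g (pair x y) ≠ 0 ↔ W.Sat φ (scons y (scons x v)) p := by
    intro x y
    rw [hg, sat_sub]
    refine sat_congr _ (fun n => ?_) fun n => rfl
    rcases n with _ | _ | n <;> simp
  -- Through its decider the arithmetical relation becomes quantifier-free, so that the choice axiom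
  -- applies.
  let θ : Fml := .neg (.eq (.app g (.pair (.var 1) (.var 0))) .zero)
  have hθ : θ.QF := ⟨trivial, trivial⟩
  have hc : (Fml.all (.ex θ)).sub .var id ∈ W := by
    refine ((Fml.Arith.strongDec hA (φ := .all (.ex θ)) ⟨trivial, trivial⟩).dec W _ _).2 ?_
    simpa [θ, hg'] using hex
  rw [show (Fml.all (.ex θ)).sub .var id = _ from Fml.sub_var _] at hc
  have hf := W.mem_mp (W.mem_of_prf (Γ := []) (.ax (hT.irca (.choice θ hθ))) (by simp)) hc
  obtain ⟨f, hf⟩ := W.fex_mem _ hf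
  refine ⟨f, fun x => ?_⟩
  have := (hθ.sub (scons (.app 0 (.var 0)) .var) Nat.succ).dec.sat_all hf x
  rw [sat_sub] at this
  simp only [θ, sat_neg, sat_eq, ev_app, ev_pair, ev_var, ev_zero, scons_zero, scons_one] at this
  exact (hg' _ _).1 this

/-- A bound for finitely many witnesses. -/
theorem exists_bound_of_forall_lt (hA : ACA ⊆ T) (g : ℕ) (k : W.Num)
    (h : ∀ c < k, ∃ m, app g (pair c m) ≠ 0) :
    ∃ M, ∀ c < k, ∃ m ≤ M, app g (pair c m) ≠ 0 := by
  let φ : Fml := .ex (.all (.imp (.lt (.var 0) (.var 2)) (.ex (.and (.le (.var 0) (.var 2))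
    (.neg (.eq (.app 0 (.pair (.var 1) (.var 0))) .zero))))))
  obtain ⟨d, hd⟩ := exists_decider_of_arith hA (φ := φ)
    ⟨trivial, trivial, trivial, trivial⟩ (fun _ => (0 : W.Num)) (fun _ => g)
  simp only [φ, sat_ex, sat_all, sat_imp, sat_lt, sat_le, sat_and, sat_neg, sat_eq, ev_app, ev_pair,
    ev_var, ev_zero, scons_zero, scons_one, scons_two] at hd
  -- The decider `d` turns induction on "the indices below `x` have a common bound" into
  -- quantifier-free induction. The clause `x ≤ k` is needed because witnesses are given only below
  -- `k`.
  have := induct (W := W) (φ := .imp (.le (.var 0) (.var 1)) (.neg (.eq (.app 0 (.var 0)) .zero)))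
    ⟨trivial, trivial, trivial⟩ (fun _ => k) (fun _ => d) (by simp [hd]) (fun x hx => by
      simp only [sat_imp, sat_le, sat_neg, sat_eq, ev_app, ev_var, ev_zero, scons_zero,
        scons_one] at hx ⊢
      intro hk
      obtain ⟨M, hM⟩ := (hd x).1 (hx (le_self_add.trans hk))
      obtain ⟨m, hm⟩ := h x (lt_iff_add_one_le.2 hk)
      refine (hd _).2 ⟨M + m, fun c hc => ?_⟩
      rcases (lt_add_one_iff'.1 hc).eq_or_lt with rfl | hc
      · exact ⟨m, le_add_self, hm⟩
      · obtain ⟨m', h₁, h₂⟩ := hM c hc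
        exact ⟨m', h₁.trans le_self_add, h₂⟩) k
  simp only [sat_imp, sat_le, sat_neg, sat_eq, ev_app, ev_var, ev_zero, scons_zero,
    scons_one] at this
  exact (hd k).1 (this le_rfl)

/-! ### Compactness: infinite colorings from finite ones -/

/-- The number `s` codes a `k`-coloring of the vertices up to `m` of the `i`-th graph. -/
def Colors (e : ℕ) (k i s m : W.Num) : Prop :=
  (∀ a ≤ m, entry s a < k) ∧
    ∀ a b, a < b → b ≤ m → app e (pair i (tri b + a)) ≠ 0 → entry s a ≠ entry s b

/-- The first `n` colors coded by `s` can be extended to colorings of all initial subgraphs. -/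
def Extendible (e : ℕ) (k i n s : W.Num) : Prop :=
  ∀ m, ∃ t, Colors e k i t m ∧ ∀ j < n, entry t j = entry s j

theorem Colors.mono {e : ℕ} {k i s m m' : W.Num} (h : Colors e k i s m) (hm : m' ≤ m) :
    Colors e k i s m' :=
  ⟨fun a ha => h.1 a (ha.trans hm), fun a b hab hb => h.2 a b hab (hb.trans hm)⟩

theorem exists_colors_decider (hA : ACA ⊆ T) (e : ℕ) (k : W.Num) :
    ∃ g, ∀ i s m, app g (pair i (pair s m)) ≠ 0 ↔ Colors e k i s m := by
  let φ : Fml := .and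
    (.all (.imp (.le (.var 0) (.snd (.snd (.var 1))))
      (.lt (.entry (.fst (.snd (.var 1))) (.var 0)) (.var 2))))
    (.all (.all (.imp (.lt (.var 1) (.var 0)) (.imp (.le (.var 0) (.snd (.snd (.var 2))))
      (.imp (.neg (.eq (.app 0 (.pair (.fst (.var 2)) (.edgeCode (.var 1) (.var 0)))) .zero))
        (.neg (.eq (.entry (.fst (.snd (.var 2))) (.var 1))
          (.entry (.fst (.snd (.var 2))) (.var 0)))))))))
  obtain ⟨g, hg⟩ := exists_decider_of_arith hA (φ := φ)
    ⟨⟨trivial, trivial⟩, trivial, trivial, ⟨trivial, trivial⟩, trivial, trivial⟩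
    (fun _ => k) (fun _ => e)
  refine ⟨g, fun i s m => (hg _).trans ?_⟩
  simp [φ, Colors]

theorem exists_extendible_decider (hA : ACA ⊆ T) (e : ℕ) (k : W.Num) :
    ∃ g, ∀ i n s, app g (pair i (pair n s)) ≠ 0 ↔ Extendible e k i n s := by
  obtain ⟨c, hc⟩ := exists_colors_decider hA e k
  let φ : Fml := .all (.ex (.and
    (.neg (.eq (.app 0 (.pair (.fst (.var 2)) (.pair (.var 0) (.var 1)))) .zero))
    (.all (.imp (.lt (.var 0) (.fst (.snd (.var 3)))) (.eq (.entry (.var 1) (.var 0))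
      (.entry (.snd (.snd (.var 3))) (.var 0)))))))
  obtain ⟨g, hg⟩ := exists_decider_of_arith hA (φ := φ)
    ⟨⟨trivial, trivial⟩, trivial, trivial⟩ (fun _ => k) (fun _ => c)
  refine ⟨g, fun i n s => (hg _).trans ?_⟩
  simp only [φ, sat_all, sat_ex, sat_and, sat_neg, sat_imp, sat_lt, sat_eq, ev_app, ev_pair, ev_fst,
    ev_snd, ev_var, ev_zero, ev_entry, scons_zero, scons_one, scons_two, scons_three, fst_pair,
    snd_pair, hc, Extendible]

/-- If each color `c < k` of the vertex `n` failed at some initial subgraph, one `M` would bound the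
failures for all `c`, and a coloring of a large enough initial subgraph would give `n` a color
already excluded. -/
theorem Extendible.exists_succ (hA : ACA ⊆ T) {e : ℕ} {k i n s : W.Num}
    (h : Extendible e k i n s) :
    ∃ s', Extendible e k i (n + 1) s' ∧ ∀ j < n, entry s' j = entry s j := by
  obtain ⟨γ, hγ⟩ := exists_colors_decider hA e k
  -- some color of the vertex `n` occurs in colorings of all initial subgraphs
  have key : ∃ c, ∀ m, ∃ t, Colors e k i t m ∧ (∀ j < n, entry t j = entry s j) ∧
      entry t n = c := by
    by_contra! hc
    let φ : Fml := .neg (.ex (.and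
      (.neg (.eq (.app 0 (.pair (.var 2) (.pair (.var 0) (.snd (.var 1))))) .zero)) (.and
      (.all (.imp (.lt (.var 0) (.var 4)) (.eq (.entry (.var 1) (.var 0))
        (.entry (.var 5) (.var 0))))) (.eq (.entry (.var 0) (.var 3)) (.fst (.var 1))))))
    obtain ⟨g, hg⟩ := exists_decider_of_arith hA (φ := φ)
      ⟨⟨⟨trivial, trivial⟩, ⟨trivial, trivial⟩, trivial⟩, trivial⟩
      (scons i (scons n (scons s fun _ => s))) (fun _ => γ)
    have hg' : ∀ c m, app g (pair c m) ≠ 0 ↔ ¬ ∃ t, Colors e k i t m ∧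
        (∀ j < n, entry t j = entry s j) ∧ entry t n = c := by
      intro c m
      rw [hg]
      simp only [φ, sat_all, sat_ex, sat_and, sat_neg, sat_imp, sat_lt, sat_eq, ev_app, ev_pair,
        ev_fst, ev_snd, ev_var, ev_zero, ev_entry, scons_zero,
        scons_succ, fst_pair, snd_pair, hγ]
    obtain ⟨M, hM⟩ := exists_bound_of_forall_lt hA g k fun c _ => by
      obtain ⟨m, hm⟩ := hc c
      exact ⟨m, (hg' c m).2 fun ⟨t, h₁, h₂, h₃⟩ => hm t h₁ h₂ h₃⟩
    -- Adding `n` ensures that the vertex `n` itself is colored, hence has a color below `k`.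
    obtain ⟨t, ht, hts⟩ := h (M + n)
    obtain ⟨m, hm, hne⟩ := hM (entry t n) (ht.1 n le_add_self)
    exact (hg' _ _).1 hne ⟨t, ht.mono (hm.trans le_self_add), hts, rfl⟩
  obtain ⟨c, hc⟩ := key
  obtain ⟨s', -, h₁, h₂⟩ := hc 0
  refine ⟨s', fun m => ?_, h₁⟩
  obtain ⟨t, ht, h₃, h₄⟩ := hc m
  refine ⟨t, ht, fun j hj => ?_⟩
  rcases (lt_add_one_iff'.1 hj).eq_or_lt with rfl | hj
  · rw [h₄, h₂]
  · rw [h₃ j hj, h₁ j hj]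

/-- Uniform colorings of all graphs whose initial subgraphs are colorable. -/
theorem exists_uniform_coloring (hA : ACA ⊆ T) (e : ℕ) (k : W.Num) :
    ∃ c, ∀ i, (∀ m, ∃ t, Colors e k i t m) → (∀ n, app c (pair i n) < k) ∧
      ∀ a b, a < b → app e (pair i (tri b + a)) ≠ 0 → app c (pair i a) ≠ app c (pair i b) := by
  obtain ⟨η, hη⟩ := exists_extendible_decider hA e k
  -- Arithmetical choice gives one function performing the one-vertex prolongation for all graphs
  -- and partial colorings at once. The implication makes the relation total.
  obtain ⟨F, hF⟩ : ∃ F, ∀ i n s, Extendible e k i n s →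
      Extendible e k i (n + 1) (app F (pair i (pair n s))) ∧
        ∀ j < n, entry (app F (pair i (pair n s))) j = entry s j := by
    let φ : Fml := .imp (.neg (.eq (.app 0 (.pair (.fst (.var 1)) (.pair (.fst (.snd (.var 1)))
        (.snd (.snd (.var 1)))))) .zero)) (.and
      (.neg (.eq (.app 0 (.pair (.fst (.var 1)) (.pair (.succ (.fst (.snd (.var 1)))) (.var 0))))
        .zero))
      (.all (.imp (.lt (.var 0) (.fst (.snd (.var 2)))) (.eq (.entry (.var 1) (.var 0))
        (.entry (.snd (.snd (.var 2))) (.var 0))))))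
    have hφ : ∀ x s', W.Sat φ (scons s' (scons x fun _ => k)) (fun _ => η) ↔
        (Extendible e k (fst x) (fst (snd x)) (snd (snd x)) →
          Extendible e k (fst x) (fst (snd x) + 1) s' ∧
            ∀ j < fst (snd x), entry s' j = entry (snd (snd x)) j) := by
      intro x s'
      simp only [φ, sat_all, sat_and, sat_neg, sat_imp, sat_lt, sat_eq, ev_app, ev_pair,
        ev_fst, ev_snd, ev_var, ev_zero, ev_succ, ev_entry, scons_zero, scons_one, scons_two,
        hη]
    obtain ⟨F, hF⟩ := exists_choice_of_arith hA (φ := φ)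
      ⟨⟨trivial, trivial⟩, ⟨trivial, trivial⟩, trivial, trivial⟩ (fun _ => k) (fun _ => η)
      fun x => by
        by_cases hx : Extendible e k (fst x) (fst (snd x)) (snd (snd x))
        · obtain ⟨s', h₁, h₂⟩ := hx.exists_succ hA
          exact ⟨s', (hφ _ _).2 fun _ => ⟨h₁, h₂⟩⟩
        · exact ⟨0, (hφ _ _).2 fun h => absurd h hx⟩
    refine ⟨F, fun i n s h => ?_⟩
    simpa using (hφ _ _).1 (hF (pair i (pair n s))) (by simpa using h)
  obtain ⟨S, hS⟩ := exists_recur .zero (.app 0 (.pair (.var 2) (.pair (.var 1) (.var 0))))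
    (fun _ => k) (fun _ => F)
  have hS₀ : ∀ i : W.Num, app S (pair i 0) = 0 := fun i => (hS i).1
  have hS₁ : ∀ i n : W.Num, app S (pair i (n + 1)) = app F (pair i (pair n (app S (pair i n)))) :=
    fun i n => by simpa using (hS i).2 n
  clear hS
  -- Stage `n` of the iteration settles the vertices below `n`, so the color of `n` is read off at
  -- stage `n + 1`; `hstable` shows that it never changes later.
  obtain ⟨c, hc⟩ := exists_app_eq (.entry (.app 0 (.pair (.fst (.var 0)) (.succ (.snd (.var 0)))))
    (.snd (.var 0))) (fun _ => k) (fun _ => S)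
  have hc' : ∀ i n : W.Num, app c (pair i n) = entry (app S (pair i (n + 1))) n := fun i n => by
    simp [hc]
  refine ⟨c, fun i hi => ?_⟩
  have hext : ∀ n, Extendible e k i n (app S (pair i n)) := by
    intro n
    have := induct (W := W) (φ := .neg (.eq (.app 0 (.pair (.var 1) (.pair (.var 0)
      (.app 1 (.pair (.var 1) (.var 0)))))) .zero)) ⟨trivial, trivial⟩ (fun _ => i)
      (scons η fun _ => S) (by
        simp only [sat_neg, sat_eq, ev_app, ev_pair, ev_var, ev_zero, scons_zero, scons_one,
          hη]
        intro m
        obtain ⟨t, ht⟩ := hi m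
        exact ⟨t, ht, fun j hj => absurd hj not_lt_zero⟩) (fun n hn => by
        simp only [sat_neg, sat_eq, ev_app, ev_pair, ev_var, ev_zero, scons_zero, scons_one,
          hη] at hn ⊢
        rw [hS₁]
        exact (hF _ _ _ hn).1) n
    simpa only [sat_neg, sat_eq, ev_app, ev_pair, ev_var, ev_zero, scons_zero, scons_one,
      hη] using this
  have hstable : ∀ j n, j < n → entry (app S (pair i n)) j = app c (pair i j) := by
    intro j n hjn
    obtain ⟨d, rfl⟩ := le_iff_exists.1 (lt_iff_add_one_le.1 hjn)
    have := induct (W := W) (φ := .eq (.entry (.app 0 (.pair (.var 1) (.add (.succ (.var 2))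
      (.var 0)))) (.var 2)) (.app 1 (.pair (.var 1) (.var 2)))) trivial (scons i fun _ => j)
      (scons S fun _ => c) (by simp [hc']) (fun d hd => by
        simp only [sat_eq, ev_app, ev_pair, ev_var, ev_entry, ev_add, ev_succ, scons_zero,
          scons_one, scons_two] at hd ⊢
        rw [← add_assoc, hS₁, (hF _ _ _ (hext _)).2 _
          ((lt_add_one_iff'.2 le_rfl).trans_le le_self_add), hd]) d
    simpa using this
  refine ⟨fun n => ?_, fun a b hab he => ?_⟩
  · obtain ⟨t, ht, hts⟩ := hext (n + 1) n
    rw [hc', ← hts n (lt_add_one_iff'.2 le_rfl)]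
    exact ht.1 n le_rfl
  · obtain ⟨t, ht, hts⟩ := hext (b + 1) b
    have hb : b < b + 1 := lt_add_one_iff'.2 le_rfl
    rw [← hstable a _ (hab.trans hb), ← hstable b _ hb, ← hts a (hab.trans hb), ← hts b hb]
    exact ht.2 a b hab le_rfl he

/-- A decider separates the graphs all of whose initial subgraphs are colorable. The others receive,
by choice, the index of a bad initial subgraph; these receive the uniform coloring with colors
permuted, so that the value at `0` also serves as the flag `0`. -/
theorem exists_totalColoring (hA : ACA ⊆ T) (e : ℕ) {k : W.Num} (hk : 0 < k) :
    ∃ f, ∀ i, (0 < app f (pair i 0) ∧ ¬ ∃ t, Colors e k i t (app f (pair i 0))) ∨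
      (app f (pair i 0) = 0 ∧ (∀ n, app f (pair i n) < k) ∧
        ∀ a b, a < b → app e (pair i (tri b + a)) ≠ 0 → app f (pair i a) ≠ app f (pair i b)) := by
  obtain ⟨γ, hγ⟩ := exists_colors_decider hA e k
  obtain ⟨c, hc⟩ := exists_uniform_coloring hA e k
  obtain ⟨δ, hδ⟩ : ∃ δ, ∀ i, app δ i ≠ 0 ↔ ∀ m, ∃ t, Colors e k i t m := by
    obtain ⟨δ, hδ⟩ := exists_decider_of_arith hA (φ := .all (.ex (.neg (.eq (.app 0
      (.pair (.var 2) (.pair (.var 0) (.var 1)))) .zero)))) ⟨trivial, trivial⟩ (fun _ => k)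
      (fun _ => γ)
    refine ⟨δ, fun i => (hδ i).trans ?_⟩
    simp only [sat_all, sat_ex, sat_neg, sat_eq, ev_app, ev_pair, ev_var, ev_zero, scons_zero,
      scons_one, scons_two, hγ]
  obtain ⟨μ, hμ⟩ : ∃ μ, ∀ i, app δ i = 0 → ¬ ∃ t, Colors e k i t (app μ i) := by
    have hs : ∀ i m, W.Sat (.imp (.eq (.app 1 (.var 1)) .zero) (.neg (.ex (.neg (.eq (.app 0
        (.pair (.var 2) (.pair (.var 0) (.var 1)))) .zero))))) (scons m (scons i fun _ => k))
        (scons γ fun _ => δ) ↔ (app δ i = 0 → ¬ ∃ t, Colors e k i t m) := by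
      intro i m
      simp only [sat_imp, sat_ex, sat_neg, sat_eq, ev_app, ev_pair, ev_var, ev_zero, scons_zero,
        scons_one, scons_two, hγ]
    obtain ⟨μ, hμ⟩ := exists_choice_of_arith hA (φ := .imp (.eq (.app 1 (.var 1)) .zero)
      (.neg (.ex (.neg (.eq (.app 0 (.pair (.var 2) (.pair (.var 0) (.var 1)))) .zero)))))
      ⟨trivial, ⟨trivial, trivial⟩, trivial⟩ (fun _ => k) (scons γ fun _ => δ) fun i => by
        by_cases hi : app δ i = 0
        · obtain ⟨m, hm⟩ := not_forall.1 (mt (hδ i).2 (not_not.2 hi))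
          exact ⟨m, (hs i m).2 fun _ => hm⟩
        · exact ⟨0, (hs i 0).2 fun h => absurd h hi⟩
    exact ⟨μ, fun i => (hs i _).1 (hμ i)⟩
  -- permute the colors so that the vertex `0` has the color `0`
  let swap : W.Num → W.Num → W.Num := fun x y => if y = x then 0 else if y = 0 then x else y
  obtain ⟨f, hf⟩ : ∃ f, ∀ i n, (app δ i = 0 → app f (pair i n) = app μ i) ∧
      (app δ i ≠ 0 → app f (pair i n) = swap (app c (pair i 0)) (app c (pair i n))) := by
    let φ : Fml := .and (.imp (.eq (.app 0 (.fst (.var 1))) .zero)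
        (.eq (.var 0) (.app 1 (.fst (.var 1)))))
      (.imp (.neg (.eq (.app 0 (.fst (.var 1))) .zero)) (.and
        (.imp (.eq (.app 2 (.var 1)) (.app 2 (.pair (.fst (.var 1)) .zero))) (.eq (.var 0) .zero))
        (.imp (.neg (.eq (.app 2 (.var 1)) (.app 2 (.pair (.fst (.var 1)) .zero)))) (.and
          (.imp (.eq (.app 2 (.var 1)) .zero)
            (.eq (.var 0) (.app 2 (.pair (.fst (.var 1)) .zero))))
          (.imp (.neg (.eq (.app 2 (.var 1)) .zero)) (.eq (.var 0) (.app 2 (.var 1))))))))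
    have hs : ∀ z y, W.Sat φ (scons y (scons z fun _ => k)) (scons δ (scons μ fun _ => c)) ↔
        (app δ (fst z) = 0 → y = app μ (fst z)) ∧
          (app δ (fst z) ≠ 0 → y = swap (app c (pair (fst z) 0)) (app c z)) := by
      intro z y
      simp only [φ, swap, sat_and, sat_imp, sat_neg, sat_eq, ev_app, ev_pair, ev_fst, ev_var, ev_zero,
        scons_zero, scons_one, scons_two]
      split_ifs with h₁ h₂ <;> simp [h₁]
      · simp [h₂]
      · simp [h₂]
    obtain ⟨f, hf⟩ := exists_choice_of_arith hA (φ := φ)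
      ⟨⟨trivial, trivial⟩, ⟨trivial, trivial⟩, ⟨trivial, trivial⟩, ⟨trivial, trivial⟩,
        ⟨trivial, trivial⟩, ⟨trivial, trivial⟩, trivial⟩ (fun _ => k)
      (scons δ (scons μ fun _ => c)) fun z => by
        by_cases hz : app δ (fst z) = 0
        · exact ⟨_, (hs _ _).2 ⟨fun _ => rfl, fun h => absurd hz h⟩⟩
        · exact ⟨_, (hs _ _).2 ⟨fun h => absurd h hz, fun _ => rfl⟩⟩
    exact ⟨f, fun i n => by simpa using (hs _ _).1 (hf (pair i n))⟩
  have swap_self : ∀ x, swap x x = 0 := fun x => if_pos rfl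
  have swap_lt : ∀ x y, x < k → y < k → swap x y < k := fun x y hx hy => by
    simp only [swap]
    split_ifs <;> assumption
  have swap_ne : ∀ x y z, y ≠ z → swap x y ≠ swap x z := fun x y z h => by
    simp only [swap]
    split_ifs with h₁ h₂ h₃ h₄ h₅ h₆ <;> grind
  refine ⟨f, fun i => ?_⟩
  by_cases hi : app δ i = 0
  · left
    rw [(hf i 0).1 hi]
    -- The index of a bad initial subgraph is positive because the one-vertex graph has no edges and
    -- `0 < k` provides a color.
    refine ⟨pos_iff_ne_zero.2 fun h0 => hμ i hi ?_, hμ i hi⟩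
    rw [h0]
    exact ⟨0, fun a _ => by rwa [entry_zero], fun a b hab hb =>
      absurd (hab.trans_le hb) not_lt_zero⟩
  · right
    obtain ⟨h₁, h₂⟩ := hc i ((hδ i).1 hi)
    refine ⟨by rw [(hf i 0).2 hi, swap_self], fun n => ?_, fun a b hab he => ?_⟩
    · rw [(hf i n).2 hi]
      exact swap_lt _ _ (h₁ 0) (h₁ n)
    · rw [(hf i a).2 hi, (hf i b).2 hi]
      exact swap_ne _ _ _ (h₂ a b hab he)

end World

/-- Arithmetical comprehension implies the coloring principle. -/
theorem provable_totalColoring {T : Set Fml} [hT : IsBase T] (hA : ACA ⊆ T) :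
    Provable T (.all (.imp (twoLe (.var 0)) (totalColoring (.var 0)))) := by
  refine .allI (.impI (.fallI_of_forall hT.subClosed fun e => .of_worlds fun W hW => ?_))
  have hk : 0 < W.val (.var 0) := by
    have h := World.val_eq_val.2 (hW (twoLe (.var 0)) List.mem_cons_self)
    have : W.val (.succ (.succ .zero)) ≤ W.val (.var 0) := by rwa [World.val_monus] at h
    rw [World.val_succ] at this
    exact (one_pos.trans_le le_add_self).trans_le this
  -- The matrix after the two function quantifiers is arithmetical, so under comprehension it
  -- suffices to make it true in the structure of `W`.
  have har : (Fml.all (totalColoringBody (.var 0))).Arith := by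
    refine ⟨⟨trivial, ?_, trivial⟩, trivial, ?_⟩
    · exact ⟨⟨trivial, trivial⟩, trivial, trivial, ⟨trivial, trivial⟩, trivial, trivial⟩
    · exact ⟨trivial, trivial, ⟨trivial, trivial⟩, trivial, trivial⟩
  refine ((har.strongDec hA).dec.fex W .var (scons e id)).2 ?_
  obtain ⟨f, hf⟩ := World.exists_totalColoring hA e hk
  refine ⟨f, fun i => ?_⟩
  have := hf i
  simp only [totalColoringBody, initialColorable, isColoring, edge, Tm.ren, World.sat_or,
    World.sat_and, World.sat_neg, World.sat_lt, World.sat_le, World.sat_eq, World.sat_ex,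
    World.sat_all, World.sat_imp, World.ev_app, World.ev_pair, World.ev_entry, World.ev_edgeCode,
    World.ev_up, World.ev_var, World.ev_zero, scons_zero, scons_one, scons_two]
  exact this

end IRCA

open IRCA in
theorem mainTheorem7 :
    -- over `iRCA₀`, arithmetical comprehension proves the coloring statement for all `k ≥ 2`
    Provable (IRCA0 ∪ ACA) (.all (.imp (twoLe (.var 0)) (totalColoring (.var 0)))) ∧
    -- `iRCA₀` proves that, for all `k ≥ 2`, the coloring statement implies every instance of
    -- arithmetical comprehension
    (∀ φ : Fml, φ.Arith →
      Provable IRCA0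
        (.all (.imp (twoLe (.var 0)) (.imp (totalColoring (.var 0)) φ.comprehension)))) :=
  ⟨provable_totalColoring Set.subset_union_right,
    fun _ h => provable_comprehension_of_totalColoring h⟩
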